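/- Let $k$ be an algebraically closed field of characteristic $0$, let $X$ be a smooth projective variety over $k$, and let $E$ be a vector bundle on $X$, that is, a locally free $\mathcal O_X$-module of finite rank. Let $A$ range over the Artinian local $k$-algebras with residue field $k$. A deformation of $X$ over $A$ is a flat $A$-scheme $X_A$ together with an isomorphism of $X_A\times_{\operatorname{Spec} A}\operatorname{Spec} k$ with $X$ over $k$; write $i\colon X\to X_A$ for the resulting closed immersion. A deformation over $A$ of the pair $(X,E)$, *with $E$ viewed as a vector bundle*, is a triple $(X_A,F,\varphi)$ consisting of a deformation $X_A$ of $X$, a vector bundle $F$ on $X_A$ and an isomorphism $\varphi\colon i^*F\cong E$. A deformation over $A$ of $(X,E)$, *with $E$ viewed as an object of the derived category*, is a triple $(X_A,F,\varphi)$ consisting of a deformation $X_A$ of $X$, a perfect complex $F\in D(X_A)$ (an object of the derived category of $\mathcal O_{X_A}$-modules which is locally isomorphic to a bounded complex of vector bundles) and an isomorphism $\varphi\colon Li^*F\cong E[0]$ in $D(X)$, where $E[0]$ is $E$ placed in degree $0$. In both cases, an isomorphism $(X_A,F,\varphi)\cong(X'_A,F',\varphi')$ consists of an isomorphism $X_A\cong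 X'_A$ over $A$ inducing the identity of $X$, and an isomorphism of $F$ with the pullback of $F'$ (in the second case, in the derived category) compatible with $\varphi$ and $\varphi'$. Let $\mathrm{Def}^{vb}_{(X,E)}(A)$ and $\mathrm{Def}^{der}_{(X,E)}(A)$ be the sets (in a suitable universe) of isomorphism classes of deformations of the first and of the second kind. They are functors of $A$, through base change of $X_A$ and pullback, respectively derived pullback, of $F$. Then derived base change is well defined on deformations of the second kind (it again gives deformations of the second kind), so that $\mathrm{Def}^{der}_{(X,E)}$ is indeed a functor, and placing a vector bundle in degree $0$, $$(X_A,F,\varphi)\longmapsto (X_A,F[0],\varphi[0]),$$ is well defined and induces an isomorphism of functors $$\mathrm{Def}^{vb}_{(X,E)}\;\cong\;\mathrm{Def}^{der}_{(X,E)}.$$ -/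

import Mathlib

open CategoryTheory Limits AlgebraicGeometry

universe v u

namespace PairDeformation

/-! ### Projective space and vector bundles -/

noncomputable instance (σ R : Type*) [CommSemiring R] :
    GradedRing (MvPolynomial.homogeneousSubmodule σ R) :=
  MvPolynomial.gradedAlgebra

/-- Projective `n`-space over a field `k`, as `Proj k[x₀, …, xₙ]`. -/
noncomputable def projectiveSpace (k : Type u) [Field k] (n : ℕ) : Scheme.{u} :=
  Proj (MvPolynomial.homogeneousSubmodule (Fin (n + 1)) k)

/-- The structure morphism of projective `n`-space over `k`. -/
noncomputable def projectiveSpaceStr (k : Type u) [Field k] (n : ℕ) :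
    projectiveSpace k n ⟶ Spec (.of k) :=
  Proj.toSpecZero (MvPolynomial.homogeneousSubmodule (Fin (n + 1)) k) ≫
    Spec.map (CommRingCat.ofHom
      (algebraMap k (MvPolynomial.homogeneousSubmodule (Fin (n + 1)) k 0)))

/-- A `k`-scheme is projective if it is a closed subscheme of some projective space over `k`. -/
def IsProjective {k : Type u} [Field k] {X : Scheme.{u}} (s : X ⟶ Spec (.of k)) : Prop :=
  ∃ (n : ℕ) (j : X ⟶ projectiveSpace k n), IsClosedImmersion j ∧ j ≫ projectiveSpaceStr k n = s

/-- A vector bundle: a sheaf of modules which is locally free of finite rank. -/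
def IsVectorBundle (X : Scheme.{u}) (M : X.Modules) : Prop :=
  ∀ x : X, ∃ U : X.Opens, x ∈ U ∧ ∃ n : ℕ,
    Nonempty (M.restrict U.ι ≅
      (SheafOfModules.free (ULift.{u} (Fin n)) : (U : Scheme.{u}).Modules))

/-- The pullback of a free sheaf of modules is free. -/
noncomputable def pullbackFree {X Y : Scheme.{u}} (f : X ⟶ Y) (I : Type u) : (Scheme.Modules.pullback f).obj (SheafOfModules.free I : Y.Modules) ≅ (SheafOfModules.free I : X.Modules) := by
  have h : (SheafOfModules.pushforward.{u} f.toRingCatSheafHom).IsRightAdjoint :=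
    (Scheme.Modules.pullbackPushforwardAdjunction f).isRightAdjoint
  have : (TopologicalSpace.Opens.map f.base).Final := by
    refine ⟨fun V => ?_⟩
    have ht : IsTerminal (StructuredArrow.mk (Y := (⊤ : TopologicalSpace.Opens Y)) (S := V)
        (T := TopologicalSpace.Opens.map f.base) (homOfLE le_top)) :=
      IsTerminal.ofUniqueHom (fun W => StructuredArrow.homMk (homOfLE le_top))
        (fun _ _ => by ext; exact Subsingleton.elim _ _)
    exact isConnected_of_isTerminal _ ht
  exact SheafOfModules.pullbackObjFreeIso f.toRingCatSheafHom I

lemma IsVectorBundle.pullback {X Y : Scheme.{u}} (f : X ⟶ Y) {M : Y.Modules} (h : IsVectorBundle Y M) :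
    IsVectorBundle X ((Scheme.Modules.pullback f).obj M) := by
  intro x
  obtain ⟨U, hU, n, ⟨e⟩⟩ := h (f x)
  refine ⟨f ⁻¹ᵁ U, hU, n, ⟨?_⟩⟩
  refine (Scheme.Modules.restrictFunctorIsoPullback (f ⁻¹ᵁ U).ι).app _ ≪≫
    (Scheme.Modules.pullbackComp (f ⁻¹ᵁ U).ι f).app M ≪≫
    (Scheme.Modules.pullbackCongr (morphismRestrict_ι f U).symm).app M ≪≫
    (Scheme.Modules.pullbackComp (f ∣_ U) U.ι).symm.app M ≪≫
    (Scheme.Modules.pullback (f ∣_ U)).mapIso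
      ((Scheme.Modules.restrictFunctorIsoPullback U.ι).symm.app M ≪≫ e) ≪≫ pullbackFree _ _

/-! ### Exactness of restrictions and of pushforwards along homeomorphisms -/

instance restrictFunctor_additive {X Y : Scheme.{u}} (f : X ⟶ Y) [IsOpenImmersion f] :
    (Scheme.Modules.restrictFunctor f).Additive where
  map_add := rfl

instance restrictFunctor_preservesFiniteLimits {X Y : Scheme.{u}} (f : X ⟶ Y) [IsOpenImmersion f] :
    PreservesFiniteLimits (Scheme.Modules.restrictFunctor f) := by
  have : ReflectsFiniteLimits (Scheme.Modules.toPresheaf X) := ⟨fun _ _ _ => inferInstance⟩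
  have h : PreservesFiniteLimits (Scheme.Modules.toPresheaf Y ⋙
      (Functor.whiskeringLeft _ _ Ab.{u}).obj f.opensFunctor.op) := by
    have : PreservesFiniteLimits (Scheme.Modules.toPresheaf Y) := inferInstance
    have : PreservesFiniteLimits ((Functor.whiskeringLeft _ _ Ab.{u}).obj f.opensFunctor.op) :=
      ⟨fun _ _ _ => inferInstance⟩
    exact comp_preservesFiniteLimits _ _
  have : PreservesFiniteLimits
      (Scheme.Modules.restrictFunctor f ⋙ Scheme.Modules.toPresheaf X) := h
  exact preservesFiniteLimits_of_reflects_of_preserves _ (Scheme.Modules.toPresheaf X)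

section toSheaf
variable {C : Type*} [Category* C] {J : GrothendieckTopology C} (R : Sheaf J RingCat.{u})
  [HasSheafify J AddCommGrpCat.{u}]
  [J.WEqualsLocallyBijective AddCommGrpCat.{u}]

lemma epi_of_isZero_cokernel {A : Type*} [Category* A] [Abelian A] {X Y : A} (f : X ⟶ Y)
   (h : IsZero (cokernel f)) : Epi f := Abelian.epi_of_cokernel_π_eq_zero f (h.eq_of_tgt _ _)

/-- The forgetful functor from sheaves of modules to sheaves of abelian groups preserves
epimorphisms. -/
lemma toSheaf_preservesEpi :
    (SheafOfModules.toSheaf.{u} R).PreservesEpimorphisms where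
  preserves {M N} g hg := by
    let L := PresheafOfModules.sheafification.{u} (𝟙 R.obj)
    let h := (SheafOfModules.forget R).map g
    let adj := PresheafOfModules.sheafificationAdjunction.{u} (𝟙 R.obj)
    have hi : IsIso (PresheafOfModules.sheafificationAdjunction.{u} (𝟙 R.obj)).counit :=
      inferInstance
    let e : SheafOfModules.forget R ⋙ L ≅ 𝟭 _ :=
      @asIso _ _ _ _ (PresheafOfModules.sheafificationAdjunction.{u} (𝟙 R.obj)).counit hi
    have : L.IsLeftAdjoint := adj.isLeftAdjoint
    have : PreservesFiniteColimits (PresheafOfModules.toPresheaf.{u} R.obj) := inferInstance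
    have : PreservesFiniteColimits (presheafToSheaf J AddCommGrpCat.{u}) := inferInstance
    have : PreservesFiniteColimits (L ⋙ SheafOfModules.toSheaf R) :=
      comp_preservesFiniteColimits (PresheafOfModules.toPresheaf.{u} R.obj)
        (presheafToSheaf J AddCommGrpCat)
    have : Epi (L.map h) := by
      have h1 : L.map h = e.hom.app M ≫ g ≫ e.inv.app N := by
        have := e.hom.naturality g
        dsimp at this
        rw [← reassoc_of% this]
        simp [h]
      rw [h1]
      infer_instance
    have hz : IsZero (L.obj (cokernel h)) :=
      (isZero_cokernel_of_epi (L.map h)).of_iso (PreservesCokernel.iso L h)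
    have hz' : IsZero ((L ⋙ SheafOfModules.toSheaf R).obj (cokernel h)) :=
      (SheafOfModules.toSheaf R).map_isZero hz
    have : Epi ((L ⋙ SheafOfModules.toSheaf R).map h) := by
      have := hz'.of_iso (PreservesCokernel.iso (L ⋙ SheafOfModules.toSheaf R) h).symm
      exact epi_of_isZero_cokernel _ this
    have h2 : (SheafOfModules.toSheaf R).map g = (SheafOfModules.toSheaf R).map (e.inv.app M) ≫
       (L ⋙ SheafOfModules.toSheaf R).map h ≫ (SheafOfModules.toSheaf R).map (e.hom.app N) := by
        have := e.hom.naturality g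
        dsimp at this
        dsimp only [Functor.comp_map]
        rw [← Functor.map_comp, ← Functor.map_comp, this]
        simp
    rw [h2]
    infer_instance
end toSheaf

/-- A morphism of schemes which is a homeomorphism on the underlying topological spaces. -/
class IsTopIso {X Y : Scheme.{u}} (f : X ⟶ Y) : Prop where
  isHomeomorph : IsHomeomorph f

instance {X Y Z : Scheme.{u}} (f : X ⟶ Y) (g : Y ⟶ Z) [IsTopIso f] [IsTopIso g] : IsTopIso (f ≫ g) where
  isHomeomorph := by
    simpa using IsTopIso.isHomeomorph.comp (IsTopIso.isHomeomorph (f := f))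

instance {X : Scheme.{u}} : IsTopIso (𝟙 X) where
  isHomeomorph := by simpa using IsHomeomorph.id

lemma IsTopIso.of_comp {X Y Z : Scheme.{u}} (f : X ⟶ Y) (g : Y ⟶ Z) [hf : IsTopIso f]
    (h : IsTopIso (f ≫ g)) : IsTopIso g where
  isHomeomorph := by
    have h1 : IsHomeomorph (g ∘ f) := by simpa using h.isHomeomorph
    have h2 := hf.isHomeomorph
    have : (g : Y → Z) = (g ∘ f) ∘ h2.homeomorph.symm := by
      ext y
      obtain ⟨x, rfl⟩ := h2.surjective y
      simp only [Function.comp_apply]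
      congr 2
      exact (h2.homeomorph.symm_apply_apply x).symm
    rw [this]
    exact h1.comp h2.homeomorph.symm.isHomeomorph

lemma sheafPushforward_isLeftAdjoint {X Y : TopCat.{u}} (e : X ≅ Y) :
    (TopCat.Sheaf.pushforward AddCommGrpCat.{u} e.hom).IsLeftAdjoint := by
  have h1 : TopCat.Sheaf.pushforward AddCommGrpCat.{u} e.hom ⋙
    TopCat.Sheaf.pushforward AddCommGrpCat.{u} e.inv = 𝟭 _ := by
    change TopCat.Sheaf.pushforward AddCommGrpCat.{u} (e.hom ≫ e.inv) = _
    rw [e.hom_inv_id]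
    rfl
  have h2 : TopCat.Sheaf.pushforward AddCommGrpCat.{u} e.inv ⋙
    TopCat.Sheaf.pushforward AddCommGrpCat.{u} e.hom = 𝟭 _ := by
    change TopCat.Sheaf.pushforward AddCommGrpCat.{u} (e.inv ≫ e.hom) = _
    rw [e.inv_hom_id]
    rfl
  exact ((CategoryTheory.Equivalence.mk _ _ (eqToIso h1.symm) (eqToIso h2)).toAdjunction).isLeftAdjoint

instance pushforward_preservesFiniteColimits {X Y : Scheme.{u}} (f : X ⟶ Y) [IsTopIso f] :
    PreservesFiniteColimits (Scheme.Modules.pushforward f) := by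
  have hf : IsHomeomorph f.base := IsTopIso.isHomeomorph
  have : (Scheme.Modules.pushforward f).PreservesEpimorphisms := by
    constructor
    intro M N g hg
    have h1 : Epi ((SheafOfModules.toSheaf X.ringCatSheaf).map g) :=
      @Functor.PreservesEpimorphisms.preserves _ _ _ _ _ (toSheaf_preservesEpi X.ringCatSheaf) M N g hg
    have h2 : (TopCat.Sheaf.pushforward AddCommGrpCat.{u} f.base).IsLeftAdjoint :=
      sheafPushforward_isLeftAdjoint (TopCat.isoOfHomeo hf.homeomorph)
    have h3 := @Functor.map_epi _ _ _ _ (TopCat.Sheaf.pushforward AddCommGrpCat.{u} f.base) _ _ _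
      ((SheafOfModules.toSheaf X.ringCatSheaf).map g) h1
    have h4 : Epi ((SheafOfModules.toSheaf Y.ringCatSheaf).map
      ((Scheme.Modules.pushforward f).map g)) := h3
    exact (SheafOfModules.toSheaf Y.ringCatSheaf).epi_of_epi_map h4
  rw [Functor.preservesFiniteColimits_iff_forall_exact_map_and_epi]
  intro S hS
  have := hS.epi_g
  have := hS.mono_f
  refine ⟨((Functor.preservesFiniteLimits_iff_forall_exact_map_and_mono
    (Scheme.Modules.pushforward f)).mp inferInstance S hS).1, ?_⟩
  exact (Scheme.Modules.pushforward f).map_epi S.g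

/-! ### Artinian local algebras -/

/-- An Artinian local `k`-algebra with residue field `k`. -/
structure ArtAlg (k : Type u) [Field k] where
  /-- The underlying type. -/
  carrier : Type u
  [commRing : CommRing carrier]
  [algebra : Algebra k carrier]
  [isLocalRing : IsLocalRing carrier]
  [isArtinianRing : IsArtinianRing carrier]
  bijective_residue : Function.Bijective (algebraMap k (IsLocalRing.ResidueField carrier))

namespace ArtAlg
variable {k : Type u} [Field k]

instance : CoeSort (ArtAlg k) (Type u) := ⟨carrier⟩

attribute [instance] commRing algebra isLocalRing isArtinianRing

/-- The morphisms are all `k`-algebra homomorphisms (they are automatically local). -/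
instance : Category (ArtAlg k) where
  Hom A B := A →ₐ[k] B
  id A := AlgHom.id k A
  comp f g := g.comp f

/-- The ring homomorphism underlying a morphism. -/
def toRingHom {A B : ArtAlg k} (f : A ⟶ B) : (A : Type u) →+* B := AlgHom.toRingHom f

/-- The morphism `Spec B ⟶ Spec A` given by a morphism `A ⟶ B`. -/
noncomputable def specMap {A B : ArtAlg k} (f : A ⟶ B) :
    Spec (.of B) ⟶ Spec (.of A) :=
  Spec.map (CommRingCat.ofHom (toRingHom f))

@[simp] lemma specMap_id (A : ArtAlg k) : specMap (𝟙 A) = 𝟙 _ := Spec.map_id _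

lemma specMap_comp {A B C : ArtAlg k} (f : A ⟶ B) (g : B ⟶ C) :
    specMap (f ≫ g) = specMap g ≫ specMap f :=
  Spec.map_comp (CommRingCat.ofHom (toRingHom f)) (CommRingCat.ofHom (toRingHom g))

/-- The augmentation `A → k`: reduction modulo the maximal ideal. -/
noncomputable def aug (A : ArtAlg k) : A →ₐ[k] k :=
  (AlgEquiv.ofBijective (Algebra.ofId k (IsLocalRing.ResidueField A))
    A.bijective_residue).symm.toAlgHom.comp
      (IsScalarTower.toAlgHom k A (IsLocalRing.ResidueField A))

lemma algHom_ext {A : ArtAlg k} (f g : A →ₐ[k] k) : f = g := by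
  ext a
  have hn : ∀ (f : A →ₐ[k] k) (b : A), b ∈ IsLocalRing.maximalIdeal A → f b = 0 := by
    intro f b hb
    by_contra h
    have hnil : IsNilpotent b := by
      have := IsArtinianRing.isNilpotent_jacobson_bot (R := A)
      rw [IsLocalRing.jacobson_eq_maximalIdeal _ bot_ne_top] at this
      obtain ⟨n, hn⟩ := this
      exact ⟨n, by simpa [hn] using Ideal.pow_mem_pow hb n⟩
    exact h (hnil.map f).eq_zero
  obtain ⟨c, hc⟩ := A.bijective_residue.2 (IsLocalRing.residue A a)
  have hm : a - algebraMap k A c ∈ IsLocalRing.maximalIdeal A := by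
    rw [← IsLocalRing.residue_eq_zero_iff, map_sub, ← hc, sub_eq_zero]
    rfl
  have h1 := hn f _ hm
  have h2 := hn g _ hm
  simp only [map_sub, AlgHom.commutes, sub_eq_zero] at h1 h2
  rw [h1, h2]

/-- The closed point `Spec k ⟶ Spec A`. -/
noncomputable def point (A : ArtAlg k) : Spec (.of k) ⟶ Spec (.of A) :=
  Spec.map (CommRingCat.ofHom A.aug.toRingHom)

lemma point_specMap {A B : ArtAlg k} (f : A ⟶ B) : B.point ≫ specMap f = A.point := by
  have : A.aug = B.aug.comp (f : A →ₐ[k] B) := algHom_ext _ _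
  rw [point, point, specMap, ← Spec.map_comp, this]
  rfl

lemma aug_surjective (A : ArtAlg k) : Function.Surjective A.aug :=
  fun c => ⟨algebraMap k A c, by simp⟩

instance (A : ArtAlg k) : IsClosedImmersion A.point :=
  IsClosedImmersion.spec_of_surjective _ A.aug_surjective

instance (A : ArtAlg k) : Surjective A.point where
  surj := by
    intro y
    have : Subsingleton (PrimeSpectrum A) := by
      refine ⟨fun p q => ?_⟩
      have h (p : PrimeSpectrum A) : p.asIdeal = IsLocalRing.maximalIdeal A :=
        IsLocalRing.eq_maximalIdeal inferInstance
      exact PrimeSpectrum.ext ((h p).trans (h q).symm)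
    obtain ⟨x⟩ : Nonempty (PrimeSpectrum k) := inferInstance
    exact ⟨x, Subsingleton.elim (α := PrimeSpectrum A) _ _⟩

end ArtAlg

/-! ### Functors induced on derived categories by exact functors -/

section derived

universe w₁ w₂ w₃ w₄ v₁ v₂ v₃ v₄ u₁ u₂ u₃ u₄

variable {C₁ : Type u₁} [Category.{v₁} C₁] [Abelian C₁] [HasDerivedCategory.{w₁} C₁]
  {C₂ : Type u₂} [Category.{v₂} C₂] [Abelian C₂] [HasDerivedCategory.{w₂} C₂]
  {C₃ : Type u₃} [Category.{v₃} C₃] [Abelian C₃] [HasDerivedCategory.{w₃} C₃]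

/-- The functors induced on complexes by a composition of additive functors. -/
noncomputable def complexComp {F : C₁ ⥤ C₂} {G : C₂ ⥤ C₃} {H : C₁ ⥤ C₃}
    [F.Additive] [G.Additive] [H.Additive] (e : F ⋙ G ≅ H) :
    F.mapHomologicalComplex (.up ℤ) ⋙ G.mapHomologicalComplex (.up ℤ) ≅
      H.mapHomologicalComplex (.up ℤ) :=
  NatIso.mapHomologicalComplex e (.up ℤ)

/-- An isomorphism `F ⋙ G ≅ H` between exact functors induces one between the functors induced on
the derived categories. -/
noncomputable def derivedComp {F : C₁ ⥤ C₂} {G : C₂ ⥤ C₃} {H : C₁ ⥤ C₃}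
    [F.Additive] [PreservesFiniteLimits F] [PreservesFiniteColimits F]
    [G.Additive] [PreservesFiniteLimits G] [PreservesFiniteColimits G]
    [H.Additive] [PreservesFiniteLimits H] [PreservesFiniteColimits H] (e : F ⋙ G ≅ H) :
    F.mapDerivedCategory ⋙ G.mapDerivedCategory ≅ H.mapDerivedCategory :=
  Localization.liftNatIso DerivedCategory.Q (HomologicalComplex.quasiIso C₁ (.up ℤ))
    (DerivedCategory.Q ⋙ F.mapDerivedCategory ⋙ G.mapDerivedCategory)
    (H.mapHomologicalComplex (.up ℤ) ⋙ DerivedCategory.Q) _ _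
    ((Functor.associator _ _ _).symm ≪≫
      Functor.isoWhiskerRight F.mapDerivedCategoryFactors _ ≪≫ Functor.associator _ _ _ ≪≫
      Functor.isoWhiskerLeft _ G.mapDerivedCategoryFactors ≪≫ (Functor.associator _ _ _).symm ≪≫
      Functor.isoWhiskerRight (complexComp e) _)

lemma derivedComp_hom_app {F : C₁ ⥤ C₂} {G : C₂ ⥤ C₃} {H : C₁ ⥤ C₃}
    [F.Additive] [PreservesFiniteLimits F] [PreservesFiniteColimits F]
    [G.Additive] [PreservesFiniteLimits G] [PreservesFiniteColimits G]
    [H.Additive] [PreservesFiniteLimits H] [PreservesFiniteColimits H] (e : F ⋙ G ≅ H)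
    (K : CochainComplex C₁ ℤ) :
    (derivedComp e).hom.app (DerivedCategory.Q.obj K) =
      G.mapDerivedCategory.map (F.mapDerivedCategoryFactors.hom.app K) ≫
      G.mapDerivedCategoryFactors.hom.app ((F.mapHomologicalComplex _).obj K) ≫
      DerivedCategory.Q.map ((complexComp e).hom.app K) ≫
      H.mapDerivedCategoryFactors.inv.app K := by
  simp [derivedComp, Localization.Lifting.iso]

variable {C₄ : Type u₄} [Category.{v₄} C₄] [Abelian C₄] [HasDerivedCategory.{w₄} C₄]

set_option maxHeartbeats 400000 in
lemma derivedComp_assoc {F : C₁ ⥤ C₂} {G : C₂ ⥤ C₃} {H : C₃ ⥤ C₄} {FG : C₁ ⥤ C₃} {GH : C₂ ⥤ C₄}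
    {FGH : C₁ ⥤ C₄}
    [F.Additive] [PreservesFiniteLimits F] [PreservesFiniteColimits F]
    [G.Additive] [PreservesFiniteLimits G] [PreservesFiniteColimits G]
    [H.Additive] [PreservesFiniteLimits H] [PreservesFiniteColimits H]
    [FG.Additive] [PreservesFiniteLimits FG] [PreservesFiniteColimits FG]
    [GH.Additive] [PreservesFiniteLimits GH] [PreservesFiniteColimits GH]
    [FGH.Additive] [PreservesFiniteLimits FGH] [PreservesFiniteColimits FGH]
    (e₁ : F ⋙ G ≅ FG) (e₂ : FG ⋙ H ≅ FGH) (e₃ : G ⋙ H ≅ GH) (e₄ : F ⋙ GH ≅ FGH)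
    (h : ∀ M, H.map (e₁.hom.app M) ≫ e₂.hom.app M = e₃.hom.app (F.obj M) ≫ e₄.hom.app M)
    (M : DerivedCategory C₁) :
    H.mapDerivedCategory.map ((derivedComp e₁).hom.app M) ≫ (derivedComp e₂).hom.app M =
      (derivedComp e₃).hom.app (F.mapDerivedCategory.obj M) ≫ (derivedComp e₄).hom.app M := by
  let τ : (F.mapDerivedCategory ⋙ G.mapDerivedCategory) ⋙ H.mapDerivedCategory ⟶
      FGH.mapDerivedCategory :=
    Functor.whiskerRight (derivedComp e₁).hom H.mapDerivedCategory ≫ (derivedComp e₂).hom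
  let τ' : (F.mapDerivedCategory ⋙ G.mapDerivedCategory) ⋙ H.mapDerivedCategory ⟶
      FGH.mapDerivedCategory :=
    (Functor.associator _ _ _).hom ≫
      Functor.whiskerLeft F.mapDerivedCategory (derivedComp e₃).hom ≫ (derivedComp e₄).hom
  suffices hτ : τ = τ' by
    have := congr_app hτ M
    simpa [τ, τ'] using this
  refine Localization.natTrans_ext DerivedCategory.Q (HomologicalComplex.quasiIso C₁ (.up ℤ))
    fun K => ?_
  have hn := (derivedComp e₃).hom.naturality (F.mapDerivedCategoryFactors.hom.app K)
  have hH := H.mapDerivedCategoryFactors_hom_naturality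
    ((complexComp e₁).hom.app K)
  have hh : (H.mapHomologicalComplex (.up ℤ)).map
      ((complexComp e₁).hom.app K) ≫
      (complexComp e₂).hom.app K =
      (complexComp e₃).hom.app ((F.mapHomologicalComplex _).obj K) ≫
      (complexComp e₄).hom.app K := by
    ext n
    exact h _
  have hhQ := congrArg DerivedCategory.Q.map hh
  simp only [Functor.map_comp] at hhQ
  have hn' : (derivedComp e₃).hom.app (F.mapDerivedCategory.obj (DerivedCategory.Q.obj K)) ≫
      GH.mapDerivedCategory.map (F.mapDerivedCategoryFactors.hom.app K) =
      H.mapDerivedCategory.map (G.mapDerivedCategory.map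
        (F.mapDerivedCategoryFactors.hom.app K)) ≫
      (derivedComp e₃).hom.app (DerivedCategory.Q.obj ((F.mapHomologicalComplex (.up ℤ)).obj K)) :=
    hn.symm
  rw [derivedComp_hom_app] at hn'
  have h4 := derivedComp_hom_app e₄ K
  have h2 := derivedComp_hom_app e₂ K
  have h1 := derivedComp_hom_app e₁ K
  change H.mapDerivedCategory.map ((derivedComp e₁).hom.app (DerivedCategory.Q.obj K)) ≫
    (derivedComp e₂).hom.app (DerivedCategory.Q.obj K) = 𝟙 _ ≫
      (derivedComp e₃).hom.app (F.mapDerivedCategory.obj (DerivedCategory.Q.obj K)) ≫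
        (derivedComp e₄).hom.app (DerivedCategory.Q.obj K)
  rw [h1, h2, h4, Category.id_comp, reassoc_of% hn']
  simp only [Functor.map_comp, Category.assoc]
  congr 2
  rw [← Functor.map_comp_assoc H.mapDerivedCategory (FG.mapDerivedCategoryFactors.inv.app K),
    Iso.inv_hom_id_app]
  rw [Iso.inv_hom_id_app_assoc]
  erw [CategoryTheory.Functor.map_id, Category.id_comp, reassoc_of% hH, reassoc_of% hhQ]
/-- An exact endofunctor isomorphic to the identity induces the identity on derived categories,
up to isomorphism. -/
noncomputable def derivedUnit {I : C₁ ⥤ C₁} [I.Additive] [PreservesFiniteLimits I]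
    [PreservesFiniteColimits I] (ε : I ≅ 𝟭 C₁) : I.mapDerivedCategory ≅ 𝟭 _ :=
  Localization.liftNatIso DerivedCategory.Q (HomologicalComplex.quasiIso C₁ (.up ℤ))
    (I.mapHomologicalComplex (.up ℤ) ⋙ DerivedCategory.Q)
    (DerivedCategory.Q) _ _
    (Functor.isoWhiskerRight (NatIso.mapHomologicalComplex ε (.up ℤ) ≪≫
      Functor.mapHomologicalComplexIdIso C₁ (.up ℤ)) DerivedCategory.Q ≪≫ Functor.leftUnitor _)

lemma derivedUnit_hom_app {I : C₁ ⥤ C₁} [I.Additive] [PreservesFiniteLimits I]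
    [PreservesFiniteColimits I] (ε : I ≅ 𝟭 C₁) (K : CochainComplex C₁ ℤ) :
    (derivedUnit ε).hom.app (DerivedCategory.Q.obj K) = I.mapDerivedCategoryFactors.hom.app K ≫
      DerivedCategory.Q.map ((NatIso.mapHomologicalComplex ε (.up ℤ) ≪≫
      Functor.mapHomologicalComplexIdIso C₁ (.up ℤ)).hom.app K) := by
  simp [derivedUnit, Localization.Lifting.iso]

lemma derivedComp_unit {F : C₁ ⥤ C₂} {I : C₂ ⥤ C₂}
    [F.Additive] [PreservesFiniteLimits F] [PreservesFiniteColimits F]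
    [I.Additive] [PreservesFiniteLimits I] [PreservesFiniteColimits I]
    (e : F ⋙ I ≅ F) (ε : I ≅ 𝟭 C₂) (h : ∀ M, e.hom.app M = ε.hom.app (F.obj M))
    (M : DerivedCategory C₁) :
    (derivedComp e).hom.app M = (derivedUnit ε).hom.app (F.mapDerivedCategory.obj M) := by
  let τ : F.mapDerivedCategory ⋙ I.mapDerivedCategory ⟶ F.mapDerivedCategory :=
    Functor.whiskerLeft F.mapDerivedCategory (derivedUnit ε).hom ≫ (Functor.rightUnitor _).hom
  suffices hτ : (derivedComp e).hom = τ by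
    have := congr_app hτ M
    simpa [τ] using this
  refine Localization.natTrans_ext DerivedCategory.Q (HomologicalComplex.quasiIso C₁ (.up ℤ))
    fun K => ?_
  have hn : I.mapDerivedCategory.map (F.mapDerivedCategoryFactors.hom.app K) ≫
      (derivedUnit ε).hom.app (DerivedCategory.Q.obj ((F.mapHomologicalComplex (.up ℤ)).obj K)) =
    (derivedUnit ε).hom.app (F.mapDerivedCategory.obj (DerivedCategory.Q.obj K)) ≫
      F.mapDerivedCategoryFactors.hom.app K :=
    (derivedUnit ε).hom.naturality (F.mapDerivedCategoryFactors.hom.app K)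
  have hh : (complexComp e).hom.app K = (NatIso.mapHomologicalComplex ε (.up ℤ) ≪≫
      Functor.mapHomologicalComplexIdIso C₂ (.up ℤ)).hom.app
        ((F.mapHomologicalComplex (.up ℤ)).obj K) := by
    ext n
    exact (h _).trans (Category.comp_id _).symm
  rw [derivedComp_hom_app, hh]
  change _ = (derivedUnit ε).hom.app (F.mapDerivedCategory.obj (DerivedCategory.Q.obj K)) ≫ 𝟙 _
  rw [Category.comp_id, ← cancel_mono (F.mapDerivedCategoryFactors.hom.app K), ← hn,
    derivedUnit_hom_app]
  simp only [Category.assoc, Iso.inv_hom_id_app]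
  congr 2
  exact Category.comp_id _

end derived
/-- The derived category of all sheaves of modules on a scheme. -/
noncomputable instance (X : Scheme.{u}) : HasDerivedCategory.{u + 1} X.Modules :=
  HasDerivedCategory.standard _

/-- A perfect complex: an object of the derived category which is locally isomorphic to a bounded
complex of locally free sheaves of finite rank. -/
def IsPerfect (X : Scheme.{u}) (F : DerivedCategory X.Modules) : Prop :=
  ∀ x : X, ∃ U : X.Opens, x ∈ U ∧ ∃ P : CochainComplex (U : Scheme.{u}).Modules ℤ,
    (∃ a b : ℤ, ∀ n : ℤ, n < a ∨ b < n → IsZero (P.X n)) ∧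
    (∀ n : ℤ, IsVectorBundle (U : Scheme.{u}) (P.X n)) ∧
    Nonempty ((Scheme.Modules.restrictFunctor U.ι).mapDerivedCategory.obj F ≅
      DerivedCategory.Q.obj P)

/-! ### Universal arrows -/

/-- `a : F ⟶ R G` is universal: it exhibits `G` as the value at `F` of the (partially defined)
left adjoint of `R`. If `R` is the pushforward `f_*` of sheaves of modules, then this says that `a`
is adjoint to an isomorphism `f^* F ≅ G` (see `isUniversalArrow_pushforward_iff`); if `R` is the
derived pushforward `Rf_*` between derived categories, then it says that `a` is adjoint to an
isomorphism `Lf^* F ≅ G`, where `Lf^*` is the derived pullback, the left adjoint of `Rf_*`. -/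
def IsUniversalArrow {C D : Type*} [Category* C] [Category* D] (R : D ⥤ C) {F : C} {G : D}
    (a : F ⟶ R.obj G) : Prop :=
  ∀ T : D, Function.Bijective fun g : G ⟶ T => a ≫ R.map g

lemma IsUniversalArrow.iff_of_comp {C D E : Type*} [Category* C] [Category* D] [Category* E]
    {R : D ⥤ C} {S : E ⥤ D} {Q : E ⥤ C} (κ : S ⋙ R ≅ Q) {F : C} {G : D} {H : E}
    {a : F ⟶ R.obj G} (ha : IsUniversalArrow R a) (b : G ⟶ S.obj H) :
    IsUniversalArrow Q (a ≫ R.map b ≫ κ.hom.app H) ↔ IsUniversalArrow S b := by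
  refine forall_congr' fun T => ?_
  have h1 : Function.Bijective fun t : F ⟶ (S ⋙ R).obj T => t ≫ κ.hom.app T :=
    ((κ.app T).homToEquiv (Z := F)).bijective
  have h2 := h1.comp (ha (S.obj T))
  rw [← h2.of_comp_iff']
  refine iff_of_eq (congrArg _ (funext fun g => ?_))
  have := κ.hom.naturality g
  dsimp at this ⊢
  simp [this]

set_option linter.checkUnivs false in
/-- A category `Cat X` for every scheme `X`, with pushforward functors along the morphisms that are
homeomorphisms, which are compatible with identities and compositions up to coherent isomorphisms.
The two cases of interest are `modulesTheory` and `derivedTheory` below; the structure only serves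
to treat them at the same time. -/
structure PushforwardTheory where
  /-- The category of objects on a scheme. -/
  Cat : Scheme.{u} → Type (u + 1)
  [category : ∀ X, Category.{v} (Cat X)]
  /-- The pushforward along a morphism which is a homeomorphism. -/
  push {X Y : Scheme.{u}} (f : X ⟶ Y) [IsTopIso f] : Cat X ⥤ Cat Y
  /-- The pushforward along the identity is isomorphic to the identity. -/
  pushId (X : Scheme.{u}) : push (𝟙 X) ≅ 𝟭 _
  /-- The composition of two pushforwards is isomorphic to the pushforward. -/
  pushComp {X Y Z : Scheme.{u}} (f : X ⟶ Y) (g : Y ⟶ Z) (h : X ⟶ Z)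
    [IsTopIso f] [IsTopIso g] [IsTopIso h] (w : f ≫ g = h) : push f ⋙ push g ≅ push h
  pushComp_id {X Y : Scheme.{u}} (f : X ⟶ Y) [IsTopIso f] (M : Cat X) :
    (pushComp f (𝟙 Y) f (Category.comp_id f)).hom.app M = (pushId Y).hom.app ((push f).obj M)
  pushComp_assoc {X Y Z W : Scheme.{u}} (f : X ⟶ Y) (g : Y ⟶ Z) (h : Z ⟶ W) (fg : X ⟶ Z)
    (gh : Y ⟶ W) (fgh : X ⟶ W) [IsTopIso f] [IsTopIso g] [IsTopIso h] [IsTopIso fg]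
    [IsTopIso gh] [IsTopIso fgh] (w₁ : f ≫ g = fg) (w₂ : fg ≫ h = fgh) (w₃ : g ≫ h = gh)
    (w₄ : f ≫ gh = fgh) (M : Cat X) :
    (push h).map ((pushComp f g fg w₁).hom.app M) ≫ (pushComp fg h fgh w₂).hom.app M =
      (pushComp g h gh w₃).hom.app ((push f).obj M) ≫ (pushComp f gh fgh w₄).hom.app M

attribute [instance] PushforwardTheory.category

/-- The canonical isomorphism `g_* f_* ≅ h_*` for `h = g ∘ f`. -/
noncomputable def modulesPushComp {X Y Z : Scheme.{u}} (f : X ⟶ Y) (g : Y ⟶ Z) (h : X ⟶ Z)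
    (w : f ≫ g = h) :
    Scheme.Modules.pushforward f ⋙ Scheme.Modules.pushforward g ≅ Scheme.Modules.pushforward h :=
  Scheme.Modules.pushforwardComp f g ≪≫ Scheme.Modules.pushforwardCongr w

lemma modulesPushComp_id {X Y : Scheme.{u}} (f : X ⟶ Y) (M : X.Modules) :
    (modulesPushComp f (𝟙 Y) f (Category.comp_id f)).hom.app M =
      (Scheme.Modules.pushforwardId Y).hom.app ((Scheme.Modules.pushforward f).obj M) := by
  ext U : 1
  simp only [modulesPushComp, Iso.trans_hom, NatTrans.comp_app, Scheme.Modules.Hom.comp_app,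
    Scheme.Modules.pushforwardComp_hom_app_app, Scheme.Modules.pushforwardCongr_hom_app_app,
    Scheme.Modules.pushforwardId_hom_app_app]
  exact (Category.id_comp _).trans (M.presheaf.map_id _)

lemma modulesPushComp_assoc {X Y Z W : Scheme.{u}} (f : X ⟶ Y) (g : Y ⟶ Z) (h : Z ⟶ W) (fg : X ⟶ Z)
    (gh : Y ⟶ W) (fgh : X ⟶ W) (w₁ : f ≫ g = fg) (w₂ : fg ≫ h = fgh) (w₃ : g ≫ h = gh)
    (w₄ : f ≫ gh = fgh) (M : X.Modules) :
    (Scheme.Modules.pushforward h).map ((modulesPushComp f g fg w₁).hom.app M) ≫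
      (modulesPushComp fg h fgh w₂).hom.app M =
    (modulesPushComp g h gh w₃).hom.app ((Scheme.Modules.pushforward f).obj M) ≫
      (modulesPushComp f gh fgh w₄).hom.app M := by
  subst w₁ w₃ w₄
  ext U : 1
  simp [modulesPushComp]
  rfl

/-- Sheaves of modules and their pushforwards. -/
noncomputable def modulesTheory : PushforwardTheory.{u, u} where
  Cat X := X.Modules
  push f := Scheme.Modules.pushforward f
  pushId X := Scheme.Modules.pushforwardId X
  pushComp f g h _ _ _ w := modulesPushComp f g h w
  pushComp_id f _ M := modulesPushComp_id f M
  pushComp_assoc := by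
    intros
    apply modulesPushComp_assoc

/-- Derived categories of sheaves of modules and derived pushforwards. The pushforward along a
homeomorphism is exact, and hence the derived pushforward is obtained by applying it termwise. -/
noncomputable def derivedTheory : PushforwardTheory.{u + 1, u} where
  Cat X := DerivedCategory X.Modules
  push f := (Scheme.Modules.pushforward f).mapDerivedCategory
  pushId X := derivedUnit (Scheme.Modules.pushforwardId X)
  pushComp f g h _ _ _ w := derivedComp (modulesPushComp f g h w)
  pushComp_id f _ M := derivedComp_unit _ _ (modulesPushComp_id f) M
  pushComp_assoc := by
    intros
    apply derivedComp_assoc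
    intro
    apply modulesPushComp_assoc

/-! ### Deformations of schemes -/

variable {k : Type u} [Field k] {X : Scheme.{u}} 

/-- A flat deformation of `s : X ⟶ Spec k` over `A`: a flat `A`-scheme `total`, together with a
cartesian square which identifies its restriction to the closed point `Spec k ⟶ Spec A` with
`X`. -/
structure SchemeDeformation (s : X ⟶ Spec (.of k)) (A : ArtAlg k) where
  total : Scheme.{u}
  π : total ⟶ Spec (.of A)
  flat : Flat π
  i : X ⟶ total
  isPullback : IsPullback i s π A.point

lemma isTopIso_of_closedImmersion {X Y : Scheme.{u}} (f : X ⟶ Y) [IsClosedImmersion f]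
    [Surjective f] : IsTopIso f where
  isHomeomorph := by
    have h := f.isClosedEmbedding
    exact isHomeomorph_iff_isEmbedding_surjective.mpr ⟨h.isEmbedding, f.surjective⟩

namespace SchemeDeformation
variable {s : X ⟶ Spec (.of k)}

instance {A : ArtAlg k} (x : SchemeDeformation s A) : IsTopIso x.i := by
  have : IsClosedImmersion x.i := MorphismProperty.of_isPullback x.isPullback.flip inferInstance
  have : Surjective x.i := MorphismProperty.of_isPullback x.isPullback.flip inferInstance
  exact isTopIso_of_closedImmersion _

/-- A morphism from the deformation `y` over `B` to the deformation `x` over `A`, along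
`f : A ⟶ B`: a cartesian square over `Spec B ⟶ Spec A` which is compatible with the inclusions of
`X`. It identifies `y` with the base change of `x`. -/
structure Hom {A B : ArtAlg k} (f : A ⟶ B) (x : SchemeDeformation s A)
    (y : SchemeDeformation s B) where
  p : y.total ⟶ x.total
  isPullback : IsPullback p y.π x.π (ArtAlg.specMap f)
  comm : y.i ≫ p = x.i

variable {A B C : ArtAlg k} {f : A ⟶ B} {g : B ⟶ C} {x : SchemeDeformation s A}
    {y : SchemeDeformation s B} {z : SchemeDeformation s C}

instance (φ : Hom f x y) : IsTopIso φ.p := 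
  IsTopIso.of_comp y.i φ.p (by rw [φ.comm]; infer_instance)

/-- The identity of a deformation. -/
@[simps] def Hom.id (x : SchemeDeformation s A) : Hom (𝟙 A) x x where
  p := 𝟙 _
  isPullback := by rw [ArtAlg.specMap_id]; exact IsPullback.of_horiz_isIso ⟨by simp⟩
  comm := by simp

/-- The composition of morphisms of deformations. -/
@[simps] def Hom.comp (φ : Hom f x y) (ψ : Hom g y z) : Hom (f ≫ g) x z where
  p := ψ.p ≫ φ.p
  isPullback := by rw [ArtAlg.specMap_comp]; exact ψ.isPullback.paste_horiz φ.isPullback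
  comm := by rw [← Category.assoc, ψ.comm, φ.comm]

lemma Hom.exists_factor {y' : SchemeDeformation s B} (φ : Hom f x y) (φ' : Hom f x y') :
    ∃ χ : Hom (𝟙 B) y y', χ.p ≫ φ.p = φ'.p := by
  let e := φ'.isPullback.isoIsPullback _ _ φ.isPullback
  have h1 : e.hom ≫ φ.p = φ'.p := by simp [e]
  have h2 : e.hom ≫ y.π = y'.π := by simp [e]
  refine ⟨⟨e.hom, ?_, ?_⟩, h1⟩
  · rw [ArtAlg.specMap_id]; exact IsPullback.of_horiz_isIso ⟨by simp [h2]⟩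
  · apply φ.isPullback.hom_ext
    · rw [Category.assoc, h1, φ.comm, φ'.comm]
    · rw [Category.assoc, h2, y.isPullback.w, y'.isPullback.w]

lemma exists_hom (f : A ⟶ B) (x : SchemeDeformation s A) :
    ∃ y : SchemeDeformation s B, Nonempty (Hom f x y) := by
  have w : x.i ≫ x.π = (s ≫ B.point) ≫ ArtAlg.specMap f := by
    rw [Category.assoc, ArtAlg.point_specMap, x.isPullback.w]
  have hp := IsPullback.of_hasPullback x.π (ArtAlg.specMap f)
  have := x.flat
  refine ⟨⟨pullback x.π (ArtAlg.specMap f), pullback.snd _ _, inferInstance,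
    hp.lift x.i (s ≫ B.point) w, ?_⟩, ⟨⟨pullback.fst _ _, hp, hp.lift_fst _ _ _⟩⟩⟩
  refine IsPullback.of_right (h₁₂ := pullback.fst _ _) (h₂₂ := ArtAlg.specMap f) (v₁₃ := x.π) ?_
    (hp.lift_snd _ _ _) hp
  rw [ArtAlg.point_specMap, hp.lift_fst]
  exact x.isPullback

end SchemeDeformation
/-! ### Deformations of pairs -/

/-- A deformation over `A` of the pair `(X, E)`, where `E` is an object of the theory `T`:
a flat deformation of `X`, together with an object `F` on it which satisfies `P` (being a vector
bundle, or being perfect) and an identification of `E` with the (derived) pullback of `F` along the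
inclusion `i` of `X`, given as the adjoint arrow `ρ : F ⟶ i_* E`. -/
structure Deformation (T : PushforwardTheory.{v, u}) (P : ∀ Y : Scheme.{u}, T.Cat Y → Prop)
    (s : X ⟶ Spec (.of k)) (E : T.Cat X) (A : ArtAlg k) where
  /-- The deformation of `X`. -/
  base : SchemeDeformation s A
  /-- The deformation of `E`. -/
  F : T.Cat base.total
  prop : P base.total F
  /-- The arrow adjoint to the identification of the restriction of `F` with `E`. -/
  ρ : F ⟶ (T.push base.i).obj E
  isUniversal : IsUniversalArrow (T.push base.i) ρ

namespace Deformation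

variable {T : PushforwardTheory.{v, u}} {P : ∀ Y : Scheme.{u}, T.Cat Y → Prop}
  {s : X ⟶ Spec (.of k)} {E : T.Cat X} {A B C : ArtAlg k}

/-- `Arrow f x y` says that the deformation `y` over `B` is isomorphic to the base change along
`f : A ⟶ B` of the deformation `x` over `A`: there are a cartesian square `p : y.total ⟶ x.total`
over `Spec B ⟶ Spec A` and an identification of `y.F` with the (derived) pullback of `x.F` along
`p`, given as the adjoint arrow `a : x.F ⟶ p_* y.F`, both compatible with the identifications of
the restrictions to `X` with `X` and `E`. -/
def Arrow (f : A ⟶ B) (x : Deformation T P s E A) (y : Deformation T P s E B) : Prop :=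
  ∃ (φ : SchemeDeformation.Hom f x.base y.base)
    (a : x.F ⟶ (T.push φ.p).obj y.F), IsUniversalArrow (T.push φ.p) a ∧
      a ≫ (T.push φ.p).map y.ρ ≫ (T.pushComp y.base.i φ.p x.base.i φ.comm).hom.app E = x.ρ

lemma Arrow.refl (x : Deformation T P s E A) : Arrow (𝟙 A) x x := by
  refine ⟨.id _, (T.pushId _).inv.app x.F, fun G => ?_, ?_⟩
  · have h : (fun g : x.F ⟶ G => (T.pushId _).inv.app x.F ≫ (T.push (𝟙 _)).map g) =
        ((T.pushId _).symm.app G).homToEquiv (Z := x.F) := by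
      funext g
      exact ((T.pushId _).inv.naturality g).symm
    exact h ▸ Equiv.bijective _
  · have h1 := (T.pushId x.base.total).inv.naturality x.ρ
    have h2 := T.pushComp_id x.base.i E
    change (T.pushId _).inv.app x.F ≫ (T.push (𝟙 x.base.total)).map x.ρ ≫
      (T.pushComp x.base.i (𝟙 x.base.total) x.base.i (Category.comp_id _)).hom.app E = x.ρ
    dsimp only [Functor.id_map, Functor.id_obj] at h1
    rw [h2, ← reassoc_of% h1]
    simp

lemma Arrow.comp {f : A ⟶ B} {g : B ⟶ C} {x : Deformation T P s E A}
    {y : Deformation T P s E B} {z : Deformation T P s E C} (h : Arrow f x y) (h' : Arrow g y z) :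
    Arrow (f ≫ g) x z := by
  obtain ⟨φ, a, ha, hφ⟩ := h
  obtain ⟨ψ, b, hb, hψ⟩ := h'
  have : IsTopIso (ψ.p ≫ φ.p) := inferInstance
  refine ⟨φ.comp ψ, a ≫ (T.push φ.p).map b ≫ (T.pushComp ψ.p φ.p (ψ.p ≫ φ.p) rfl).hom.app z.F,
    (ha.iff_of_comp _ b).mpr hb, ?_⟩
  have hn := (T.pushComp ψ.p φ.p (ψ.p ≫ φ.p) rfl).hom.naturality z.ρ
  have has := T.pushComp_assoc z.base.i ψ.p φ.p y.base.i (ψ.p ≫ φ.p) x.base.i ψ.comm φ.comm rfl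
    (φ.comp ψ).comm E
  change (a ≫ (T.push φ.p).map b ≫ (T.pushComp ψ.p φ.p (ψ.p ≫ φ.p) rfl).hom.app z.F) ≫
    (T.push (ψ.p ≫ φ.p)).map z.ρ ≫
      (T.pushComp z.base.i (ψ.p ≫ φ.p) x.base.i (φ.comp ψ).comm).hom.app E = x.ρ
  dsimp only [Functor.comp_map, Functor.comp_obj] at hn
  simp only [Category.assoc]
  rw [← reassoc_of% hn, ← has, ← hφ, ← hψ]
  simp

lemma Arrow.unique {f : A ⟶ B} {x : Deformation T P s E A} {y y' : Deformation T P s E B}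
    (h : Arrow f x y) (h' : Arrow f x y') : Arrow (𝟙 B) y y' := by
  obtain ⟨φ, a, ha, hφ⟩ := h
  obtain ⟨φ', a', ha', hφ'⟩ := h'
  obtain ⟨χ, hχ⟩ := φ.exists_factor φ'
  obtain ⟨b, hb⟩ := (ha _).2 (a' ≫ (T.pushComp χ.p φ.p φ'.p hχ).inv.app y'.F)
  dsimp only at hb
  have hb' : a ≫ (T.push φ.p).map b ≫ (T.pushComp χ.p φ.p φ'.p hχ).hom.app y'.F = a' := by
    rw [reassoc_of% hb]
    simp
  refine ⟨χ, b, ?_, ?_⟩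
  · rw [← ha.iff_of_comp (T.pushComp χ.p φ.p φ'.p hχ), hb']
    exact ha'
  · apply (ha _).1
    dsimp only
    have hn := (T.pushComp χ.p φ.p φ'.p hχ).hom.naturality y'.ρ
    have has := T.pushComp_assoc y'.base.i χ.p φ.p y.base.i φ'.p x.base.i χ.comm φ.comm hχ φ'.comm E
    rw [← cancel_mono ((T.pushComp y.base.i φ.p x.base.i φ.comm).hom.app E)]
    simp only [Functor.map_comp, Category.assoc]
    rw [has, hφ, ← hφ', ← hb']
    dsimp at hn
    simp [reassoc_of% hn]

lemma exists_arrow {f : A ⟶ B} (x : Deformation T P s E A) {y : SchemeDeformation s B}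
    (φ : SchemeDeformation.Hom f x.base y) {G : T.Cat y.total} (hG : P _ G)
    (a : x.F ⟶ (T.push φ.p).obj G) (ha : IsUniversalArrow (T.push φ.p) a) :
    ∃ y : Deformation T P s E B, Arrow f x y := by
  obtain ⟨ρ, hρ⟩ := (ha _).2 (x.ρ ≫ (T.pushComp y.i φ.p x.base.i φ.comm).inv.app E)
  dsimp only at hρ
  have hρ' : a ≫ (T.push φ.p).map ρ ≫ (T.pushComp y.i φ.p x.base.i φ.comm).hom.app E = x.ρ := by
    rw [reassoc_of% hρ]
    simp
  refine ⟨⟨y, G, hG, ρ, ?_⟩, φ, a, ha, hρ'⟩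
  rw [← ha.iff_of_comp (T.pushComp y.i φ.p x.base.i φ.comm), hρ']
  exact x.isUniversal

variable (T P s E) in
/-- Two deformations over `A` are isomorphic if there is an arrow over the identity of `A`; this
amounts to an isomorphism of the schemes over `A` and an isomorphism of the objects on them which are
compatible with the identifications over `X`. -/
def setoid (A : ArtAlg k) : Setoid (Deformation T P s E A) where
  r x y := Arrow (𝟙 A) x y
  iseqv := ⟨Arrow.refl, fun {x _} h => h.unique (Arrow.refl x),
    fun h h' => by simpa using h.comp h'⟩

variable (T P s E) in
/-- All deformations of the pair have base changes along all morphisms `A ⟶ B`. (The base changes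
are unique up to isomorphism by `Arrow.unique`.) -/
def HasBaseChange : Prop :=
  ∀ ⦃A B : ArtAlg k⦄ (f : A ⟶ B) (x : Deformation T P s E A),
    ∃ y : Deformation T P s E B, Arrow f x y

/-- The local deformation functor of the pair `(X, E)`: it sends `A` to the set of isomorphism
classes of deformations of `(X, E)` over `A`, and `A ⟶ B` to the base change. -/
noncomputable def functor (h : HasBaseChange T P s E) : ArtAlg k ⥤ Type (max (u + 1) v) where
  obj A := Quotient (setoid T P s E A)
  map {A B} f := TypeCat.ofHom (Quotient.map (fun x => (h f x).choose) (by
    intro x x' hx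
    have h1 := (h f x).choose_spec
    have h2 : Arrow f x (h f x').choose := by simpa using Arrow.comp hx (h f x').choose_spec
    exact h1.unique h2))
  map_id A := by
    ext x
    induction x using Quotient.inductionOn with
    | _ x => exact (Quotient.sound (s := setoid T P s E A) (h (𝟙 A) x).choose_spec).symm
  map_comp {A B C} f g := by
    ext x
    induction x using Quotient.inductionOn with
    | _ x =>
      exact Quotient.sound (s := setoid T P s E C) ((h (f ≫ g) x).choose_spec.unique
        ((h f x).choose_spec.comp (h g _).choose_spec))

end Deformation

/-- For sheaves of modules, an arrow `M ⟶ f_* N` is universal if and only if the adjoint morphism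
`f^* M ⟶ N` is an isomorphism. -/
lemma isUniversalArrow_pushforward_iff {Y Z : Scheme.{u}} (f : Y ⟶ Z) {M : Z.Modules}
    {N : Y.Modules} (a : M ⟶ (Scheme.Modules.pushforward f).obj N) :
    IsUniversalArrow (Scheme.Modules.pushforward f) a ↔
      IsIso (((Scheme.Modules.pullbackPushforwardAdjunction f).homEquiv M N).symm a) := by
  let adj := Scheme.Modules.pullbackPushforwardAdjunction f
  have h (T : Y.Modules) : Function.Bijective (fun g : N ⟶ T =>
      a ≫ (Scheme.Modules.pushforward f).map g) ↔
      Function.Bijective (fun g : N ⟶ T => (adj.homEquiv M N).symm a ≫ g) := by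
    rw [← (adj.homEquiv M T).bijective.of_comp_iff']
    refine iff_of_eq (congrArg _ (funext fun g => ?_))
    simp [Adjunction.homEquiv_naturality_right]
  unfold IsUniversalArrow
  simp only [h]
  exact (isIso_iff_coyoneda_map_bijective _).symm

/-- Deformations of `(X, E)` with `E` a vector bundle have base changes, given by the pullback. -/
lemma hasBaseChange_vectorBundle (s : X ⟶ Spec (.of k)) (E : X.Modules) :
    Deformation.HasBaseChange modulesTheory.{u} IsVectorBundle s E := by
  intro A B f x
  obtain ⟨y, ⟨φ⟩⟩ := SchemeDeformation.exists_hom f x.base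
  let M : x.base.total.Modules := x.F
  let a : M ⟶ (Scheme.Modules.pushforward φ.p).obj ((Scheme.Modules.pullback φ.p).obj M) :=
    (Scheme.Modules.pullbackPushforwardAdjunction φ.p).unit.app M
  have ha : IsUniversalArrow (modulesTheory.push φ.p) a := by
    refine (isUniversalArrow_pushforward_iff φ.p a).mpr ?_
    simp only [a, ← Adjunction.homEquiv_id, Equiv.symm_apply_apply]
    infer_instance
  exact x.exists_arrow φ (IsVectorBundle.pullback φ.p x.prop) a ha

/-- The local deformation functor of the pair `(X, E)`, where `E` is treated as a vector bundle. -/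
noncomputable def vectorBundleDeformationFunctor (s : X ⟶ Spec (.of k)) (E : X.Modules) :
    ArtAlg k ⥤ Type (u + 1) :=
  Deformation.functor (hasBaseChange_vectorBundle s E)

/-- The sheaf of modules `M`, as a complex concentrated in degree `0`. -/
noncomputable abbrev inDegreeZero {Y : Scheme.{u}} (M : Y.Modules) : DerivedCategory Y.Modules :=
  (DerivedCategory.singleFunctor Y.Modules 0).obj M

/-- The local deformation functor of the pair `(X, E)`, where `E` is treated as an object of
the derived category: deformations of `E` are perfect complexes whose derived restriction to `X` is
identified with `E`. The functoriality is the derived base change, which exists by `h`. -/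
noncomputable def derivedDeformationFunctor (s : X ⟶ Spec (.of k)) (E : X.Modules)
    (h : Deformation.HasBaseChange derivedTheory.{u} IsPerfect s (inDegreeZero E)) :
    ArtAlg k ⥤ Type (u + 1) :=
  Deformation.functor h

/-- A morphism `M ⟶ i_* N` of sheaves of modules, as a morphism of complexes concentrated in
degree `0`. -/
noncomputable def arrowInDegreeZero {Y Z : Scheme.{u}} (i : Y ⟶ Z) [IsTopIso i] {M : Z.Modules}
    {N : Y.Modules} (a : M ⟶ (Scheme.Modules.pushforward i).obj N) :
    inDegreeZero M ⟶ (derivedTheory.push i).obj (inDegreeZero N) :=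
  (DerivedCategory.singleFunctor Z.Modules 0).map a ≫
    ((Scheme.Modules.pushforward i).mapDerivedCategorySingleFunctor 0).inv.app N

end PairDeformation

open PairDeformation

/-!
Deforming a vector bundle `E` on `X` as a vector bundle is the same as deforming it as a perfect
complex. Let `i : X ⟶ Y` be the inclusion into a deformation over an Artinian algebra; it is a
homeomorphism whose ideal is nilpotent on stalks (`isThickening_of_isPullback`).

*A bundle is a derived deformation.* Let `M` be a vector bundle on `Y`. Its derived pullback is
its pullback, because `M` is locally free; in the language of universal arrows this is
`isUniversalArrow_arrowInDegreeZero`. Conversely, since modules embed fully faithfully into the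
derived category, an arrow between modules which is universal in the derived category is universal
for modules (`isUniversalArrow_of_arrowInDegreeZero`).

*Every derived deformation is a bundle* (`exists_isVectorBundle_of_isPerfect`). Let `F` be perfect on
`Y` with `Li^* F = E`. As `Y` is quasi-compact, `F` is bounded above. For a thickening, Nakayama's
lemma holds for all sheaves of modules (`isZero_of_isZero_pullback`), so the highest nonzero
cohomology sheaf of `F` cannot be killed by `i^*`, and `F` lives in degrees `≤ 0`
(`isLE_of_isUniversalArrow`). Represent `F` by a complex `K` in degrees `≤ 0` whose terms are adapted
to `i^*`. Locally on `X` the bundle `E` is free, and since `K⁰ ⟶ i_* i^* K⁰` (`epi_unit_app`) and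
`i^* K⁰ ⟶ E` are epimorphisms, a basis of `E` lifts locally to `K⁰` (`exists_local_lift_free`). The
resulting morphism from a free module `P` to `K` becomes a quasi-isomorphism after applying `i^*`, and
therefore is one, by Nakayama's lemma for its mapping cone (`quasiIso_of_quasiIso_map`). So `F` is
locally a free module in degree `0`.

The functors of isomorphism classes agree because placing modules in degree `0` is compatible with
the composition isomorphisms of pushforwards (`arrowInDegreeZero_pushComp`), and hence with base
change (`arrow_toDerived_iff`).

The derived pullback is handled without flat resolutions. A sheaf of modules is called
`sectionProjective` if it lifts against epimorphisms with flasque kernel. There are enough of these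
(direct sums of extensions by zero of structure sheaves of open subsets), the class contains the free
modules and is stable under kernels of epimorphisms, and the pullback along any morphism is exact on short exact
sequences of such modules, since modules embed into flasque ones and pushforwards preserve flasque
modules (`isAdapted_sectionProjective`). The abstract criterion
`isUniversalArrow_mapDerivedCategory` then identifies derived pullbacks with pullbacks of resolutions.
-/

namespace PairDeformation

/-! ### Resolutions of bounded above complexes -/

namespace AcyclicResolution

universe v₁ u₁

variable {A : Type u₁} [Category.{v₁} A] [Abelian A]

/-- One stage of the recursive construction of a resolution of a chain complex: an object `V`, which
is the term constructed last, together with the object `W` onto which the next term has to surject;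
`W` comes with the differential `z` to `V` and the comparison map `a` to the complex. -/
structure Stage (Q : ℕ → A) (n : ℕ) where
  /-- The preceding term of the resolution. -/
  V : A
  /-- The object that the next term has to cover. -/
  W : A
  /-- The differential out of `W`. -/
  z : W ⟶ V
  /-- The comparison map. -/
  a : W ⟶ Q n

variable (Q : ChainComplex A ℕ) (c : A → A) (π : ∀ M, c M ⟶ M)

/-- The next stage: the new term is `c W`, and the new object to be covered consists of the pairs of
a cycle of `c W` and an element of `Q` with the same image in `Q`. -/
noncomputable def Stage.next {n : ℕ} (s : Stage Q.X n) : Stage Q.X (n + 1) where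
  V := c s.W
  W := pullback (kernel.ι (π s.W ≫ s.z) ≫ π s.W ≫ s.a) (Q.d (n + 1) n)
  z := pullback.fst _ _ ≫ kernel.ι _
  a := pullback.snd _ _

/-- The stages of the resolution. -/
noncomputable def stage : ∀ n : ℕ, Stage Q.X n
  | 0 => { V := Q.X 0, W := Q.X 0, z := 0, a := 𝟙 _ }
  | n + 1 => (stage n).next Q c π

/-- The differential of the resolution. -/
noncomputable def resD (n : ℕ) : c (stage Q c π (n + 1)).W ⟶ c (stage Q c π n).W :=
  π _ ≫ (stage Q c π (n + 1)).z

lemma resD_comp_π_z (n : ℕ) : resD Q c π n ≫ π _ ≫ (stage Q c π n).z = 0 := by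
  change (π _ ≫ pullback.fst _ _ ≫ kernel.ι (π (stage Q c π n).W ≫ (stage Q c π n).z)) ≫ _ = 0
  simp

lemma resD_comp (n : ℕ) : resD Q c π (n + 1) ≫ resD Q c π n = 0 :=
  resD_comp_π_z Q c π (n + 1)

lemma resD_comp_π_a (n : ℕ) : resD Q c π n ≫ π _ ≫ (stage Q c π n).a =
    (π _ ≫ (stage Q c π (n + 1)).a) ≫ Q.d (n + 1) n := by
  change (π _ ≫ pullback.fst _ _ ≫ kernel.ι (π (stage Q c π n).W ≫ (stage Q c π n).z)) ≫ _ =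
    (π _ ≫ pullback.snd _ _) ≫ _
  simp [pullback.condition]

/-- The resolution of the chain complex `Q`; its terms are values of `c`. -/
noncomputable abbrev res : ChainComplex A ℕ :=
  ChainComplex.of (fun n => c (stage Q c π n).W) (resD Q c π) (resD_comp Q c π)

lemma res_d (n : ℕ) : (res Q c π).d (n + 1) n = resD Q c π n :=
  ChainComplex.of_d (fun n => c (stage Q c π n).W) (resD Q c π) n

/-- The terms of the comparison map of the resolution. -/
noncomputable def resF (n : ℕ) : c (stage Q c π n).W ⟶ Q.X n := π _ ≫ (stage Q c π n).a

/-- The comparison map of the resolution. -/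
noncomputable def resHom : res Q c π ⟶ Q where
  f n := resF Q c π n
  comm' i j h := by
    obtain rfl : j + 1 = i := h
    exact (resD_comp_π_a Q c π j).symm.trans
      (congrArg (fun f : c (stage Q c π (j + 1)).W ⟶ c (stage Q c π j).W => f ≫ resF Q c π j)
        (res_d Q c π j).symm)

/-- Up to refinement, a cycle `p` of the resolution, together with an element `q` of `Q` whose
boundary is the image of `p`, comes from an element of the next term. This gives both the exactness
and the comparison of the homologies. -/
lemma exists_lift_resF [∀ M, Epi (π M)] (n : ℕ) {T : A} (p : T ⟶ c (stage Q c π n).W)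
    (q : T ⟶ Q.X (n + 1)) (hp : p ≫ π _ ≫ (stage Q c π n).z = 0)
    (hq : p ≫ resF Q c π n = q ≫ Q.d (n + 1) n) :
    ∃ (T' : A) (ε : T' ⟶ T) (_ : Epi ε) (p' : T' ⟶ c (stage Q c π (n + 1)).W),
      ε ≫ p = p' ≫ resD Q c π n ∧ ε ≫ q = p' ≫ resF Q c π (n + 1) := by
  let w : T ⟶ (stage Q c π (n + 1)).W :=
    pullback.lift (kernel.lift (π (stage Q c π n).W ≫ (stage Q c π n).z) p hp) q (by
      rw [kernel.lift_ι_assoc]; exact hq)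
  obtain ⟨T', ε, hε, p', h⟩ := surjective_up_to_refinements_of_epi (π (stage Q c π (n + 1)).W) w
  have h1 : w ≫ (stage Q c π (n + 1)).z = p := by
    change pullback.lift _ _ _ ≫ pullback.fst _ _ ≫ kernel.ι _ = p
    rw [pullback.lift_fst_assoc, kernel.lift_ι]
  have h2 : w ≫ (stage Q c π (n + 1)).a = q := by
    change pullback.lift _ _ _ ≫ pullback.snd _ _ = q
    rw [pullback.lift_snd]
  refine ⟨T', ε, hε, p', ?_, ?_⟩
  · refine (congrArg (fun f => ε ≫ f) h1.symm).trans ?_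
    refine (Category.assoc _ _ _).symm.trans ((congrArg (fun f => f ≫ _) h).trans ?_)
    exact Category.assoc _ _ _
  · refine (congrArg (fun f => ε ≫ f) h2.symm).trans ?_
    refine (Category.assoc _ _ _).symm.trans ((congrArg (fun f => f ≫ _) h).trans ?_)
    exact Category.assoc _ _ _

/-- The statement of `exists_lift_resF` for the differentials of the complex `res`. -/
lemma res_exists_lift [∀ M, Epi (π M)] (n : ℕ) {T : A} (p : T ⟶ (res Q c π).X n)
    (q : T ⟶ Q.X (n + 1)) (hp : p ≫ (res Q c π).d n ((ComplexShape.down ℕ).next n) = 0)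
    (hq : p ≫ (resHom Q c π).f n = q ≫ Q.d (n + 1) n) :
    ∃ (T' : A) (ε : T' ⟶ T) (_ : Epi ε) (p' : T' ⟶ (res Q c π).X (n + 1)),
      ε ≫ p = p' ≫ (res Q c π).d (n + 1) n ∧ ε ≫ q = p' ≫ (resHom Q c π).f (n + 1) := by
  rw [res_d]
  refine exists_lift_resF Q c π n p q ?_ hq
  cases n with
  | zero =>
    have h : (stage Q c π 0).z = 0 := rfl
    rw [h, comp_zero, comp_zero]
  | succ n =>
    rw [ChainComplex.next_nat_succ, res_d] at hp
    exact hp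

lemma quasiIso_resHom [∀ M, Epi (π M)] : QuasiIso (resHom Q c π) where
  quasiIsoAt n := by
    rw [quasiIsoAt_iff_isIso_homologyMap]
    have h1 : Mono (HomologicalComplex.homologyMap (resHom Q c π) n) := by
      rw [HomologicalComplex.mono_homologyMap_iff_up_to_refinements _ (n + 1) n _
        (ChainComplex.prev _ n) rfl]
      intro T p hp q hq
      obtain ⟨T', ε, hε, p', h, -⟩ := res_exists_lift Q c π n p q hp hq
      exact ⟨T', ε, hε, p', h⟩
    have h2 : Epi (HomologicalComplex.homologyMap (resHom Q c π) n) := by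
      rw [HomologicalComplex.epi_homologyMap_iff_up_to_refinements _ (n + 1) n _
        (ChainComplex.prev _ n) rfl]
      intro T q hq
      cases n with
      | zero =>
        obtain ⟨T', ε, hε, p, h⟩ := surjective_up_to_refinements_of_epi (π (stage Q c π 0).W) q
        refine ⟨T', ε, hε, p, ?_, 0, ?_⟩
        · rw [(res Q c π).shape _ _ (by simp)]
          exact comp_zero
        · rw [zero_comp, add_zero]
          refine h.trans ?_
          exact congrArg (fun f => p ≫ f) (Category.comp_id (π (stage Q c π 0).W)).symm
      | succ n =>
        rw [ChainComplex.next_nat_succ] at hq ⊢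
        obtain ⟨T', ε, hε, p', h, h'⟩ := res_exists_lift Q c π n 0 q zero_comp
          (by rw [zero_comp, hq])
        refine ⟨T', ε, hε, p', by rw [← h, comp_zero], 0, ?_⟩
        rw [h', zero_comp, add_zero]
    exact isIso_of_mono_of_epi _

end AcyclicResolution

section

universe v₁ u₁
variable {A : Type u₁} [Category.{v₁} A] [Abelian A]

/-- If every object is a quotient of an object in `G`, then every bounded above complex has a
bounded above resolution by objects in `G`. -/
lemma exists_resolution (G : ObjectProperty A) [G.IsClosedUnderIsomorphisms] [G.ContainsZero]
    (hG : ∀ M : A, ∃ (P : A) (π : P ⟶ M), G P ∧ Epi π) (K : CochainComplex A ℤ) (b : ℤ) [K.IsLE b] :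
    ∃ (P : CochainComplex A ℤ) (_ : P.IsStrictlyLE b) (f : P ⟶ K),
      (∀ n, G (P.X n)) ∧ QuasiIso f := by
  choose c π hc hπ using hG
  let e := ComplexShape.embeddingUpIntLE b
  let P := AcyclicResolution.res (HomologicalComplex.truncLE' K e) c π
  let f : P ⟶ _ := AcyclicResolution.resHom (HomologicalComplex.truncLE' K e) c π
  have hf : QuasiIso f := AcyclicResolution.quasiIso_resHom _ c π
  refine ⟨P.extend e, inferInstance, HomologicalComplex.extendMap f e ≫
    (HomologicalComplex.truncLEIso K e).inv ≫ HomologicalComplex.ιTruncLE K e, fun n => ?_, ?_⟩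
  · by_cases hn : ∃ i, e.f i = n
    · obtain ⟨i, hi⟩ := hn
      exact G.prop_of_iso (P.extendXIso e hi).symm (hc _)
    · exact G.prop_of_isZero (P.isZero_extend_X e n (by simpa using hn))
  · have h1 : QuasiIso (HomologicalComplex.extendMap f e) := inferInstance
    have h2 : QuasiIso (HomologicalComplex.ιTruncLE K e) :=
      inferInstanceAs (QuasiIso (K.ιTruncLE b))
    have h3 : QuasiIso (HomologicalComplex.truncLEIso K e).inv := inferInstance
    exact quasiIso_comp _ _

end

/-! ### Objects adapted to a right exact functor -/

section

universe v₁ v₂ u₁ u₂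
variable {A : Type u₁} [Category.{v₁} A] [Abelian A] {B : Type u₂} [Category.{v₂} B] [Abelian B]

lemma quasiIso_iff_acyclic_mappingCone {K L : CochainComplex A ℤ} (φ : K ⟶ L) :
    QuasiIso φ ↔ (CochainComplex.mappingCone φ).Acyclic := by
  let : HasDerivedCategory A := HasDerivedCategory.standard A
  rw [← DerivedCategory.isIso_Q_map_iff_quasiIso]
  refine (Pretriangulated.Triangle.isZero₃_iff_isIso₁ _
    (DerivedCategory.mappingCone_triangle_distinguished φ)).symm.trans ?_
  constructor
  · intro h n
    rw [HomologicalComplex.exactAt_iff_isZero_homology]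
    exact ((DerivedCategory.homologyFunctor A n).map_isZero h).of_iso
      ((DerivedCategory.homologyFunctorFactors A n).symm.app _)
  · intro h
    -- The zero endomorphism of an acyclic complex is a quasi-isomorphism.
    have h0 : QuasiIso (0 : CochainComplex.mappingCone φ ⟶ CochainComplex.mappingCone φ) := by
      rw [quasiIso_iff]
      intro n
      rw [quasiIsoAt_iff_exactAt _ _ (h n)]
      exact h n
    have h1 : IsIso (DerivedCategory.Q.map
        (0 : CochainComplex.mappingCone φ ⟶ CochainComplex.mappingCone φ)) :=
      inferInstance
    rw [Functor.map_zero] at h1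
    change IsZero (DerivedCategory.Q.obj (CochainComplex.mappingCone φ))
    rw [IsZero.iff_id_eq_zero,
      ← cancel_epi (0 : DerivedCategory.Q.obj (CochainComplex.mappingCone φ) ⟶
        DerivedCategory.Q.obj (CochainComplex.mappingCone φ)), zero_comp, zero_comp]

/-- The functor induced by `L` on cochain complexes. -/
noncomputable abbrev onComplexes (L : A ⥤ B) [L.Additive] :
    CochainComplex A ℤ ⥤ CochainComplex B ℤ :=
  L.mapHomologicalComplex (.up ℤ)

lemma quasiIso_map_iff_acyclic (L : A ⥤ B) [L.Additive] {K K' : CochainComplex A ℤ} (φ : K ⟶ K') :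
    QuasiIso ((onComplexes L).map φ) ↔
      ((onComplexes L).obj (CochainComplex.mappingCone φ)).Acyclic := by
  rw [quasiIso_iff_acyclic_mappingCone]
  exact forall_congr' fun n =>
    ⟨fun h => h.of_iso (CochainComplex.mappingCone.mapHomologicalComplexIso φ L).symm,
     fun h => h.of_iso (CochainComplex.mappingCone.mapHomologicalComplexIso φ L)⟩

lemma exactAt_map_iff (L : A ⥤ B) [L.Additive] (K : CochainComplex A ℤ) (n : ℤ) :
    ((onComplexes L).obj K).ExactAt n ↔
      ∀ ⦃T : B⦄ (x : T ⟶ L.obj (K.X n)), x ≫ L.map (K.d n (n + 1)) = 0 →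
        ∃ (T' : B) (π : T' ⟶ T) (_ : Epi π) (z : T' ⟶ L.obj (K.X (n - 1))),
          π ≫ x = z ≫ L.map (K.d (n - 1) n) :=
  HomologicalComplex.exactAt_iff_exact_up_to_refinements _ (n - 1) n (n + 1) (by simp) (by simp)

lemma exactAt_iff_epi_toCycles (K : CochainComplex A ℤ) (i j : ℤ) (h : i + 1 = j) :
    K.ExactAt j ↔ Epi (K.toCycles i j) := by
  subst h
  rw [HomologicalComplex.exactAt_iff_isZero_homology]
  have hc := K.homologyIsCokernel i (i + 1) (by simp)
  constructor
  · intro h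
    exact Preadditive.epi_of_isZero_cokernel' _ hc h
  · intro h
    have : K.homologyπ (i + 1) = 0 := by
      rw [← cancel_epi (K.toCycles i (i + 1)), K.toCycles_comp_homologyπ, comp_zero]
    rw [IsZero.iff_id_eq_zero, ← cancel_epi (K.homologyπ (i + 1)), this, zero_comp, zero_comp]

/-- A class `G` of objects which can be used to compute the left derived functors of the right exact
functor `L`: every object is a quotient of one in `G`, and `L` is exact on the short exact sequences
with quotient in `G`. -/
structure IsAdapted (L : A ⥤ B) (G : ObjectProperty A) : Prop where
  isClosedUnderIsomorphisms : G.IsClosedUnderIsomorphisms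
  prop_of_isZero (M : A) : IsZero M → G M
  prop_biprod (M N : A) : G M → G N → G (M ⊞ N)
  exists_epi (M : A) : ∃ (P : A) (π : P ⟶ M), G P ∧ Epi π
  prop_kernel (S : ShortComplex A) : S.ShortExact → G S.X₂ → G S.X₃ → G S.X₁
  mono_map (S : ShortComplex A) : S.ShortExact → G S.X₃ → Mono (L.map S.f)

/-- The sequence `0 ⟶ Zⁱ ⟶ Kⁱ ⟶ Zʲ ⟶ 0` for `j = i + 1`. -/
noncomputable abbrev cyclesSequence (K : CochainComplex A ℤ) (i j : ℤ) : ShortComplex A :=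
  ShortComplex.mk (K.iCycles i) (K.toCycles i j) (by
    rw [← cancel_mono (K.iCycles j), Category.assoc, K.toCycles_i, zero_comp, K.iCycles_d])

lemma cyclesSequence_shortExact (K : CochainComplex A ℤ) {i j : ℤ} (h : i + 1 = j)
    (hK : K.ExactAt j) : (cyclesSequence K i j).ShortExact where
  exact := by
    refine ShortComplex.exact_of_f_is_kernel _ (KernelFork.IsLimit.ofι' _ _ fun {T} g hg => ?_)
    have : g ≫ K.d i j = 0 := by
      rw [← K.toCycles_i, ← Category.assoc, hg, zero_comp]
    exact ⟨K.liftCycles g j (by simp [← h]) this, K.liftCycles_i _ _ _ _⟩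
  mono_f := inferInstanceAs (Mono (K.iCycles i))
  epi_g := (exactAt_iff_epi_toCycles K i j h).mp hK

namespace IsAdapted

variable {L : A ⥤ B} [L.Additive] {G : ObjectProperty A} (hG : IsAdapted L G)
include hG

/-- In the range in which a bounded above complex of adapted objects is exact, its cycles are
adapted as well, and `L` preserves their inclusion. -/
lemma cycles (K : CochainComplex A ℤ) (b m : ℤ) [K.IsStrictlyLE b] (hK : ∀ n, G (K.X n))
    (he : ∀ n, m < n → K.ExactAt n) (n : ℤ) (hn : m ≤ n) :
    G (K.cycles n) ∧ Mono (L.map (K.iCycles n)) := by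
  -- Descending induction on `n`, starting above `b`, where the complex vanishes.
  suffices H : ∀ (r : ℕ) (n : ℤ), b < n + r → m ≤ n → G (K.cycles n) ∧ Mono (L.map (K.iCycles n)) by
    exact H (b - n + 1).toNat n (by lia) hn
  intro r
  induction r with
  | zero =>
    intro n hb _
    have hz : IsZero (K.X n) := K.isZero_of_isStrictlyLE b n (by simpa using hb)
    have hz' : IsZero (K.cycles n) := IsZero.of_mono (K.iCycles n) hz
    exact ⟨hG.prop_of_isZero _ hz', ⟨fun _ _ _ => (L.map_isZero hz').eq_of_tgt _ _⟩⟩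
  | succ r ih =>
    intro n hb hm
    have h1 := (ih (n + 1) (by push_cast at hb; lia) (by lia)).1
    have hS := cyclesSequence_shortExact K (j := n + 1) rfl (he _ (by lia))
    exact ⟨hG.prop_kernel _ hS (hK n) h1, hG.mono_map _ hS h1⟩

variable [PreservesFiniteColimits L]

/-- An acyclic bounded above complex of adapted objects stays acyclic. -/
lemma acyclic_map (K : CochainComplex A ℤ) (b : ℤ) [K.IsStrictlyLE b] (hK : ∀ n, G (K.X n))
    (he : K.Acyclic) : ((onComplexes L).obj K).Acyclic := by
  intro n
  rw [exactAt_map_iff]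
  intro T x hx
  have h1 := hG.cycles K b (n - 1) hK (fun _ _ => he _) n (by lia)
  have h2 := hG.cycles K b (n - 1) hK (fun _ _ => he _) (n + 1) (by lia)
  have := h1.2
  have := h2.2
  have hS := cyclesSequence_shortExact K (i := n) (j := n + 1) rfl (he _)
  have hS' : ((cyclesSequence K n (n + 1)).map L).Exact :=
    hS.exact.map_of_epi_of_preservesCokernel L hS.epi_g inferInstance
  have hx' : x ≫ L.map (K.toCycles n (n + 1)) = 0 := by
    rw [← cancel_mono (L.map (K.iCycles (n + 1))), Category.assoc, ← L.map_comp, K.toCycles_i,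
      hx, zero_comp]
  obtain ⟨T₁, π₁, _, y, hy⟩ : ∃ (T₁ : B) (π₁ : T₁ ⟶ T) (_ : Epi π₁)
      (y : T₁ ⟶ L.obj (K.cycles n)), π₁ ≫ x = y ≫ L.map (K.iCycles n) :=
    hS'.exact_up_to_refinements x hx'
  have : Epi (K.toCycles (n - 1) n) := (exactAt_iff_epi_toCycles K _ _ (by lia)).mp (he n)
  obtain ⟨T₂, π₂, _, z, hz⟩ :=
    surjective_up_to_refinements_of_epi (L.map (K.toCycles (n - 1) n)) y
  refine ⟨T₂, π₂ ≫ π₁, inferInstance, z, ?_⟩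
  rw [← K.toCycles_i, L.map_comp, Category.assoc, hy, ← Category.assoc, ← Category.assoc, hz]

/-- If `L` reflects zero objects, then the exactness of bounded above complexes of adapted objects
in high degrees can be tested after applying `L`. -/
lemma exactAt_of_exactAt_map (hL : ∀ M : A, IsZero (L.obj M) → IsZero M) (K : CochainComplex A ℤ)
    (b m : ℤ) [K.IsStrictlyLE b] (hK : ∀ n, G (K.X n))
    (he : ∀ n, m < n → ((onComplexes L).obj K).ExactAt n) (n : ℤ) (hn : m < n) : K.ExactAt n := by
  suffices H : ∀ (r : ℕ) (n : ℤ), b < n + r → m < n → K.ExactAt n by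
    exact H (b - n + 1).toNat n (by lia) hn
  intro r
  induction r with
  | zero =>
    intro n hb _
    rw [HomologicalComplex.exactAt_iff_isZero_homology]
    have hz : IsZero (K.X n) := K.isZero_of_isStrictlyLE b n (by simpa using hb)
    exact IsZero.of_epi (K.homologyπ n) (IsZero.of_mono (K.iCycles n) hz)
  | succ r ih =>
    intro n hb hm
    have ht : ∀ l, n < l → K.ExactAt l := by
      intro l hl
      by_cases h : b < l + r
      · exact ih l h (by lia)
      · push_cast at hb; lia
    have := (hG.cycles K b n hK ht n le_rfl).2
    rw [exactAt_iff_epi_toCycles K (n - 1) n (by lia)]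
    have : Epi (L.map (K.toCycles (n - 1) n)) := by
      rw [epi_iff_surjective_up_to_refinements]
      intro T y
      have hx := he n hm
      rw [exactAt_map_iff] at hx
      obtain ⟨T', π, hπ, z, hz⟩ := hx (y ≫ L.map (K.iCycles n)) (by
        have : L.map (K.iCycles n) ≫ L.map (K.d n (n + 1)) = 0 := by
          rw [← L.map_comp, K.iCycles_d, L.map_zero]
        rw [Category.assoc, this, comp_zero])
      refine ⟨T', π, hπ, z, ?_⟩
      rw [← cancel_mono (L.map (K.iCycles n)), Category.assoc, Category.assoc, ← L.map_comp,
        K.toCycles_i, hz]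
    -- `L` kills the cokernel of the map from `K` in degree `n - 1` to the cycles in degree `n`.
    refine epi_of_isZero_cokernel _ (hL _ ?_)
    exact (isZero_cokernel_of_epi (L.map (K.toCycles (n - 1) n))).of_iso
      (PreservesCokernel.iso L (K.toCycles (n - 1) n))

end IsAdapted

end

/-! ### Left derived functors as universal arrows -/

lemma isUniversalArrow_iso_iff {C D : Type*} [Category* C] [Category* D] (R : D ⥤ C) {F F' : C}
    {G G' : D} (e : F' ≅ F) (a : F ⟶ R.obj G) (e' : G ≅ G') :
    IsUniversalArrow R (e.hom ≫ a ≫ R.map e'.hom) ↔ IsUniversalArrow R a := by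
  refine forall_congr' fun T => ?_
  have h1 : Function.Bijective fun g : G' ⟶ T => e'.hom ≫ g := e'.homFromEquiv.symm.bijective
  have h2 : Function.Bijective fun t : F ⟶ R.obj T => e.hom ≫ t := e.homFromEquiv.symm.bijective
  rw [← h1.of_comp_iff (fun g => a ≫ R.map g), ← h2.of_comp_iff']
  refine iff_of_eq (congrArg _ (funext fun g => ?_))
  simp

/-- The object that represents a universal arrow is unique up to isomorphism. -/
lemma IsUniversalArrow.exists_iso {C D : Type*} [Category* C] [Category* D] {R : D ⥤ C} {F : C}
    {G G' : D} {a : F ⟶ R.obj G} {a' : F ⟶ R.obj G'} (ha : IsUniversalArrow R a)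
    (ha' : IsUniversalArrow R a') : ∃ e : G ≅ G', a ≫ R.map e.hom = a' := by
  obtain ⟨f, hf⟩ := (ha _).2 a'
  obtain ⟨g, hg⟩ := (ha' _).2 a
  dsimp only at hf hg
  refine ⟨⟨f, g, (ha _).1 ?_, (ha' _).1 ?_⟩, hf⟩
  · simp [reassoc_of% hf, hg]
  · simp [reassoc_of% hg, hf]

section

universe w₁ w₂ v₁ v₂ u₁ u₂
variable {A : Type u₁} [Category.{v₁} A] [Abelian A] {B : Type u₂} [Category.{v₂} B] [Abelian B]

/-- The adjunct `L K ⟶ T` of a morphism of complexes `K ⟶ R T`. -/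
noncomputable def adjunct {L : A ⥤ B} {R : B ⥤ A} (adj : L ⊣ R) [L.Additive] [R.Additive]
    {K : CochainComplex A ℤ} {T : CochainComplex B ℤ} (θ : K ⟶ (onComplexes R).obj T) :
    (onComplexes L).obj K ⟶ T where
  f n := (adj.homEquiv _ _).symm (θ.f n)
  comm' i j _ := by
    exact (adj.homEquiv_naturality_right_symm _ _).symm.trans
      ((congrArg _ (θ.comm i j)).trans (adj.homEquiv_naturality_left_symm _ _))

/-- The adjunct `K ⟶ R T` of a morphism of complexes `L K ⟶ T`. -/
noncomputable def coadjunct {L : A ⥤ B} {R : B ⥤ A} (adj : L ⊣ R) [L.Additive] [R.Additive]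
    {K : CochainComplex A ℤ} {T : CochainComplex B ℤ} (θ : (onComplexes L).obj K ⟶ T) :
    K ⟶ (onComplexes R).obj T where
  f n := (adj.homEquiv _ _) (θ.f n)
  comm' i j _ := by
    exact (adj.homEquiv_naturality_right _ _).symm.trans
      ((congrArg _ (θ.comm i j)).trans (adj.homEquiv_naturality_left _ _))

variable {L : A ⥤ B} {R : B ⥤ A} (adj : L ⊣ R) [L.Additive] [R.Additive]

lemma adjunct_coadjunct {K : CochainComplex A ℤ} {T : CochainComplex B ℤ}
    (θ : (onComplexes L).obj K ⟶ T) : adjunct adj (coadjunct adj θ) = θ := by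
  ext n
  exact (adj.homEquiv _ _).symm_apply_apply _

lemma coadjunct_adjunct {K : CochainComplex A ℤ} {T : CochainComplex B ℤ}
    (θ : K ⟶ (onComplexes R).obj T) : coadjunct adj (adjunct adj θ) = θ := by
  ext n
  exact (adj.homEquiv _ _).apply_symm_apply _

lemma adjunct_comp_left {K K' : CochainComplex A ℤ} {T : CochainComplex B ℤ} (s : K' ⟶ K)
    (θ : K ⟶ (onComplexes R).obj T) :
    adjunct adj (s ≫ θ) = (onComplexes L).map s ≫ adjunct adj θ := by
  ext n
  exact adj.homEquiv_naturality_left_symm _ _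

lemma adjunct_comp_right {K : CochainComplex A ℤ} {T T' : CochainComplex B ℤ}
    (θ : K ⟶ (onComplexes R).obj T) (h : T ⟶ T') :
    adjunct adj (θ ≫ (onComplexes R).map h) = adjunct adj θ ≫ h := by
  ext n
  exact adj.homEquiv_naturality_right_symm _ _

lemma coadjunct_comp_left {K K' : CochainComplex A ℤ} {T : CochainComplex B ℤ} (s : K' ⟶ K)
    (θ : (onComplexes L).obj K ⟶ T) :
    coadjunct adj ((onComplexes L).map s ≫ θ) = s ≫ coadjunct adj θ := by
  ext n
  exact adj.homEquiv_naturality_left _ _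

lemma coadjunct_comp_right {K : CochainComplex A ℤ} {T T' : CochainComplex B ℤ}
    (θ : (onComplexes L).obj K ⟶ T) (h : T ⟶ T') :
    coadjunct adj (θ ≫ h) = coadjunct adj θ ≫ (onComplexes R).map h := by
  ext n
  exact adj.homEquiv_naturality_right _ _

lemma nonempty_homotopy_adjunct {K : CochainComplex A ℤ} {T : CochainComplex B ℤ}
    (θ : K ⟶ (onComplexes R).obj T) (H : Homotopy θ 0) : Nonempty (Homotopy (adjunct adj θ) 0) := by
  let ε : (onComplexes L).obj ((onComplexes R).obj T) ⟶ T := adjunct adj (𝟙 _)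
  have h1 : adjunct adj θ = (onComplexes L).map θ ≫ ε := by
    rw [← adjunct_comp_left, Category.comp_id]
  have h2 := (L.mapHomotopy H).compRight ε
  refine ⟨(Homotopy.ofEq h1).trans (h2.trans (Homotopy.ofEq ?_))⟩
  have : (L.mapHomologicalComplex (.up ℤ)).map (0 : K ⟶ (onComplexes R).obj T) = 0 :=
    Functor.map_zero _ _ _
  rw [this, zero_comp]

/-- A morphism of complexes which vanishes in the derived category is homotopic to zero after
precomposition with a quasi-isomorphism. -/
lemma exists_quasiIso_homotopy_zero [HasDerivedCategory.{w₁} A] {K K' : CochainComplex A ℤ}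
    (f : K ⟶ K') (hf : DerivedCategory.Q.map f = 0) :
    ∃ (P : CochainComplex A ℤ) (s : P ⟶ K), QuasiIso s ∧ Nonempty (Homotopy (s ≫ f) 0) := by
  let q := HomotopyCategory.quotient A (.up ℤ)
  have h1 : DerivedCategory.Qh.map (q.map f) = DerivedCategory.Qh.map (q.map 0) := by
    have e := DerivedCategory.quotientCompQhIso A
    have : IsIso (e.hom.app K') := inferInstance
    rw [← cancel_mono (e.hom.app K')]
    refine (e.hom.naturality f).trans ?_
    refine Eq.trans ?_ (e.hom.naturality 0).symm
    rw [hf, DerivedCategory.Q.map_zero]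
  obtain ⟨P, s, hs, h⟩ := (MorphismProperty.map_eq_iff_precomp DerivedCategory.Qh
    (HomotopyCategory.quasiIso A (.up ℤ)) _ _).mp h1
  obtain ⟨P, rfl⟩ := HomotopyCategory.quotient_obj_surjective P
  obtain ⟨s, rfl⟩ := q.map_surjective s
  refine ⟨P, s, ?_, ?_⟩
  · rw [← DerivedCategory.isIso_Qh_map_iff] at hs
    rw [← DerivedCategory.isIso_Q_map_iff_quasiIso]
    exact hs
  · rw [← q.map_comp, ← q.map_comp, comp_zero] at h
    exact ⟨HomotopyCategory.homotopyOfEq _ _ h⟩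

variable [PreservesFiniteLimits R] [PreservesFiniteColimits R] {G : ObjectProperty A}
  [HasDerivedCategory.{w₁} A] [HasDerivedCategory.{w₂} B]

/-- The exact functor `R` on a left fraction of morphisms of complexes. -/
lemma map_fraction {M L' T : CochainComplex B ℤ} (ψ : M ⟶ L') [QuasiIso ψ] (φ : M ⟶ T) :
    DerivedCategory.Q.map ((onComplexes R).map ψ) ≫ R.mapDerivedCategoryFactors.inv.app L' ≫
      R.mapDerivedCategory.map (inv (DerivedCategory.Q.map ψ) ≫ DerivedCategory.Q.map φ) ≫
        R.mapDerivedCategoryFactors.hom.app T = DerivedCategory.Q.map ((onComplexes R).map φ) := by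
  have h := R.mapDerivedCategoryFactors_hom_naturality φ
  have h' := R.mapDerivedCategoryFactors_hom_naturality ψ
  have h'' : DerivedCategory.Q.map ((onComplexes R).map ψ) ≫
      R.mapDerivedCategoryFactors.inv.app L' = R.mapDerivedCategoryFactors.inv.app M ≫
      R.mapDerivedCategory.map (DerivedCategory.Q.map ψ) := by
    rw [← cancel_epi (R.mapDerivedCategoryFactors.hom.app M), ← reassoc_of% h']
    simp
  rw [reassoc_of% h'', ← Functor.map_comp_assoc, IsIso.hom_inv_id_assoc, h]
  simp

include adj in
/-- Let `L` be left adjoint to the exact functor `R`. If `L` preserves the quasi-isomorphisms from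
complexes of adapted objects to `K`, and `L K ⟶ L'` is a quasi-isomorphism, then `L'` represents the
left derived functor of `L` at `K`: the arrow `K ⟶ R L'` is universal in the derived category. -/
theorem isUniversalArrow_mapDerivedCategory (hG : IsAdapted L G) {K : CochainComplex A ℤ}
    {L' : CochainComplex B ℤ} (θ : K ⟶ (onComplexes R).obj L') (hθ : QuasiIso (adjunct adj θ))
    (b : ℤ) [K.IsStrictlyLE b]
    (hK : ∀ (P : CochainComplex A ℤ) (_ : P.IsStrictlyLE b) (s : P ⟶ K), (∀ n, G (P.X n)) →
      QuasiIso s → QuasiIso ((onComplexes L).map s)) :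
    IsUniversalArrow R.mapDerivedCategory
      (DerivedCategory.Q.map θ ≫ R.mapDerivedCategoryFactors.inv.app L') := by
  have := hG.isClosedUnderIsomorphisms
  have : G.ContainsZero := ⟨⟨_, isZero_zero A, hG.prop_of_isZero _ (isZero_zero A)⟩⟩
  suffices H : ∀ T : CochainComplex B ℤ, Function.Bijective
      fun g : DerivedCategory.Q.obj L' ⟶ DerivedCategory.Q.obj T =>
      (DerivedCategory.Q.map θ ≫ R.mapDerivedCategoryFactors.inv.app L') ≫
        R.mapDerivedCategory.map g by
    intro T
    let e : DerivedCategory.Q.obj _ ≅ T := DerivedCategory.Q.objObjPreimageIso T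
    have h1 : Function.Bijective fun g : DerivedCategory.Q.obj L' ⟶ T => g ≫ e.inv :=
      e.symm.homToEquiv.bijective
    have h2 : Function.Bijective fun t : DerivedCategory.Q.obj K ⟶
        R.mapDerivedCategory.obj (DerivedCategory.Q.obj _) => t ≫ R.mapDerivedCategory.map e.hom :=
      (R.mapDerivedCategory.mapIso e).homToEquiv.bijective
    have h3 := h2.comp ((H _).comp h1)
    convert h3 using 2 with g
    simp [← Functor.map_comp]
  intro T
  have hn {T T' : CochainComplex B ℤ} (f : T ⟶ T') :
      R.mapDerivedCategory.map (DerivedCategory.Q.map f) =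
        R.mapDerivedCategoryFactors.hom.app T ≫ DerivedCategory.Q.map ((onComplexes R).map f) ≫
          R.mapDerivedCategoryFactors.inv.app T' := by
    have := R.mapDerivedCategoryFactors_hom_naturality f
    rw [← reassoc_of% this]
    simp
  constructor
  · suffices H : ∀ g : DerivedCategory.Q.obj L' ⟶ DerivedCategory.Q.obj T,
        (DerivedCategory.Q.map θ ≫ R.mapDerivedCategoryFactors.inv.app L') ≫
        R.mapDerivedCategory.map g = 0 → g = 0 by
      intro g₁ g₂ h
      refine sub_eq_zero.mp (H _ ?_)
      dsimp only at h
      rw [Functor.map_sub, Preadditive.comp_sub, h, sub_self]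
    intro g hg
    -- A fraction `s⁻¹ h` which `R` annihilates: after precomposition with a resolution the morphism
    -- `θ ≫ R h` is homotopic to zero, and hence so is its adjunct.
    obtain ⟨T₁, h, s, hs, rfl⟩ := DerivedCategory.left_fac g
    rw [Functor.map_comp, Functor.map_inv, ← Category.assoc, IsIso.comp_inv_eq, zero_comp, hn] at hg
    have h0 : DerivedCategory.Q.map (θ ≫ (onComplexes R).map h) = 0 := by
      rw [← cancel_mono (R.mapDerivedCategoryFactors.inv.app T₁), zero_comp, ← hg, Functor.map_comp]
      simp
    obtain ⟨P, s', hs', ⟨H⟩⟩ := exists_quasiIso_homotopy_zero _ h0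
    have : P.IsLE b := by
      rw [CochainComplex.isLE_iff]
      intro i hi
      rw [exactAt_iff_of_quasiIsoAt s' i]
      exact K.exactAt_of_isLE b i hi
    obtain ⟨P', hP', t, hPG, ht⟩ := exists_resolution G hG.exists_epi P b
    have h1 : QuasiIso ((onComplexes L).map (t ≫ s')) := hK P' hP' _ hPG inferInstance
    obtain ⟨H'⟩ := nonempty_homotopy_adjunct adj ((t ≫ s') ≫ θ ≫ (onComplexes R).map h)
      ((Homotopy.ofEq (Category.assoc _ _ _)).trans
        ((H.compLeft t).trans (Homotopy.ofEq comp_zero)))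
    have h2 := DerivedCategory.Q_map_eq_of_homotopy (C := B) H'
    rw [adjunct_comp_left, adjunct_comp_right, DerivedCategory.Q.map_comp,
      DerivedCategory.Q.map_comp (adjunct adj θ), Functor.map_zero, ← Category.assoc] at h2
    have h3 : DerivedCategory.Q.map h = 0 := by
      rw [← cancel_epi (DerivedCategory.Q.map ((onComplexes L).map (t ≫ s')) ≫
        DerivedCategory.Q.map (adjunct adj θ)), h2, comp_zero]
    rw [h3, zero_comp]
  · intro f
    -- A fraction with denominator `s : P ⟶ K`, where `P` may be replaced by a resolution.
    obtain ⟨P, hP, s, hs, g, hf⟩ := DerivedCategory.right_fac_of_isStrictlyLE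
      (f ≫ R.mapDerivedCategoryFactors.hom.app T) b
    obtain ⟨P', hP', t, hPG, ht⟩ := exists_resolution G hG.exists_epi P b
    rw [DerivedCategory.isIso_Q_map_iff_quasiIso] at hs
    have h1 : QuasiIso ((onComplexes L).map (t ≫ s)) := hK P' hP' _ hPG inferInstance
    refine ⟨inv (DerivedCategory.Q.map ((onComplexes L).map (t ≫ s) ≫ adjunct adj θ)) ≫
      DerivedCategory.Q.map (adjunct adj (t ≫ g)), ?_⟩
    dsimp only
    rw [← cancel_mono (R.mapDerivedCategoryFactors.hom.app T), hf,
      ← cancel_epi (DerivedCategory.Q.map (t ≫ s))]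
    have h2 : (t ≫ s) ≫ θ = coadjunct adj (𝟙 _) ≫
        (onComplexes R).map ((onComplexes L).map (t ≫ s) ≫ adjunct adj θ) := by
      rw [← coadjunct_comp_right, Category.id_comp, coadjunct_comp_left, coadjunct_adjunct]
    have h3 : t ≫ g = coadjunct adj (𝟙 _) ≫ (onComplexes R).map (adjunct adj (t ≫ g)) := by
      rw [← coadjunct_comp_right, Category.id_comp, coadjunct_adjunct]
    have h4 : DerivedCategory.Q.map (t ≫ s) ≫ inv (DerivedCategory.Q.map s) ≫
        DerivedCategory.Q.map g = DerivedCategory.Q.map (t ≫ g) := by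
      simp
    rw [h4, h3]
    have h5 : DerivedCategory.Q.map (t ≫ s) ≫ DerivedCategory.Q.map θ =
        DerivedCategory.Q.map (coadjunct adj (𝟙 _)) ≫
          DerivedCategory.Q.map ((onComplexes R).map
            ((onComplexes L).map (t ≫ s) ≫ adjunct adj θ)) := by
      rw [← Functor.map_comp, h2, Functor.map_comp]
    simp only [Category.assoc]
    rw [reassoc_of% h5]
    refine (congrArg (fun f => DerivedCategory.Q.map (coadjunct adj (𝟙 _)) ≫ f)
      (map_fraction _ _)).trans ?_
    rw [← h3, ← Functor.map_comp, ← h3]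

end

/-! ### Flasque sheaves of modules -/

section Godement

variable {Y : Scheme.{u}} (D : Y → Type u) [∀ y, AddCommGroup (D y)]

/-- The presheaf whose sections over `U` are the families of elements of the groups `D y` for `y` in
`U`. -/
noncomputable def productPresheaf : TopCat.Presheaf Ab.{u} Y where
  obj U := AddCommGrpCat.of (∀ y : U.unop, D y)
  map {U V} i := AddCommGrpCat.ofHom
    { toFun s y := s ⟨y.1, i.unop.le y.2⟩
      map_zero' := rfl
      map_add' _ _ := rfl }

lemma isSheaf_productPresheaf : (productPresheaf D).IsSheaf := by
  rw [TopCat.Presheaf.isSheaf_iff_isSheaf_comp (forget Ab.{u})]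
  exact TopCat.Presheaf.isSheaf_of_iso (NatIso.ofComponents (fun _ => Iso.refl _) (by intros; rfl))
    (TopCat.Presheaf.toTypes_isSheaf Y D)

variable [∀ y, Module (Y.presheaf.stalk y) (D y)]

noncomputable instance (U : (TopologicalSpace.Opens Y)ᵒᵖ) :
    Module (Y.ringCatSheaf.obj.obj U) ((productPresheaf D).obj U) :=
  letI (y : U.unop) : Module (Y.presheaf.obj U) (D y) :=
    Module.compHom _ (Y.presheaf.germ U.unop (y : Y) y.2).hom
  inferInstanceAs (Module (Y.presheaf.obj U) (∀ y : U.unop, D y))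

lemma productPresheaf_smul_apply (U : (TopologicalSpace.Opens Y)ᵒᵖ)
    (r : Y.ringCatSheaf.obj.obj U) (m : ∀ y : U.unop, D y) (y : U.unop) :
    (r • (show (productPresheaf D).obj U from m) : ∀ y : U.unop, D y) y =
    (Y.presheaf.germ U.unop (y : Y) y.2).hom r • m y := rfl

/-- The sheaf of modules whose sections over `U` are the families of elements of the modules `D y`
over the stalks of the structure sheaf, for `y` in `U`. -/
noncomputable def productSheaf : Y.Modules where
  val := PresheafOfModules.ofPresheaf (R := Y.ringCatSheaf.obj) (productPresheaf D) (by
    intro U V f r m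
    funext y
    have h : (Y.presheaf.germ U.unop y.1 (f.unop.le y.2)).hom r =
        (Y.presheaf.germ V.unop y.1 y.2).hom (Y.ringCatSheaf.obj.map f r) :=
      (TopCat.Presheaf.germ_res_apply Y.presheaf f.unop y.1 y.2 r).symm
    refine (productPresheaf_smul_apply D U r m ⟨y.1, f.unop.le y.2⟩).trans ?_
    refine Eq.trans ?_ (productPresheaf_smul_apply D V _ _ y).symm
    exact congrArg (fun t => t • m ⟨y.1, f.unop.le y.2⟩) h)
  isSheaf := isSheaf_productPresheaf D

/-- The stalk of a sheaf of modules is a module over the stalk of the structure sheaf. -/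
noncomputable instance stalkModule (M : Y.Modules) (y : Y) :
    Module (Y.presheaf.stalk y) (M.presheaf.stalk y) :=
  PresheafOfModules.instModuleCarrierStalkCommRingCatCarrierAbPresheafOpensCarrier
    (R := Y.presheaf) M.val y

lemma germ_smul_modules (M : Y.Modules) (U : Y.Opens) (y : Y) (hy : y ∈ U) (r : Γ(Y, U))
    (m : Γ(M, U)) : M.presheaf.germ U y hy (r • m) =
      (Y.presheaf.germ U y hy).hom r • M.presheaf.germ U y hy m :=
  PresheafOfModules.germ_smul (R := Y.presheaf) M.val y U hy r m

/-- A family of semilinear maps from the stalks of `M` to the modules `D y` defines a morphism into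
the pushforward of the product sheaf. -/
noncomputable def toProductSheaf {Z : Scheme.{u}} (i : Y ⟶ Z) (M : Z.Modules)
    (f : ∀ y, M.presheaf.stalk (i y) →+ D y)
    (hf : ∀ y (r : Z.presheaf.stalk (i y)) m, f y (r • m) = (i.stalkMap y).hom r • f y m) :
    M ⟶ (Scheme.Modules.pushforward i).obj (productSheaf D) where
  val := PresheafOfModules.homMk
    { app U := AddCommGrpCat.ofHom
        { toFun s y := f y.1 (M.presheaf.germ U.unop (i y.1) y.2 s)
          map_zero' := funext fun y =>
            ((f y.1).comp (M.presheaf.germ U.unop (i y.1) y.2).hom).map_zero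
          map_add' s t := funext fun y =>
            ((f y.1).comp (M.presheaf.germ U.unop (i y.1) y.2).hom).map_add s t }
      naturality U V g := by
        ext s
        funext y
        exact congrArg (f y.1) (TopCat.Presheaf.germ_res_apply M.presheaf g.unop (i y.1) y.2 s) }
    (by
      intro U r m
      funext y
      have h1 : f y.1 (M.presheaf.germ U.unop (i y.1) y.2 (r • m)) =
          (i.stalkMap y.1).hom ((Z.presheaf.germ U.unop (i y.1) y.2).hom r) •
            f y.1 (M.presheaf.germ U.unop (i y.1) y.2 m) :=
        (congrArg (f y.1) (germ_smul_modules M U.unop (i y.1) y.2 r m)).trans (hf _ _ _)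
      have h2 : (i.stalkMap y.1).hom ((Z.presheaf.germ U.unop (i y.1) y.2).hom r) =
          (Y.presheaf.germ (i ⁻¹ᵁ U.unop) y.1 y.2).hom ((i.app U.unop).hom r) :=
        Scheme.Hom.germ_stalkMap_apply i U.unop y.1 y.2 r
      exact h1.trans (congrArg (fun t => t • f y.1 (M.presheaf.germ U.unop (i y.1) y.2 m)) h2))

end Godement

/-- A sheaf of modules is flasque if all sections extend. -/
def IsFlasqueModule {Y : Scheme.{u}} (M : Y.Modules) : Prop :=
  ∀ ⦃U V : Y.Opens⦄ (i : V ⟶ U), Function.Surjective (M.presheaf.map i.op)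

lemma isFlasqueModule_productSheaf {Y : Scheme.{u}} (D : Y → Type u) [∀ y, AddCommGroup (D y)]
    [∀ y, Module (Y.presheaf.stalk y) (D y)] : IsFlasqueModule (productSheaf D) := by
  intro U V i s
  classical
  let t : ∀ y : U, D y := fun y => if h : y.1 ∈ V then s ⟨y.1, h⟩ else 0
  refine ⟨t, ?_⟩
  funext y
  exact dif_pos y.2

lemma IsFlasqueModule.pushforward {X Y : Scheme.{u}} (f : X ⟶ Y) {M : X.Modules}
    (h : IsFlasqueModule M) : IsFlasqueModule ((Scheme.Modules.pushforward f).obj M) :=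
  fun _ _ i => h ((TopologicalSpace.Opens.map f.base).map i)

/-- The embedding of a sheaf of modules into the sheaf of families of germs. -/
lemma exists_mono_flasque {Y : Scheme.{u}} (M : Y.Modules) :
    ∃ (I : Y.Modules) (f : M ⟶ I), Mono f ∧ IsFlasqueModule I := by
  refine ⟨_, toProductSheaf (fun y => M.presheaf.stalk y) (𝟙 Y) M (fun y => AddMonoidHom.id _)
    (fun y r m => ?_), ?_, (isFlasqueModule_productSheaf _).pushforward _⟩
  · have h : ((𝟙 Y : Y ⟶ Y).stalkMap y).hom r = r := by
      exact ConcreteCategory.congr_hom (Scheme.Hom.stalkMap_id Y y) r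
    exact congrArg (fun t : Y.presheaf.stalk y => t • (show M.presheaf.stalk y from m)) h.symm
  · refine (Scheme.Modules.toPresheaf Y).mono_of_mono_map ?_
    refine @NatTrans.mono_of_mono_app _ _ _ _ _ _ _ fun U => ?_
    rw [AddCommGrpCat.mono_iff_injective]
    intro s t h
    exact TopCat.Presheaf.section_ext ⟨M.presheaf, M.isSheaf⟩ U.unop s t
      (fun y hy => congrFun h ⟨y, hy⟩)

lemma IsFlasqueModule.restrict {X Y : Scheme.{u}} (f : X ⟶ Y) [IsOpenImmersion f] {M : Y.Modules}
    (h : IsFlasqueModule M) : IsFlasqueModule (M.restrict f) :=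
  fun _ _ i => h (f.opensFunctor.map i)

lemma IsFlasqueModule.isFlasque {Y : Scheme.{u}} {M : Y.Modules} (h : IsFlasqueModule M) :
    TopCat.Sheaf.IsFlasque (X := Y) ((SheafOfModules.toSheaf Y.ringCatSheaf).obj M) where
  epi i := (AddCommGrpCat.epi_iff_surjective _).mpr (h i.unop)

/-- The sheaf of abelian groups underlying a sheaf of modules. -/
noncomputable abbrev toAbSheaf (Y : Scheme.{u}) : Y.Modules ⥤ TopCat.Sheaf Ab.{u} Y :=
  SheafOfModules.toSheaf Y.ringCatSheaf

instance (Y : Scheme.{u}) : (toAbSheaf Y).Additive where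
  map_add := rfl

instance (Y : Scheme.{u}) : PreservesFiniteLimits (toAbSheaf Y) :=
  inferInstanceAs (PreservesFiniteLimits (SheafOfModules.toSheaf Y.ringCatSheaf))

lemma shortExact_toSheaf {Y : Scheme.{u}} {S : ShortComplex Y.Modules} (hS : S.ShortExact) :
    (S.map (toAbSheaf Y)).ShortExact := by
  have := hS.mono_f
  have := hS.epi_g
  have h := ((Functor.preservesFiniteLimits_iff_forall_exact_map_and_mono
    (toAbSheaf Y)).mp inferInstance S hS)
  have := h.2
  exact { exact := h.1
          mono_f := h.2
          epi_g := @Functor.PreservesEpimorphisms.preserves _ _ _ _ _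
            (toSheaf_preservesEpi Y.ringCatSheaf) _ _ S.g hS.epi_g }

lemma surjective_app_of_isFlasque {Y : Scheme.{u}} {S : ShortComplex Y.Modules} (hS : S.ShortExact)
    (h : IsFlasqueModule S.X₁) (U : Y.Opens) : Function.Surjective (S.g.app U) := by
  have := h.isFlasque
  exact (AddCommGrpCat.epi_iff_surjective _).mp
    (@TopCat.Sheaf.IsFlasque.epi_of_shortExact _ U _ (shortExact_toSheaf hS) this)

lemma IsFlasqueModule.of_shortExact {Y : Scheme.{u}} {S : ShortComplex Y.Modules}
    (hS : S.ShortExact) (h₁ : IsFlasqueModule S.X₁) (h₂ : IsFlasqueModule S.X₂) :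
    IsFlasqueModule S.X₃ := by
  intro U V i s
  obtain ⟨t, rfl⟩ := surjective_app_of_isFlasque hS h₁ V s
  obtain ⟨t, rfl⟩ := h₂ i t
  exact ⟨S.g.app U t, (ConcreteCategory.congr_hom (S.g.mapPresheaf.naturality i.op) t).symm⟩

lemma exact_app {Y : Scheme.{u}} {S : ShortComplex Y.Modules} (hS : S.ShortExact) (U : Y.Opens)
    (s : Γ(S.X₂, U)) (h : S.g.app U s = 0) : ∃ t, S.f.app U t = s := by
  have h' := shortExact_toSheaf hS
  have := h'.mono_f
  obtain ⟨t, ht⟩ := TopCat.Sheaf.sections_exact_of_left_exact h'.1 h'.2 s h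
  exact ⟨t, ht⟩

lemma injective_app {Y : Scheme.{u}} {M N : Y.Modules} (f : M ⟶ N) [Mono f] (U : Y.Opens) :
    Function.Injective (f.app U) := by
  have : Mono f.mapPresheaf := inferInstanceAs (Mono ((Scheme.Modules.toPresheaf Y).map f))
  exact (AddCommGrpCat.mono_iff_injective _).mp ((NatTrans.mono_iff_mono_app _).mp this (.op U))

/-! ### A class of sheaves of modules adapted to all pullbacks -/

variable {Y : Scheme.{u}}

/-- A morphism of sheaves of modules such that every section of the target, together with a lift of
its restriction to an open subset, can be lifted; these are the epimorphisms with flasque kernel. -/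
def HasSectionLifting {N Q : Y.Modules} (f : N ⟶ Q) : Prop :=
  ∀ ⦃U V : Y.Opens⦄ (i : V ⟶ U) (q : Γ(Q, U)) (n : Γ(N, V)), f.app V n = Q.presheaf.map i.op q →
    ∃ n' : Γ(N, U), f.app U n' = q ∧ N.presheaf.map i.op n' = n

lemma app_map {M N : Y.Modules} (f : M ⟶ N) {U V : Y.Opens} (i : V ⟶ U) (s : Γ(M, U)) :
    f.app V (M.presheaf.map i.op s) = N.presheaf.map i.op (f.app U s) :=
  ConcreteCategory.congr_hom (f.mapPresheaf.naturality i.op) s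

lemma hasSectionLifting_of_shortExact {S : ShortComplex Y.Modules} (hS : S.ShortExact)
    (h : IsFlasqueModule S.X₁) : HasSectionLifting S.g := by
  intro U V i q n hn
  obtain ⟨m, rfl⟩ := surjective_app_of_isFlasque hS h U q
  obtain ⟨s, hs⟩ := exact_app hS V (S.X₂.presheaf.map i.op m - n) (by
    rw [map_sub, hn, app_map, sub_self])
  obtain ⟨s, rfl⟩ := h i s
  have h0 : S.g.app U (S.f.app U s) = 0 :=
    ConcreteCategory.congr_hom (congrArg (fun f => Scheme.Modules.Hom.app f U) S.zero) s
  refine ⟨m - S.f.app U s, ?_, ?_⟩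
  · rw [map_sub, h0, sub_zero]
  · rw [map_sub, ← app_map, hs, sub_sub_cancel]

lemma subsingleton_sections_bot (M : Y.Modules) : Subsingleton Γ(M, (⊥ : Y.Opens)) :=
  ⟨fun s t => TopCat.Presheaf.section_ext ⟨M.presheaf, M.isSheaf⟩ ⊥ s t (fun _ h => h.elim)⟩

lemma HasSectionLifting.surjective_app {N Q : Y.Modules} {f : N ⟶ Q} (hf : HasSectionLifting f)
    (U : Y.Opens) : Function.Surjective (f.app U) := by
  intro q
  have := subsingleton_sections_bot Q
  obtain ⟨n, hn, -⟩ := hf (homOfLE (bot_le : (⊥ : Y.Opens) ≤ U)) q 0 (Subsingleton.elim _ _)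
  exact ⟨n, hn⟩

lemma epi_of_surjective_app {N Q : Y.Modules} {f : N ⟶ Q}
    (hf : ∀ U : Y.Opens, Function.Surjective (f.app U)) : Epi f := by
  refine (Scheme.Modules.toPresheaf Y).epi_of_epi_map ?_
  have (U : (TopologicalSpace.Opens Y)ᵒᵖ) : Epi (((Scheme.Modules.toPresheaf Y).map f).app U) :=
    (AddCommGrpCat.epi_iff_surjective _).mpr (hf _)
  exact NatTrans.epi_of_epi_app _

lemma shortExact_kernel {A : Type*} [Category* A] [Abelian A] {N Q : A} (f : N ⟶ Q) [Epi f] :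
    (ShortComplex.mk (kernel.ι f) f (kernel.condition f)).ShortExact where
  exact := ShortComplex.exact_of_f_is_kernel _ (kernelIsKernel f)

lemma HasSectionLifting.isFlasqueModule {N Q : Y.Modules} {f : N ⟶ Q} (hf : HasSectionLifting f) :
    IsFlasqueModule (kernel f) := by
  have := epi_of_surjective_app hf.surjective_app
  intro U V i s
  have h0 (V : Y.Opens) (s : Γ(kernel f, V)) : f.app V ((kernel.ι f).app V s) = 0 :=
    ConcreteCategory.congr_hom (congrArg (fun f => Scheme.Modules.Hom.app f V)
      (kernel.condition f)) s
  obtain ⟨n, hn, hn'⟩ := hf i 0 ((kernel.ι f).app V s) (by rw [h0, map_zero])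
  obtain ⟨t, ht⟩ := exact_app (shortExact_kernel f) U n hn
  refine ⟨t, injective_app (kernel.ι f) V ?_⟩
  rw [app_map]
  exact (congrArg _ ht).trans hn'

variable (Y) in
/-- The sheaves of modules with the lifting property with respect to the epimorphisms with flasque
kernel. -/
def sectionProjective : ObjectProperty Y.Modules := fun P =>
  ∀ ⦃N Q : Y.Modules⦄ (f : N ⟶ Q), HasSectionLifting f → ∀ g : P ⟶ Q, ∃ h : P ⟶ N, h ≫ f = g

lemma HasSectionLifting.pushforward {X : Scheme.{u}} (j : X ⟶ Y) {N Q : X.Modules} {f : N ⟶ Q}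
    (hf : HasSectionLifting f) : HasSectionLifting ((Scheme.Modules.pushforward j).map f) :=
  fun _ _ i q n h => hf ((TopologicalSpace.Opens.map j.base).map i) q n h

lemma sectionProjective_restrict {X : Scheme.{u}} (j : X ⟶ Y) [IsOpenImmersion j] {P : Y.Modules}
    (hP : sectionProjective Y P) : sectionProjective X (P.restrict j) := by
  intro N Q f hf g
  let adj := Scheme.Modules.restrictAdjunction j
  obtain ⟨h, hh⟩ := hP _ (hf.pushforward j) (adj.homEquiv _ _ g)
  refine ⟨(adj.homEquiv _ _).symm h, ?_⟩
  rw [← adj.homEquiv_naturality_right_symm, hh, Equiv.symm_apply_apply]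

/-- Morphisms into flasque modules extend if the quotient is `sectionProjective`. -/
lemma exists_extension {S : ShortComplex Y.Modules} (hS : S.ShortExact)
    (h₃ : sectionProjective Y S.X₃) {F : Y.Modules} (hF : IsFlasqueModule F) (a : S.X₁ ⟶ F) :
    ∃ e : S.X₂ ⟶ F, S.f ≫ e = a := by
  -- The pushout along `a` is an extension of `S.X₃` by a flasque module, and hence splits.
  have := hS.mono_f
  have := hS.epi_g
  let q : pushout a S.f ⟶ S.X₃ := pushout.desc 0 S.g (by simp)
  have hq : pushout.inr a S.f ≫ q = S.g := pushout.inr_desc _ _ _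
  have hq' : pushout.inl a S.f ≫ q = 0 := pushout.inl_desc _ _ _
  have hepi : Epi (pushout.inr a S.f ≫ q) := by rw [hq]; infer_instance
  let T : ShortComplex Y.Modules := ShortComplex.mk (pushout.inl a S.f) q hq'
  have hTg : Epi T.g := epi_of_epi (pushout.inr a S.f) q
  have hT : T.ShortExact :=
    { exact := by
        refine ShortComplex.exact_of_g_is_cokernel _ (CokernelCofork.IsColimit.ofπ' _ _ ?_)
        intro Z k hk
        have hk' : S.f ≫ pushout.inr a S.f ≫ k = 0 := by
          rw [← pushout.condition_assoc]
          exact (congrArg (fun t => a ≫ t) hk).trans comp_zero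
        refine ⟨hS.exact.desc _ hk', ?_⟩
        apply pushout.hom_ext
        · rw [reassoc_of% hq', zero_comp]
          exact hk.symm
        · rw [reassoc_of% hq, hS.exact.g_desc]
      mono_f := inferInstanceAs (Mono (pushout.inl a S.f))
      epi_g := hTg }
  have := hT.mono_f
  have := hT.epi_g
  obtain ⟨σ, hσ⟩ := h₃ _ (hasSectionLifting_of_shortExact hT hF) (𝟙 _)
  have hr : (𝟙 T.X₂ - T.g ≫ σ) ≫ T.g = 0 := by
    rw [Preadditive.sub_comp, Category.assoc, hσ, Category.id_comp]
    exact (congrArg (fun t => T.g - t) (Category.comp_id _)).trans (sub_self _)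
  let r : T.X₂ ⟶ F := hT.exact.lift _ hr
  have hr' : r ≫ T.f = 𝟙 T.X₂ - T.g ≫ σ := hT.exact.lift_f _ hr
  refine ⟨pushout.inr a S.f ≫ r, ?_⟩
  have h1 : pushout.inl a S.f ≫ r = 𝟙 F := by
    rw [← cancel_mono T.f, Category.assoc, hr', Preadditive.comp_sub]
    have : pushout.inl a S.f ≫ T.g ≫ σ = 0 := by
      rw [reassoc_of% (show pushout.inl a S.f ≫ T.g = 0 from hq'), zero_comp]
    rw [this, sub_zero, Category.comp_id, Category.id_comp]
  rw [← pushout.condition_assoc, h1, Category.comp_id]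

/-- If `f : N ⟶ Q` is an epimorphism and `N` is embedded in `I`, then `N` is the fibre product of
`I` and `Q` over `I / ker f`. -/
lemma exists_lift_of_comp_eq {A : Type*} [Category* A] [Abelian A] {N Q I L : A} (f : N ⟶ Q)
    [Epi f] (ι : N ⟶ I) [Mono ι] (t : Q ⟶ cokernel (kernel.ι f ≫ ι))
    (ht : f ≫ t = ι ≫ cokernel.π (kernel.ι f ≫ ι)) (g : L ⟶ Q) (l : L ⟶ I)
    (hl : l ≫ cokernel.π (kernel.ι f ≫ ι) = g ≫ t) : ∃ h : L ⟶ N, h ≫ f = g := by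
  let u : cokernel (kernel.ι f ≫ ι) ⟶ cokernel ι := cokernel.desc _ (cokernel.π ι) (by simp)
  have hu : cokernel.π (kernel.ι f ≫ ι) ≫ u = cokernel.π ι := cokernel.π_desc _ _ _
  have htu : t ≫ u = 0 := by
    rw [← cancel_epi f, reassoc_of% ht, hu, cokernel.condition, comp_zero]
  have hl' : l ≫ cokernel.π ι = 0 := by
    rw [← hu, reassoc_of% hl, htu, comp_zero]
  have hex : (ShortComplex.mk ι (cokernel.π ι) (cokernel.condition ι)).Exact :=
    ShortComplex.exact_of_g_is_cokernel _ (cokernelIsCokernel ι)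
  have : Mono (ShortComplex.mk ι (cokernel.π ι) (cokernel.condition ι)).f := ‹Mono ι›
  let h : L ⟶ N := hex.lift l hl'
  have hh : h ≫ ι = l := hex.lift_f l hl'
  have hmono : Mono t := by
    rw [Preadditive.mono_iff_cancel_zero]
    intro T x hx
    obtain ⟨T', π, hπ, n, hn⟩ := surjective_up_to_refinements_of_epi f x
    have hc : (ShortComplex.mk (kernel.ι f ≫ ι) (cokernel.π (kernel.ι f ≫ ι))
      (cokernel.condition _)).Exact :=
        ShortComplex.exact_of_g_is_cokernel _ (cokernelIsCokernel _)
    obtain ⟨T'', π', hπ', s, hs⟩ := hc.exact_up_to_refinements (n ≫ ι) (by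
      change (n ≫ ι) ≫ cokernel.π (kernel.ι f ≫ ι) = 0
      rw [Category.assoc, ← ht, ← reassoc_of% hn, hx, comp_zero])
    change π' ≫ n ≫ ι = s ≫ kernel.ι f ≫ ι at hs
    have hs' : π' ≫ n = s ≫ kernel.ι f := by
      rw [← cancel_mono ι, Category.assoc, hs, Category.assoc]
    rw [← cancel_epi π, ← cancel_epi π', hn, reassoc_of% hs', kernel.condition]
    simp
  refine ⟨h, ?_⟩
  rw [← cancel_mono t, Category.assoc, ht, reassoc_of% hh, hl]

/-- A morphism from `S.X₁` to the target `Q` of an epimorphism `f : N ⟶ Q` with flasque kernel is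
lifted as follows: embed `N` into a flasque module `I`, extend the morphism `S.X₁ ⟶ I / ker f` to
`S.X₂`, and lift the extension to `I`. -/
lemma sectionProjective_kernel {S : ShortComplex Y.Modules} (hS : S.ShortExact)
    (h₂ : sectionProjective Y S.X₂) (h₃ : sectionProjective Y S.X₃) :
    sectionProjective Y S.X₁ := by
  intro N Q f hf g
  have := epi_of_surjective_app hf.surjective_app
  obtain ⟨I, ι, hι, hI⟩ := exists_mono_flasque N
  have hex := (shortExact_kernel f)
  let t : Q ⟶ cokernel (kernel.ι f ≫ ι) :=
    hex.exact.desc (ι ≫ cokernel.π (kernel.ι f ≫ ι)) (by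
      rw [← Category.assoc]; exact cokernel.condition _)
  have ht : f ≫ t = ι ≫ cokernel.π (kernel.ι f ≫ ι) := hex.exact.g_desc _ _
  have hses : (ShortComplex.mk (kernel.ι f ≫ ι) (cokernel.π (kernel.ι f ≫ ι))
      (cokernel.condition _)).ShortExact :=
    { exact := ShortComplex.exact_of_g_is_cokernel _ (cokernelIsCokernel _)
      mono_f := inferInstanceAs (Mono (kernel.ι f ≫ ι))
      epi_g := inferInstanceAs (Epi (cokernel.π (kernel.ι f ≫ ι))) }
  obtain ⟨e, he⟩ := exists_extension hS h₃
    (IsFlasqueModule.of_shortExact hses hf.isFlasqueModule hI) (g ≫ t)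
  obtain ⟨e', he'⟩ := h₂ _ (hasSectionLifting_of_shortExact hses hf.isFlasqueModule) e
  exact exists_lift_of_comp_eq f ι t ht g (S.f ≫ e') (by
    rw [Category.assoc, ← he, ← he'])

/-- The pullback along `i` preserves monomorphisms with `sectionProjective` cokernel: an embedding
of the pullback of `S.X₁` into a flasque module extends to the pullback of `S.X₂`. -/
lemma sectionProjective_mono_pullback {X : Scheme.{u}} (i : X ⟶ Y) {S : ShortComplex Y.Modules}
    (hS : S.ShortExact) (h₃ : sectionProjective Y S.X₃) :
    Mono ((Scheme.Modules.pullback i).map S.f) := by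
  let adj := Scheme.Modules.pullbackPushforwardAdjunction i
  obtain ⟨J, ι, hι, hJ⟩ := exists_mono_flasque ((Scheme.Modules.pullback i).obj S.X₁)
  obtain ⟨e, he⟩ := exists_extension hS h₃ (hJ.pushforward i) (adj.homEquiv _ _ ι)
  have h : (Scheme.Modules.pullback i).map S.f ≫ (adj.homEquiv _ _).symm e = ι := by
    rw [← adj.homEquiv_naturality_left_symm, he, Equiv.symm_apply_apply]
  have : Mono ((Scheme.Modules.pullback i).map S.f ≫ (adj.homEquiv _ _).symm e) := by
    rw [h]; infer_instance
  exact mono_of_mono _ ((adj.homEquiv _ _).symm e)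

/-- Sheafification of presheaves of modules. -/
noncomputable def modulesSheafification (Y : Scheme.{u}) : Y.PresheafOfModules ⥤ Y.Modules :=
  PresheafOfModules.sheafification (𝟙 Y.ringCatSheaf.obj)

/-- Sheafification is left adjoint to the forgetful functor. -/
noncomputable def modulesSheafificationAdjunction (Y : Scheme.{u}) :
    modulesSheafification Y ⊣ Scheme.Modules.toPresheafOfModules Y :=
  PresheafOfModules.sheafificationAdjunction (𝟙 Y.ringCatSheaf.obj)

instance (Y : Scheme.{u}) : IsIso (modulesSheafificationAdjunction Y).counit :=
  inferInstanceAs (IsIso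
      (PresheafOfModules.sheafificationAdjunction (𝟙 Y.ringCatSheaf.obj)).counit)

lemma exists_freeYoneda_lift {P N Q : Y.PresheafOfModules} (f : N ⟶ Q)
    (hf : ∀ U, Function.Surjective (f.app U)) {U : Y.Opens}
    (hP : P = (PresheafOfModules.free _).obj (yoneda.obj U)) (g : P ⟶ Q) :
    ∃ h : P ⟶ N, h ≫ f = g := by
  subst hP
  obtain ⟨n, hn⟩ := hf _ (PresheafOfModules.freeYonedaEquiv g)
  refine ⟨PresheafOfModules.freeYonedaEquiv.symm n, PresheafOfModules.freeYonedaEquiv.injective ?_⟩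
  refine (PresheafOfModules.freeYonedaEquiv_comp _ _).trans ?_
  exact (congrArg _ (PresheafOfModules.freeYonedaEquiv.apply_symm_apply n)).trans hn

lemma exists_freeYonedaCoproduct_lift (M : Y.PresheafOfModules) {N Q : Y.PresheafOfModules}
    (f : N ⟶ Q) (hf : ∀ U, Function.Surjective (f.app U))
    (g : PresheafOfModules.freeYonedaCoproduct M ⟶ Q) :
    ∃ h : PresheafOfModules.freeYonedaCoproduct M ⟶ N, h ≫ f = g := by
  choose h hh using fun m : PresheafOfModules.Elements M =>
    exists_freeYoneda_lift f hf (U := m.1.unop) rfl (PresheafOfModules.ιFreeYonedaCoproduct M m ≫ g)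
  refine ⟨Sigma.desc h, ?_⟩
  apply Sigma.hom_ext
  intro m
  rw [Sigma.ι_desc_assoc, hh]

lemma sectionProjective_sheafification (P : Y.PresheafOfModules)
    (hP : ∀ ⦃N Q : Y.PresheafOfModules⦄ (f : N ⟶ Q), (∀ U, Function.Surjective (f.app U)) →
      ∀ g : P ⟶ Q, ∃ h : P ⟶ N, h ≫ f = g) :
    sectionProjective Y ((modulesSheafification Y).obj P) := by
  intro N Q f hf g
  let adj := modulesSheafificationAdjunction Y
  obtain ⟨h, hh⟩ := hP ((Scheme.Modules.toPresheafOfModules Y).map f)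
    (fun U => hf.surjective_app U.unop) (adj.homEquiv _ _ g)
  refine ⟨(adj.homEquiv _ _).symm h, ?_⟩
  rw [← adj.homEquiv_naturality_right_symm, hh, Equiv.symm_apply_apply]

/-- Every sheaf of modules is a quotient of a direct sum of extensions by zero of structure sheaves
of open subsets, that is, of the sheafification of a coproduct of free presheaves on representable
presheaves; these lift against morphisms which are surjective on sections. -/
lemma exists_epi_sectionProjective (M : Y.Modules) :
    ∃ (P : Y.Modules) (π : P ⟶ M), sectionProjective Y P ∧ Epi π := by
  let adj := modulesSheafificationAdjunction Y
  let M' := (Scheme.Modules.toPresheafOfModules Y).obj M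
  refine ⟨(modulesSheafification Y).obj (PresheafOfModules.freeYonedaCoproduct M'),
    (adj.homEquiv _ _).symm (PresheafOfModules.fromFreeYonedaCoproduct M'),
    sectionProjective_sheafification _ fun N Q f hf g =>
      exists_freeYonedaCoproduct_lift M' f hf g, ?_⟩
  have : (modulesSheafification Y).IsLeftAdjoint := adj.isLeftAdjoint
  have : Epi (PresheafOfModules.fromFreeYonedaCoproduct M') := inferInstance
  have : IsIso adj.counit := inferInstanceAs (IsIso (modulesSheafificationAdjunction Y).counit)
  rw [adj.homEquiv_counit]
  infer_instance

/-- Derived pullbacks can be computed with resolutions by modules in `sectionProjective`. -/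
lemma isAdapted_sectionProjective {X : Scheme.{u}} (i : X ⟶ Y) :
    IsAdapted (Scheme.Modules.pullback i) (sectionProjective Y) where
  isClosedUnderIsomorphisms := ⟨fun {P P'} e hP N Q f hf g => by
    obtain ⟨h, hh⟩ := hP f hf (e.hom ≫ g)
    exact ⟨e.inv ≫ h, by rw [Category.assoc, hh, e.inv_hom_id_assoc]⟩⟩
  prop_of_isZero M hM N Q f hf g := ⟨0, hM.eq_of_src _ _⟩
  prop_biprod M N hM hN K Q f hf g := by
    obtain ⟨h, hh⟩ := hM f hf (biprod.inl ≫ g)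
    obtain ⟨h', hh'⟩ := hN f hf (biprod.inr ≫ g)
    refine ⟨biprod.desc h h', ?_⟩
    apply biprod.hom_ext'
    · rw [biprod.inl_desc_assoc, hh]
    · rw [biprod.inr_desc_assoc, hh']
  exists_epi := exists_epi_sectionProjective
  prop_kernel _ hS h₂ h₃ := sectionProjective_kernel hS h₂ h₃
  mono_map _ hS h₃ := sectionProjective_mono_pullback i hS h₃

/-! ### Free sheaves of modules, and base change of pullbacks along open immersions -/

section free

variable {Y : Scheme.{u}}

/-- Mathlib's global sections of a sheaf of modules are compatible families of sections over all
open subsets; they are the same as sections over `Y`. -/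
noncomputable def sectionsEquiv (M : Y.Modules) :
    SheafOfModules.sections (R := Y.ringCatSheaf) M ≃ Γ(M, (⊤ : Y.Opens)) where
  toFun s := s.1 (.op ⊤)
  invFun s := PresheafOfModules.sectionsMk (fun U => M.presheaf.map (homOfLE le_top).op s)
    (fun U V f => by
      refine (ConcreteCategory.congr_hom (M.presheaf.map_comp _ f) s).symm.trans ?_
      rfl)
  left_inv s := by
    apply PresheafOfModules.sections_ext
    intro U
    exact s.2 _
  right_inv s := ConcreteCategory.congr_hom (M.presheaf.map_id _) s

variable (Y) in
/-- The free sheaf of modules on the set `I`. -/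
noncomputable def freeModule (I : Type u) : Y.Modules :=
  SheafOfModules.free I

/-- A morphism out of a free module is the same as a family of global sections. -/
noncomputable def freeEquiv (M : Y.Modules) (I : Type u) :
    (freeModule Y I ⟶ M) ≃ (I → Γ(M, (⊤ : Y.Opens))) :=
  (SheafOfModules.freeHomEquiv (R := Y.ringCatSheaf) M).trans
    (Equiv.arrowCongr (Equiv.refl I) (sectionsEquiv M))

lemma freeEquiv_comp {M N : Y.Modules} {I : Type u} (f : freeModule Y I ⟶ M)
    (p : M ⟶ N) (i : I) : freeEquiv N I (f ≫ p) i = p.app ⊤ (freeEquiv M I f i) := rfl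

lemma sectionProjective_free (I : Type u) :
    sectionProjective Y (freeModule Y I) := by
  intro N Q f hf g
  choose n hn using fun i => hf.surjective_app ⊤ (freeEquiv Q I g i)
  refine ⟨(freeEquiv N I).symm n, (freeEquiv Q I).injective (funext fun i => ?_)⟩
  rw [freeEquiv_comp, Equiv.apply_symm_apply, hn]

end free

section square

variable {X Y X' Y' : Scheme.{u}} (p : X ⟶ Y) (p' : X' ⟶ Y') (j' : X' ⟶ X) (j : Y' ⟶ Y)
  [IsOpenImmersion j] [IsOpenImmersion j'] (h : j' ≫ p = p' ≫ j)

/-- The canonical isomorphism of pushforwards along the two composites of a commutative square. -/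
noncomputable def pushSquareIso : Scheme.Modules.pushforward j' ⋙ Scheme.Modules.pushforward p ≅
    Scheme.Modules.pushforward p' ⋙ Scheme.Modules.pushforward j :=
  Scheme.Modules.pushforwardComp j' p ≪≫ Scheme.Modules.pushforwardCongr h ≪≫
    (Scheme.Modules.pushforwardComp p' j).symm

/-- The comparison between the restriction of a pushforward and the pushforward of the
restriction. -/
noncomputable def pushforwardRestrict : TwoSquare (Scheme.Modules.pushforward p)
    (Scheme.Modules.restrictFunctor j') (Scheme.Modules.restrictFunctor j)
    (Scheme.Modules.pushforward p') :=
  (mateEquiv (Scheme.Modules.restrictAdjunction j') (Scheme.Modules.restrictAdjunction j)).symm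
    (.mk _ _ _ _ (pushSquareIso p p' j' j h).hom)

/-- The comparison between the pullback of a restriction and the restriction of the pullback. -/
noncomputable def restrictPullback : TwoSquare (Scheme.Modules.restrictFunctor j)
    (Scheme.Modules.pullback p) (Scheme.Modules.pullback p') (Scheme.Modules.restrictFunctor j') :=
  (mateEquiv (Scheme.Modules.pullbackPushforwardAdjunction p)
    (Scheme.Modules.pullbackPushforwardAdjunction p')).symm (pushforwardRestrict p p' j' j h)

instance isIso_restrictPullback : IsIso (restrictPullback p p' j' j h).natTrans := by
  -- The comparison is conjugate to the isomorphism of the two composite pushforwards.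
  have : IsIso (pushSquareIso p p' j' j h).hom := inferInstance
  have e := iterated_mateEquiv_conjugateEquiv_symm
    (Scheme.Modules.pullbackPushforwardAdjunction p)
    (Scheme.Modules.pullbackPushforwardAdjunction p')
    (Scheme.Modules.restrictAdjunction j)
    (Scheme.Modules.restrictAdjunction j')
    (.mk _ _ _ _ (pushSquareIso p p' j' j h).hom)
  have e' : (restrictPullback p p' j' j h).natTrans =
      (conjugateEquiv ((Scheme.Modules.pullbackPushforwardAdjunction p).comp
        (Scheme.Modules.restrictAdjunction j'))
        ((Scheme.Modules.restrictAdjunction j).comp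
          (Scheme.Modules.pullbackPushforwardAdjunction p'))).symm
            (pushSquareIso p p' j' j h).hom := e
  rw [e']
  infer_instance

/-- The restriction of the pullback is the pullback of the restriction. -/
noncomputable def restrictPullbackIso :
    Scheme.Modules.restrictFunctor j ⋙ Scheme.Modules.pullback p' ≅
      Scheme.Modules.pullback p ⋙ Scheme.Modules.restrictFunctor j' :=
  asIso (restrictPullback p p' j' j h).natTrans

/-- The restriction of the unit, in terms of the adjunction for the restricted morphism. -/
lemma restrict_unit_comp (M : Y.Modules) :
    (Scheme.Modules.restrictFunctor j).map
      ((Scheme.Modules.pullbackPushforwardAdjunction p).unit.app M) ≫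
        (pushforwardRestrict p p' j' j h).natTrans.app _ =
    (Scheme.Modules.pullbackPushforwardAdjunction p').unit.app _ ≫
      (Scheme.Modules.pushforward p').map ((restrictPullbackIso p p' j' j h).hom.app M) :=
  unit_mateEquiv_symm _ _ (pushforwardRestrict p p' j' j h) M

end square

/-! ### Derived pullbacks of vector bundles -/

section local_exactness

variable {X : Scheme.{u}}

lemma subsingleton_sections_of_isZero {M : X.Modules} (h : IsZero M) (U : X.Opens) :
    Subsingleton Γ(M, U) := by
  have h0 : ∀ s : Γ(M, U), s = 0 := fun s =>
    ConcreteCategory.congr_hom (congrArg (fun f => Scheme.Modules.Hom.app f U)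
      (h.eq_of_src (𝟙 M) 0)) s
  exact ⟨fun s t => (h0 s).trans (h0 t).symm⟩

lemma isZero_of_subsingleton_sections {M : X.Modules} (h : ∀ U : X.Opens, Subsingleton Γ(M, U)) :
    IsZero M := by
  rw [IsZero.iff_id_eq_zero]
  ext U s
  exact Subsingleton.elim _ _

lemma isZero_of_locally {M : X.Modules}
    (h : ∀ x : X, ∃ U : X.Opens, x ∈ U ∧ IsZero (M.restrict U.ι)) : IsZero M := by
  refine isZero_of_subsingleton_sections fun W => ⟨fun s t => ?_⟩
  refine TopCat.Presheaf.section_ext ⟨M.presheaf, M.isSheaf⟩ W s t fun x hx => ?_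
  obtain ⟨U, hU, hM⟩ := h x
  have hs := subsingleton_sections_of_isZero hM (U.ι ⁻¹ᵁ W)
  have hs' : Subsingleton Γ(M, U.ι ''ᵁ (U.ι ⁻¹ᵁ W)) := hs
  have hx' : x ∈ U.ι ''ᵁ (U.ι ⁻¹ᵁ W) := ⟨⟨x, hU⟩, hx, rfl⟩
  have hle : U.ι ''ᵁ (U.ι ⁻¹ᵁ W) ≤ W := U.ι.image_preimage_le W
  have e : M.presheaf.map (homOfLE hle).op s = M.presheaf.map (homOfLE hle).op t :=
    Subsingleton.elim _ _
  have := congrArg (TopCat.Presheaf.germ M.presheaf _ x hx') e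
  rwa [TopCat.Presheaf.germ_res_apply, TopCat.Presheaf.germ_res_apply] at this

instance {Y : Scheme.{u}} (j : X ⟶ Y) [IsOpenImmersion j] :
    (Scheme.Modules.restrictFunctor j).IsLeftAdjoint :=
  (Scheme.Modules.restrictAdjunction j).isLeftAdjoint

lemma exactAt_map {A B : Type*} [Category* A] [Abelian A] [Category* B] [Abelian B] (F : A ⥤ B)
    [F.Additive] [PreservesFiniteLimits F] [PreservesFiniteColimits F] {K : CochainComplex A ℤ}
    {n : ℤ} (h : K.ExactAt n) : ((onComplexes F).obj K).ExactAt n :=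
  ShortComplex.Exact.map h F

lemma isZero_homology_of_exactAt_map {A B : Type*} [Category* A] [Abelian A] [Category* B]
    [Abelian B] (F : A ⥤ B)
    [F.Additive] [PreservesFiniteLimits F] [PreservesFiniteColimits F] {K : CochainComplex A ℤ}
    {n : ℤ} (h : ((onComplexes F).obj K).ExactAt n) : IsZero (F.obj (K.homology n)) := by
  have h' : ((K.sc n).map F).Exact := h
  rw [ShortComplex.exact_iff_isZero_homology] at h'
  exact h'.of_iso ((K.sc n).mapHomologyIso F).symm

lemma exactAt_of_locally (K : CochainComplex X.Modules ℤ) (n : ℤ)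
    (h : ∀ x : X, ∃ U : X.Opens, x ∈ U ∧
      ((onComplexes (Scheme.Modules.restrictFunctor U.ι)).obj K).ExactAt n) : K.ExactAt n := by
  rw [HomologicalComplex.exactAt_iff_isZero_homology]
  refine isZero_of_locally fun x => ?_
  obtain ⟨U, hU, hK⟩ := h x
  exact ⟨U, hU, isZero_homology_of_exactAt_map _ hK⟩

end local_exactness

section pullback_exact

variable {X Y : Scheme.{u}} (p : X ⟶ Y)

lemma isoClosed_sectionProjective {P Q : Y.Modules} (e : P ≅ Q) (h : sectionProjective Y P) :
    sectionProjective Y Q :=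
  (isAdapted_sectionProjective (𝟙 Y)).isClosedUnderIsomorphisms.of_iso e h

/-- The restrictions to `p⁻¹ U` of the pullback of a complex. -/
noncomputable def restrictPullbackComplexIso (K : CochainComplex Y.Modules ℤ) (U : Y.Opens) :
    (onComplexes (Scheme.Modules.pullback (p ∣_ U))).obj
      ((onComplexes (Scheme.Modules.restrictFunctor U.ι)).obj K) ≅
    (onComplexes (Scheme.Modules.restrictFunctor (p ⁻¹ᵁ U).ι)).obj
      ((onComplexes (Scheme.Modules.pullback p)).obj K) :=
  (complexComp (restrictPullbackIso p (p ∣_ U) (p ⁻¹ᵁ U).ι U.ι (morphismRestrict_ι p U).symm)).app K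

lemma isStrictlyLE_map {A B : Type*} [Category* A] [Abelian A] [Category* B] [Abelian B] (F : A ⥤ B)
    [F.Additive] (K : CochainComplex A ℤ) (b : ℤ) [hK : K.IsStrictlyLE b] :
    ((onComplexes F).obj K : CochainComplex B ℤ).IsStrictlyLE b := by
  rw [CochainComplex.isStrictlyLE_iff] at hK ⊢
  exact fun i hi => F.map_isZero (hK i hi)

/-- A complex of sheaves of modules whose terms are, locally on a common open cover, in the class
adapted to pullbacks. -/
def IsLocallySectionProjective (K : CochainComplex Y.Modules ℤ) : Prop :=
  ∀ y : Y, ∃ U : Y.Opens, y ∈ U ∧ ∀ n, sectionProjective U ((K.X n).restrict U.ι)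

lemma IsLocallySectionProjective.acyclic_pullback {K : CochainComplex Y.Modules ℤ}
    (hK : IsLocallySectionProjective K) (b : ℤ) [K.IsStrictlyLE b] (he : K.Acyclic) :
    ((onComplexes (Scheme.Modules.pullback p)).obj K).Acyclic := by
  intro n
  refine exactAt_of_locally _ n fun x => ?_
  obtain ⟨U, hU, hG⟩ := hK (p x)
  refine ⟨p ⁻¹ᵁ U, hU, HomologicalComplex.ExactAt.of_iso ?_ (restrictPullbackComplexIso p K U)⟩
  have := isStrictlyLE_map (Scheme.Modules.restrictFunctor U.ι) K b
  exact (isAdapted_sectionProjective (p ∣_ U)).acyclic_map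
    ((onComplexes (Scheme.Modules.restrictFunctor U.ι)).obj K) b hG
    (fun m => exactAt_map (Scheme.Modules.restrictFunctor U.ι) (he m)) n

lemma isStrictlyLE_mappingCone {A : Type*} [Category* A] [Abelian A] {K L : CochainComplex A ℤ}
    (φ : K ⟶ L) (b : ℤ) [hK : K.IsStrictlyLE b] [hL : L.IsStrictlyLE b] :
    (CochainComplex.mappingCone φ).IsStrictlyLE b := by
  rw [CochainComplex.isStrictlyLE_iff] at hK hL ⊢
  intro i hi
  refine IsZero.of_iso ?_ (HomologicalComplex.homotopyCofiber.XIsoBiprod φ i (i + 1) (by simp))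
  exact (biprod_isZero_iff _ _).mpr ⟨hK _ (by omega), hL _ hi⟩

lemma prop_mappingCone {A B : Type*} [Category* A] [Abelian A] [Category* B] [Abelian B]
    {F : A ⥤ B} {G : ObjectProperty A} (hG : IsAdapted F G) {K L : CochainComplex A ℤ} (φ : K ⟶ L)
    (hK : ∀ n, G (K.X n)) (hL : ∀ n, G (L.X n)) (n : ℤ) :
    G ((CochainComplex.mappingCone φ).X n) := by
  have := hG.isClosedUnderIsomorphisms
  exact G.prop_of_iso (HomologicalComplex.homotopyCofiber.XIsoBiprod φ n (n + 1) (by simp)).symm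
    (hG.prop_biprod _ _ (hK _) (hL _))

lemma IsLocallySectionProjective.mappingCone {K L : CochainComplex Y.Modules ℤ} (φ : K ⟶ L)
    (hK : IsLocallySectionProjective K) (hL : IsLocallySectionProjective L) :
    IsLocallySectionProjective (CochainComplex.mappingCone φ) := by
  intro y
  obtain ⟨U, hU, hG⟩ := hK y
  obtain ⟨V, hV, hG'⟩ := hL y
  refine ⟨U ⊓ V, ⟨hU, hV⟩, fun n => ?_⟩
  have hres {W : Y.Opens} (hW : U ⊓ V ≤ W) {M : Y.Modules}
      (hM : sectionProjective W (M.restrict W.ι)) :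
      sectionProjective (U ⊓ V : Y.Opens) (M.restrict (U ⊓ V).ι) := by
    refine isoClosed_sectionProjective ?_ (sectionProjective_restrict (Y.homOfLE hW) hM)
    exact (Scheme.Modules.restrictFunctorComp _ _).symm.app M ≪≫
      (Scheme.Modules.restrictFunctorCongr (Y.homOfLE_ι hW)).app M
  have e := HomologicalComplex.homotopyCofiber.XIsoBiprod φ n (n + 1) (by simp)
  have : PreservesBinaryBiproduct (K.X (n + 1)) (L.X n)
      (Scheme.Modules.restrictFunctor (U ⊓ V).ι) :=
    preservesBinaryBiproduct_of_preservesBinaryProduct _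
  refine isoClosed_sectionProjective (((Scheme.Modules.restrictFunctor (U ⊓ V).ι).mapIso e ≪≫
    (Scheme.Modules.restrictFunctor (U ⊓ V).ι).mapBiprod _ _)).symm ?_
  exact (isAdapted_sectionProjective (𝟙 _)).prop_biprod _ _
    (hres inf_le_left (hG _)) (hres inf_le_right (hG' _))

lemma isLocallySectionProjective_of_prop {K : CochainComplex Y.Modules ℤ}
    (hK : ∀ n, sectionProjective Y (K.X n)) : IsLocallySectionProjective K :=
  fun _ => ⟨⊤, trivial, fun n => sectionProjective_restrict _ (hK n)⟩

/-- Pullback preserves quasi-isomorphisms between bounded above complexes which are locally adapted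
to it. -/
lemma quasiIso_pullback {K L : CochainComplex Y.Modules ℤ} (φ : K ⟶ L) [QuasiIso φ]
    (hK : IsLocallySectionProjective K) (hL : IsLocallySectionProjective L) (b : ℤ)
    [K.IsStrictlyLE b] [L.IsStrictlyLE b] :
    QuasiIso ((onComplexes (Scheme.Modules.pullback p)).map φ) := by
  rw [quasiIso_map_iff_acyclic]
  have := isStrictlyLE_mappingCone φ b
  exact (hK.mappingCone φ hL).acyclic_pullback p b
    ((quasiIso_iff_acyclic_mappingCone φ).mp inferInstance)

/-- A vector bundle is locally free, and free modules are `sectionProjective`. -/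
lemma IsVectorBundle.isLocallySectionProjective {M : Y.Modules}
    (hM : IsVectorBundle Y M) :
    IsLocallySectionProjective ((CochainComplex.singleFunctor Y.Modules 0).obj M) := by
  intro y
  obtain ⟨U, hU, n, ⟨e⟩⟩ := hM y
  refine ⟨U, hU, fun m => ?_⟩
  by_cases h : m = 0
  · subst h
    refine isoClosed_sectionProjective ?_ (sectionProjective_free (Y := (U : Scheme.{u}))
      (ULift.{u} (Fin n)))
    exact ((Scheme.Modules.restrictFunctor U.ι).mapIso
      (HomologicalComplex.singleObjXSelf (.up ℤ) 0 M) ≪≫ e).symm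
  · exact (isAdapted_sectionProjective (𝟙 _)).prop_of_isZero _
      ((Scheme.Modules.restrictFunctor U.ι).map_isZero
        (HomologicalComplex.isZero_single_obj_X (.up ℤ) 0 M m h))

end pullback_exact

section degree_zero

variable {A B : Type*} [Category* A] [Abelian A] [Category* B] [Abelian B] {L : A ⥤ B} {R : B ⥤ A}
  (adj : L ⊣ R) [L.Additive] [R.Additive]

variable (A) in
/-- The term in degree `0` of a complex concentrated in degree `0`. -/
noncomputable def singleZeroIso (M : A) : ((CochainComplex.singleFunctor A 0).obj M).X 0 ≅ M :=
  HomologicalComplex.singleObjXSelf (.up ℤ) 0 M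

lemma isZero_single_X (M : A) (n : ℤ) (h : n ≠ 0) :
    IsZero (((CochainComplex.singleFunctor A 0).obj M).X n) :=
  HomologicalComplex.isZero_single_obj_X (.up ℤ) 0 M n h

/-- A morphism `M ⟶ R N`, as a morphism of complexes concentrated in degree `0`. -/
noncomputable def singleArrow (R : B ⥤ A) [R.Additive] {M : A} {N : B} (a : M ⟶ R.obj N) :
    (CochainComplex.singleFunctor A 0).obj M ⟶
      (onComplexes R).obj ((CochainComplex.singleFunctor B 0).obj N) :=
  (CochainComplex.singleFunctor A 0).map a ≫ (R.mapCochainComplexSingleFunctor 0).inv.app N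

lemma single_map_f_zero {M M' : A} (a : M ⟶ M') : ((CochainComplex.singleFunctor A 0).map a).f 0 =
    (singleZeroIso A M).hom ≫ a ≫ (singleZeroIso A M').inv :=
  HomologicalComplex.single_map_f_self _ _ _

lemma singleArrow_f_zero {M : A} {N : B} (a : M ⟶ R.obj N) :
    (singleArrow R a).f 0 = (singleZeroIso A M).hom ≫ a ≫ R.map (singleZeroIso B N).inv := by
  have h2 : ((R.mapCochainComplexSingleFunctor 0).inv.app N).f 0 =
      (singleZeroIso A (R.obj N)).hom ≫ R.map (singleZeroIso B N).inv :=
    HomologicalComplex.singleMapHomologicalComplex_inv_app_self _ _ _ _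
  have h3 {W : A} (x : W ⟶ M) {Z : A} (e : Z ≅ R.obj N) {T : A} (y : R.obj N ⟶ T) :
      (x ≫ a ≫ e.inv) ≫ e.hom ≫ y = x ≫ a ≫ y := by simp
  exact (congrArg₂ (· ≫ ·) (single_map_f_zero a) h2).trans (h3 _ _ _)

lemma adjunct_singleArrow_f_zero {M : A} {N : B} (a : M ⟶ R.obj N) :
    (adjunct adj (singleArrow R a)).f 0 = L.map (singleZeroIso A M).hom ≫
      (adj.homEquiv M N).symm a ≫ (singleZeroIso B N).inv := by
  change (adj.homEquiv _ _).symm ((singleArrow R a).f 0) = _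
  rw [singleArrow_f_zero, adj.homEquiv_naturality_left_symm, adj.homEquiv_naturality_right_symm]

lemma isIso_adjunct_singleArrow {M : A} {N : B} (a : M ⟶ R.obj N)
    [IsIso ((adj.homEquiv M N).symm a)] : IsIso (adjunct adj (singleArrow R a)) := by
  have (n : ℤ) : IsIso ((adjunct adj (singleArrow R a)).f n) := by
    by_cases h : n = 0
    · subst h
      have h1 {X Y Z W : B} (x : X ≅ Y) (y : Y ⟶ Z) [IsIso y] (z : Z ≅ W) :
        IsIso (x.hom ≫ y ≫ z.hom) := inferInstance
      exact (adjunct_singleArrow_f_zero adj a).symm ▸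
        h1 (L.mapIso (singleZeroIso A M)) ((adj.homEquiv M N).symm a) (singleZeroIso B N).symm
    · exact ⟨0, (L.map_isZero (isZero_single_X M n h)).eq_of_src _ _,
        (isZero_single_X N n h).eq_of_src _ _⟩
  exact HomologicalComplex.Hom.isIso_of_components _

end degree_zero

/-- `arrowInDegreeZero` is the image in the derived category of a morphism of complexes. -/
lemma arrowInDegreeZero_eq {Y Z : Scheme.{u}} (i : Y ⟶ Z) [IsTopIso i] {M : Z.Modules}
    {N : Y.Modules} (a : M ⟶ (Scheme.Modules.pushforward i).obj N) :
    arrowInDegreeZero i a =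
      DerivedCategory.Q.map (singleArrow (Scheme.Modules.pushforward i) a) ≫
        (Scheme.Modules.pushforward i).mapDerivedCategoryFactors.inv.app
          ((CochainComplex.singleFunctor Y.Modules 0).obj N) := by
  have h := (Scheme.Modules.pushforward
    i).mapDerivedCategorySingleFunctor_inv_app_mapDerivedCategoryFactors_hom_app N
  rw [singleArrow, Functor.map_comp, Category.assoc]
  have h' : ((Scheme.Modules.pushforward i).mapDerivedCategorySingleFunctor 0).inv.app N =
      DerivedCategory.Q.map (((Scheme.Modules.pushforward i).mapCochainComplexSingleFunctor
        0).inv.app N) ≫ (Scheme.Modules.pushforward i).mapDerivedCategoryFactors.inv.app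
          ((CochainComplex.singleFunctor Y.Modules 0).obj N) := by
    exact (Iso.eq_comp_inv ((Scheme.Modules.pushforward i).mapDerivedCategoryFactors.app _)).mpr h
  exact congrArg (fun t => (DerivedCategory.singleFunctor Z.Modules 0).map a ≫ t) h'

/-- For a vector bundle, the underived pullback is also the derived pullback. -/
theorem isUniversalArrow_arrowInDegreeZero {Y Z : Scheme.{u}} (i : Y ⟶ Z) [IsTopIso i]
    {M : Z.Modules} {N : Y.Modules} (a : M ⟶ (Scheme.Modules.pushforward i).obj N)
    (hM : IsVectorBundle Z M) (ha : IsUniversalArrow (Scheme.Modules.pushforward i) a) :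
    IsUniversalArrow (derivedTheory.push i) (arrowInDegreeZero i a) := by
  rw [isUniversalArrow_pushforward_iff] at ha
  rw [arrowInDegreeZero_eq]
  have := isIso_adjunct_singleArrow (Scheme.Modules.pullbackPushforwardAdjunction i) a
  refine isUniversalArrow_mapDerivedCategory (Scheme.Modules.pullbackPushforwardAdjunction i)
    (isAdapted_sectionProjective i) (singleArrow _ a) inferInstance 0 ?_
  intro P _ s hP _
  exact quasiIso_pullback i s (isLocallySectionProjective_of_prop hP)
    hM.isLocallySectionProjective 0

/-! ### Thickenings and Nakayama's lemma -/

/-- A surjective closed immersion given, on each stalk, by a nilpotent ideal. -/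
class IsThickening {X Y : Scheme.{u}} (i : X ⟶ Y) : Prop extends IsClosedImmersion i, Surjective i
    where
  isNilpotent_ker (x : X) : IsNilpotent (RingHom.ker (i.stalkMap x).hom)

instance {X Y : Scheme.{u}} (i : X ⟶ Y) [IsThickening i] : IsTopIso i :=
  isTopIso_of_closedImmersion i

instance {X Y : Scheme.{u}} (i : X ⟶ Y) [IsThickening i] (U : Y.Opens) : IsThickening (i ∣_ U) where
  toSurjective := MorphismProperty.of_isPullback (isPullback_morphismRestrict i U).flip inferInstance
  isNilpotent_ker x := by
    let e := morphismRestrictStalkMap i U x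
    obtain ⟨n, hn⟩ := IsThickening.isNilpotent_ker (i := i) x.1
    refine ⟨n, ?_⟩
    have h1 : Function.Injective e.hom.left.hom :=
      ((ConcreteCategory.isIso_iff_bijective e.hom.left).mp inferInstance).1
    have h2 : (RingHom.ker ((i ∣_ U).stalkMap x).hom).map e.hom.left.hom ≤
        RingHom.ker (i.stalkMap x.1).hom := by
      rw [Ideal.map_le_iff_le_comap]
      intro r hr
      have hw : (i.stalkMap x.1).hom (e.hom.left.hom r) =
          e.hom.right.hom (((i ∣_ U).stalkMap x).hom r) :=
        ConcreteCategory.congr_hom e.hom.w r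
      have hr' : ((i ∣_ U).stalkMap x).hom r = 0 := hr
      change (i.stalkMap x.1).hom (e.hom.left.hom r) = 0
      rw [hw, hr', map_zero]
    have h3 : (RingHom.ker ((i ∣_ U).stalkMap x).hom ^ n).map e.hom.left.hom ≤ ⊥ := by
      rw [Ideal.map_pow, ← Ideal.zero_eq_bot, ← hn]
      exact Ideal.pow_right_mono h2 n
    rw [Ideal.map_le_iff_le_comap] at h3
    refine le_bot_iff.mp fun r hr => h1 ?_
    have h4 : e.hom.left.hom r = 0 := h3 hr
    rw [h4, map_zero]

lemma exists_preimage_eq {X Y : Scheme.{u}} (i : X ⟶ Y) [IsTopIso i] (U : X.Opens) :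
    ∃ V : Y.Opens, i ⁻¹ᵁ V = U := by
  have hi := (IsTopIso.isHomeomorph (f := i)).isInducing
  obtain ⟨V, hV, hVW⟩ := hi.isOpen_iff.mp U.2
  exact ⟨⟨V, hV⟩, TopologicalSpace.Opens.ext hVW⟩

section artinian

variable {k : Type u} [Field k] {X Y : Scheme.{u}}

lemma ker_aug_le (A : ArtAlg k) :
    RingHom.ker A.aug.toRingHom ≤ IsLocalRing.maximalIdeal A :=
  IsLocalRing.le_maximalIdeal (RingHom.ker_ne_top _)

/-- The kernel of the stalk map of `i` is contained in the ideal `J` generated by the maximal ideal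
of `A`: the spectrum of the stalk modulo `J` maps to the fibre product `X`, so a function on `Y` which
vanishes on `X` lies in `J`. -/
lemma ker_stalkMap_le {A : ArtAlg k} {i : X ⟶ Y} {s : X ⟶ Spec (.of k)} {π : Y ⟶ Spec (.of A)}
    (h : IsPullback i s π A.point) [IsTopIso i] (x : X) :
    RingHom.ker (i.stalkMap x).hom ≤
      (RingHom.ker A.aug.toRingHom).map (Spec.preimage (Y.fromSpecStalk (i x) ≫ π)).hom := by
  set ψ := Spec.preimage (Y.fromSpecStalk (i x) ≫ π) with hψ
  set J := (RingHom.ker A.aug.toRingHom).map ψ.hom with hJ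
  let q : Y.presheaf.stalk (i x) ⟶ CommRingCat.of (Y.presheaf.stalk (i x) ⧸ J) :=
    CommRingCat.ofHom (Ideal.Quotient.mk J)
  have hker : RingHom.ker A.aug.toRingHom ≤ RingHom.ker (q.hom.comp ψ.hom) := fun a ha =>
    Ideal.Quotient.eq_zero_iff_mem.mpr (Ideal.mem_map_of_mem _ ha)
  let κ : k →+* Y.presheaf.stalk (i x) ⧸ J :=
    RingHom.liftOfSurjective A.aug.toRingHom A.aug_surjective ⟨q.hom.comp ψ.hom, hker⟩
  have hκ : CommRingCat.ofHom A.aug.toRingHom ≫ CommRingCat.ofHom κ = ψ ≫ q := by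
    ext a
    exact RingHom.liftOfRightInverse_comp_apply A.aug.toRingHom _
      (Function.rightInverse_surjInv A.aug_surjective)
      (⟨q.hom.comp ψ.hom, hker⟩ : { g : A →+* (Y.presheaf.stalk (i x) ⧸ J) //
        RingHom.ker A.aug.toRingHom ≤ RingHom.ker g }) a
  have w : (Spec.map q ≫ Y.fromSpecStalk (i x)) ≫ π = Spec.map (CommRingCat.ofHom κ) ≫ A.point := by
    rw [ArtAlg.point, ← Spec.map_comp, hκ, Spec.map_comp, Category.assoc, hψ, Spec.map_preimage]
  let l := h.lift _ _ w
  have hl : l ≫ i = Spec.map q ≫ Y.fromSpecStalk (i x) := h.lift_fst _ _ w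
  intro r hr
  obtain ⟨U, hU, t, rfl⟩ := TopCat.Presheaf.exists_germ_eq Y.presheaf r
  have hr' : (X.presheaf.germ (i ⁻¹ᵁ U) x hU) ((i.app U).hom t) =
      (X.presheaf.germ (i ⁻¹ᵁ U) x hU) 0 := by
    rw [map_zero]
    exact (Scheme.Hom.germ_stalkMap_apply i U x hU t).symm.trans hr
  obtain ⟨W, hW, iU, iU', hWt⟩ := TopCat.Presheaf.germ_eq X.presheaf x hU hU _ _ hr'
  obtain ⟨V, rfl⟩ := exists_preimage_eq i W
  have hle : V ≤ U := by
    intro y hy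
    obtain ⟨z, rfl⟩ := (IsTopIso.isHomeomorph (f := i)).surjective y
    exact iU.le hy
  have hgerm : Y.presheaf.germ V (i x) hW (Y.presheaf.map (homOfLE hle).op t) =
      Y.presheaf.germ U (i x) hU t := TopCat.Presheaf.germ_res_apply _ _ _ _ _
  have h0 : (i.app V).hom (Y.presheaf.map (homOfLE hle).op t) = 0 := by
    have h1 := ConcreteCategory.congr_hom (i.naturality (homOfLE hle).op) t
    refine h1.trans (Eq.trans ?_ (hWt.trans (map_zero _)))
    rfl
  have hmem : (⊤ : (Spec (CommRingCat.of (Y.presheaf.stalk (i x) ⧸ J))).Opens) ≤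
      (Spec.map q ≫ Y.fromSpecStalk (i x)) ⁻¹ᵁ V := by
    intro z _
    have hz : (Y.fromSpecStalk (i x)) (Spec.map q z) ∈ Set.range (Y.fromSpecStalk (i x)) := ⟨_, rfl⟩
    rw [Scheme.range_fromSpecStalk] at hz
    exact hz.mem_open V.2 hW
  have e1 : (Spec.map q ≫ Y.fromSpecStalk (i x)).appLE V ⊤ hmem =
      Y.presheaf.germ V (i x) hW ≫ q ≫ (Scheme.ΓSpecIso _).inv := by
    refine (Scheme.Hom.comp_appLE _ _ _ _ _).trans ?_
    refine (congrArg (fun t => t ≫ (Spec.map q).appLE (Y.fromSpecStalk (i x) ⁻¹ᵁ V) ⊤ hmem)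
      (Scheme.fromSpecStalk_app (X := Y) (x := i x) (U := V) hW)).trans ?_
    refine (Category.assoc _ _ _).trans (congrArg (fun t => Y.presheaf.germ V (i x) hW ≫ t) ?_)
    refine (Category.assoc _ _ _).trans ?_
    rw [Scheme.ΓSpecIso_inv_naturality]
    refine congrArg (fun t => (Scheme.ΓSpecIso (Y.presheaf.stalk (i x))).inv ≫ t) ?_
    refine (Scheme.Hom.map_appLE _ _ _).trans ?_
    exact (Scheme.Hom.app_eq_appLE (f := Spec.map q)).symm
  have e2 : (Spec.map q ≫ Y.fromSpecStalk (i x)).appLE V ⊤ hmem =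
      i.app V ≫ l.appLE (i ⁻¹ᵁ V) ⊤ (by rw [← hl] at hmem; exact hmem) := by
    rw [← Scheme.Hom.comp_appLE]
    congr 1
    exact hl.symm
  have e3 := ConcreteCategory.congr_hom (e1.symm.trans e2) (Y.presheaf.map (homOfLE hle).op t)
  have e4 : (Scheme.ΓSpecIso _).inv.hom (q.hom (Y.presheaf.germ V (i x) hW
      (Y.presheaf.map (homOfLE hle).op t))) = 0 := by
    refine e3.trans ((congrArg (l.appLE (i ⁻¹ᵁ V) ⊤ _).hom h0).trans (map_zero _))
  rw [hgerm] at e4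
  have e5 : Function.Injective (Scheme.ΓSpecIso
      (CommRingCat.of (Y.presheaf.stalk (i x) ⧸ J))).inv.hom :=
    ((ConcreteCategory.isIso_iff_bijective (Scheme.ΓSpecIso _).inv).mp inferInstance).1
  exact Ideal.Quotient.eq_zero_iff_mem.mp (e5 (e4.trans (map_zero _).symm))

lemma isThickening_of_isPullback {A : ArtAlg k} {i : X ⟶ Y} {s : X ⟶ Spec (.of k)}
    {π : Y ⟶ Spec (.of A)} (h : IsPullback i s π A.point) : IsThickening i := by
  have h1 : IsClosedImmersion i := MorphismProperty.of_isPullback h.flip inferInstance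
  have h2 : Surjective i := MorphismProperty.of_isPullback h.flip inferInstance
  have := isTopIso_of_closedImmersion i
  refine { h1, h2 with isNilpotent_ker := fun x => ?_ }
  have hnil := IsArtinianRing.isNilpotent_jacobson_bot (R := A)
  rw [IsLocalRing.jacobson_eq_maximalIdeal _ bot_ne_top] at hnil
  obtain ⟨n, hn⟩ := hnil
  refine ⟨n, le_bot_iff.mp ?_⟩
  refine (Ideal.pow_right_mono (ker_stalkMap_le h x) n).trans ?_
  rw [← Ideal.map_pow]
  refine (Ideal.map_mono (Ideal.pow_right_mono (ker_aug_le A) n)).trans ?_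
  rw [hn, Ideal.zero_eq_bot, Ideal.map_bot]

instance {s : X ⟶ Spec (.of k)} {A : ArtAlg k} (x : SchemeDeformation s A) : IsThickening x.i :=
  isThickening_of_isPullback x.isPullback

end artinian

section fiber

variable {X Y : Scheme.{u}} (i : X ⟶ Y) [IsThickening i]

/-- The fibre of `M` at `i x`, as a module over the stalk of the structure sheaf of `X`. -/
def stalkQuotient (M : Y.Modules) (x : X) : Type u :=
  M.presheaf.stalk (i x) ⧸
    (RingHom.ker (i.stalkMap x).hom • ⊤ :
      Submodule (Y.presheaf.stalk (i x)) (M.presheaf.stalk (i x)))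

noncomputable instance (M : Y.Modules) (x : X) : AddCommGroup (stalkQuotient i M x) :=
  inferInstanceAs (AddCommGroup (_ ⧸ _))

noncomputable instance (M : Y.Modules) (x : X) :
    Module (Y.presheaf.stalk (i x) ⧸ RingHom.ker (i.stalkMap x).hom) (stalkQuotient i M x) :=
  inferInstanceAs (Module _ (_ ⧸ _))

noncomputable instance (M : Y.Modules) (x : X) :
    Module (X.presheaf.stalk x) (stalkQuotient i M x) :=
  Module.compHom _ (RingHom.quotientKerEquivOfSurjective
    (i.stalkMap_surjective x)).symm.toRingHom

/-- The projection of the stalk onto the fibre. -/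
noncomputable def toStalkQuotient (M : Y.Modules) (x : X) :
    M.presheaf.stalk (i x) →+ stalkQuotient i M x :=
  (Submodule.mkQ _).toAddMonoidHom

lemma toStalkQuotient_smul (M : Y.Modules) (x : X) (r : Y.presheaf.stalk (i x))
    (m : M.presheaf.stalk (i x)) :
    toStalkQuotient i M x (r • m) = (i.stalkMap x).hom r • toStalkQuotient i M x m := by
  have h : (RingHom.quotientKerEquivOfSurjective (i.stalkMap_surjective x)).symm
      ((i.stalkMap x).hom r) = Ideal.Quotient.mk _ r := by
    rw [RingEquiv.symm_apply_eq]
    exact (RingHom.quotientKerEquivOfSurjective_apply_mk _ r).symm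
  refine (Module.Quotient.mk_smul_mk _ (RingHom.ker (i.stalkMap x).hom) r m).symm.trans ?_
  exact congrArg (fun t => t • toStalkQuotient i M x m) h.symm

/-- Nakayama's lemma for a thickening. No finiteness is needed because the ideals are nilpotent. The
fibres of `M` form a product sheaf on `X`, and the morphism from `M` to its pushforward is adjoint
to a morphism out of the pullback of `M`; if this vanishes, then so do the fibres. -/
theorem isZero_of_isZero_pullback (M : Y.Modules)
    (h : IsZero ((Scheme.Modules.pullback i).obj M)) : IsZero M := by
  let φ := toProductSheaf (stalkQuotient i M) i M (toStalkQuotient i M) (toStalkQuotient_smul i M)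
  have hφ : φ = 0 := by
    apply ((Scheme.Modules.pullbackPushforwardAdjunction i).homEquiv _ _).symm.injective
    exact h.eq_of_src _ _
  have hstalk (x : X) : Subsingleton (M.presheaf.stalk (i x)) := by
    have h1 : ∀ m : M.presheaf.stalk (i x), m ∈ (RingHom.ker (i.stalkMap x).hom • ⊤ :
        Submodule (Y.presheaf.stalk (i x)) (M.presheaf.stalk (i x))) := by
      intro m
      obtain ⟨U, hU, t, rfl⟩ := TopCat.Presheaf.exists_germ_eq M.presheaf m
      have h2 : φ.app U t = 0 := by rw [hφ]; rfl
      have h3 := congrFun h2 ⟨x, hU⟩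
      exact (Submodule.Quotient.mk_eq_zero _).mp h3
    obtain ⟨n, hn⟩ := IsThickening.isNilpotent_ker (i := i) x
    have h2 : (RingHom.ker (i.stalkMap x).hom • ⊤ :
        Submodule (Y.presheaf.stalk (i x)) (M.presheaf.stalk (i x))) = ⊤ :=
      eq_top_iff.mpr fun m _ => h1 m
    have h3 : ∀ n : ℕ, ((RingHom.ker (i.stalkMap x).hom) ^ n • ⊤ :
        Submodule (Y.presheaf.stalk (i x)) (M.presheaf.stalk (i x))) = ⊤ := by
      intro n
      induction n with
      | zero => rw [pow_zero, Ideal.one_eq_top, Submodule.top_smul]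
      | succ n ih => rw [pow_succ, Submodule.mul_smul, h2, ih]
    have h4 := h3 n
    rw [hn, Ideal.zero_eq_bot, Submodule.bot_smul] at h4
    exact (Submodule.subsingleton_iff _).mp (subsingleton_of_bot_eq_top h4)
  refine isZero_of_subsingleton_sections fun U => ⟨fun s t => ?_⟩
  refine TopCat.Presheaf.section_ext ⟨M.presheaf, M.isSheaf⟩ U s t fun y hy => ?_
  obtain ⟨x, rfl⟩ := (IsTopIso.isHomeomorph (f := i)).surjective y
  have := hstalk x
  exact Subsingleton.elim (α := M.presheaf.stalk (i x)) _ _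

end fiber

/-! ### The unit of the adjunction for a thickening -/

section full

variable {X Y : Scheme.{u}} (i : X ⟶ Y) [IsThickening i]

instance : (TopologicalSpace.Opens.map i.base).IsEquivalence :=
  (TopologicalSpace.Opens.mapMapIso (TopCat.isoOfHomeo
    (IsTopIso.isHomeomorph (f := i)).homeomorph)).isEquivalence_functor

/-- Morphisms between pushforwards along `i` are linear over the structure sheaf of `X`, because its
sections lift locally. -/
lemma app_smul_of_pushforward {S T : X.Modules} (f : (Scheme.Modules.pushforward i).obj S ⟶
    (Scheme.Modules.pushforward i).obj T) (V : Y.Opens) (r : Γ(X, i ⁻¹ᵁ V)) (s : Γ(S, i ⁻¹ᵁ V)) :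
    (show Γ(T, i ⁻¹ᵁ V) from f.app V (r • s : Γ(S, i ⁻¹ᵁ V))) =
      r • (show Γ(T, i ⁻¹ᵁ V) from f.app V s) := by
  refine TopCat.Presheaf.section_ext ⟨T.presheaf, T.isSheaf⟩ _ _ _ fun x hx => ?_
  obtain ⟨r', hr'⟩ := i.stalkMap_surjective x (X.presheaf.germ _ x hx r)
  obtain ⟨U, hU, t, rfl⟩ := TopCat.Presheaf.exists_germ_eq Y.presheaf r'
  have h1 : X.presheaf.germ (i ⁻¹ᵁ U) x hU ((i.app U).hom t) = X.presheaf.germ _ x hx r :=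
    (Scheme.Hom.germ_stalkMap_apply i U x hU t).symm.trans hr'
  obtain ⟨W, hW, iU, iV, hWt⟩ := TopCat.Presheaf.germ_eq X.presheaf x hU hx _ _ h1
  obtain ⟨W, rfl⟩ := exists_preimage_eq i W
  have hle {V : Y.Opens} (j : i ⁻¹ᵁ W ⟶ i ⁻¹ᵁ V) : W ≤ V := by
    intro y hy
    obtain ⟨z, rfl⟩ := (IsTopIso.isHomeomorph (f := i)).surjective y
    exact j.le hy
  let jU : W ⟶ U := homOfLE (hle iU)
  let jV : W ⟶ V := homOfLE (hle iV)
  let t' : Γ(Y, W) := Y.presheaf.map jU.op t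
  have ht' : (i.app W).hom t' = X.presheaf.map iV.op r :=
    (ConcreteCategory.congr_hom (i.naturality jU.op) t).trans hWt
  have e1 : S.presheaf.map iV.op (r • s) = (i.app W).hom t' • S.presheaf.map iV.op s :=
    (S.map_smul iV r s).trans (congrArg (fun a => a • S.presheaf.map iV.op s) ht'.symm)
  have e2 : T.presheaf.map iV.op (r • (show Γ(T, i ⁻¹ᵁ V) from f.app V s)) =
      (i.app W).hom t' • T.presheaf.map iV.op (show Γ(T, i ⁻¹ᵁ V) from f.app V s) :=
    (T.map_smul iV r _).trans (congrArg (fun a => a • T.presheaf.map iV.op _) ht'.symm)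
  have e3 (s : Γ(S, i ⁻¹ᵁ V)) : T.presheaf.map iV.op (show Γ(T, i ⁻¹ᵁ V) from f.app V s) =
      (show Γ(T, i ⁻¹ᵁ W) from f.app W (S.presheaf.map iV.op s : Γ(S, i ⁻¹ᵁ W))) :=
    (app_map f jV s).symm
  have e4 : T.presheaf.map iV.op (show Γ(T, i ⁻¹ᵁ V) from f.app V (r • s : Γ(S, i ⁻¹ᵁ V))) =
      T.presheaf.map iV.op (r • (show Γ(T, i ⁻¹ᵁ V) from f.app V s)) := by
    rw [e2, e3, e3]
    refine (congrArg (fun a : Γ(S, i ⁻¹ᵁ W) => (show Γ(T, i ⁻¹ᵁ W) from f.app W a)) e1).trans ?_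
    exact Scheme.Modules.Hom.app_smul f t' _
  refine (TopCat.Presheaf.germ_res_apply T.presheaf iV x hW _).symm.trans ?_
  exact (congrArg (T.presheaf.germ _ x hW) e4).trans
    (TopCat.Presheaf.germ_res_apply T.presheaf iV x hW _)

/-- The pushforward along a thickening is full. -/
instance : (Scheme.Modules.pushforward i).Full where
  map_surjective {S T} f := by
    let W := (Functor.whiskeringLeft _ _ Ab.{u}).obj (TopologicalSpace.Opens.map i.base).op
    obtain ⟨ψ, hψ⟩ : ∃ ψ : S.presheaf ⟶ T.presheaf, W.map ψ = f.mapPresheaf :=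
      W.map_surjective _
    have hψ' (V : Y.Opens) (s : Γ(S, i ⁻¹ᵁ V)) : ψ.app (.op (i ⁻¹ᵁ V)) s = f.app V s :=
      ConcreteCategory.congr_hom (congr_app hψ (.op V)) s
    refine ⟨⟨PresheafOfModules.homMk ψ ?_⟩, ?_⟩
    · rintro ⟨U⟩ r s
      obtain ⟨V, rfl⟩ := exists_preimage_eq i U
      refine (hψ' V _).trans ((app_smul_of_pushforward i f V r s).trans ?_)
      exact congrArg (fun t : Γ(T, i ⁻¹ᵁ V) => (show Γ(X, i ⁻¹ᵁ V) from r) • t) (hψ' V s).symm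
    · ext V s
      exact hψ' V s

/-- If the right adjoint is full, then the left adjoint maps the unit to an epimorphism. -/
lemma epi_map_unit_app {A B : Type*} [Category* A] [Category* B] {L : A ⥤ B} {R : B ⥤ A}
    (adj : L ⊣ R) [R.Full] (M : A) : Epi (L.map (adj.unit.app M)) where
  left_cancellation {T} g g' h := by
    obtain ⟨f, hf⟩ := R.map_surjective (adj.homEquiv (R.obj (L.obj M)) T g)
    obtain ⟨f', hf'⟩ := R.map_surjective (adj.homEquiv (R.obj (L.obj M)) T g')
    have h1 : adj.unit.app M ≫ R.map f = adj.unit.app M ≫ R.map f' := by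
      rw [hf, hf']
      refine (adj.homEquiv_naturality_left (adj.unit.app M) g).symm.trans ?_
      exact (congrArg _ h).trans (adj.homEquiv_naturality_left (adj.unit.app M) g')
    have h2 : f = f' := by
      apply (adj.homEquiv _ _).injective
      rw [adj.homEquiv_unit, adj.homEquiv_unit, h1]
    exact (adj.homEquiv (R.obj (L.obj M)) T).injective (hf.symm.trans ((congrArg _ h2).trans hf'))

/-- The unit of the adjunction is an epimorphism for a thickening: its cokernel is killed by the
pullback, so that Nakayama's lemma applies. -/
theorem epi_unit_app (M : Y.Modules) :
    Epi ((Scheme.Modules.pullbackPushforwardAdjunction i).unit.app M) := by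
  have h := epi_map_unit_app (Scheme.Modules.pullbackPushforwardAdjunction i) M
  refine epi_of_isZero_cokernel _ (isZero_of_isZero_pullback i _ ?_)
  exact (isZero_cokernel_of_epi ((Scheme.Modules.pullback i).map
    ((Scheme.Modules.pullbackPushforwardAdjunction i).unit.app M))).of_iso
      (PreservesCokernel.iso (Scheme.Modules.pullback i) _)

end full

/-! ### Derived pullbacks along thickenings and boundedness -/

section

universe w₁ v₁ u₁
variable {A : Type u₁} [Category.{v₁} A] [Abelian A]

lemma exactAt_single (M : A) {n : ℤ} (h : n ≠ 0) :
    ((CochainComplex.singleFunctor A 0).obj M).ExactAt n :=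
  HomologicalComplex.ExactAt.of_isZero (isZero_single_X M n h)

lemma epi_f_zero_of_quasiIso {N : CochainComplex A ℤ} {E : A}
    (ψ : N ⟶ (CochainComplex.singleFunctor A 0).obj E) [QuasiIso ψ] : Epi (ψ.f 0) := by
  let T := (CochainComplex.singleFunctor A 0).obj E
  have h1 : IsIso (T.iCycles 0) :=
    T.isIso_iCycles 0 1 (by simp) ((isZero_single_X E 1 (by simp)).eq_of_tgt _ _)
  have h2 : IsIso (T.homologyπ 0) :=
    T.isIso_homologyπ (-1) 0 (by simp) ((isZero_single_X E (-1) (by simp)).eq_of_src _ _)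
  have h3 : Epi (HomologicalComplex.cyclesMap ψ 0 ≫ T.homologyπ 0) := by
    rw [← HomologicalComplex.homologyπ_naturality]
    infer_instance
  have h4 : Epi (HomologicalComplex.cyclesMap ψ 0) := by
    have := epi_comp (HomologicalComplex.cyclesMap ψ 0 ≫ T.homologyπ 0) (inv (T.homologyπ 0))
    simpa using this
  have h5 : Epi (N.iCycles 0 ≫ ψ.f 0) := by
    rw [← HomologicalComplex.cyclesMap_i]
    exact epi_comp _ _
  exact epi_of_epi (N.iCycles 0) _

variable [HasDerivedCategory.{w₁} A]

lemma exactAt_of_iso_Q {K K' : CochainComplex A ℤ}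
    (e : DerivedCategory.Q.obj K ≅ DerivedCategory.Q.obj K') {n : ℤ} (h : K'.ExactAt n) :
    K.ExactAt n := by
  rw [HomologicalComplex.exactAt_iff_isZero_homology] at h ⊢
  let H := DerivedCategory.homologyFunctorFactors A n
  exact h.of_iso ((H.symm.app K) ≪≫ (DerivedCategory.homologyFunctor A n).mapIso e ≪≫ H.app K')

/-- A complex in degrees `≤ 0` which becomes isomorphic to an object `E` in degree `0` in the
derived category admits an actual quasi-isomorphism to `E`. -/
lemma exists_quasiIso_single {N : CochainComplex A ℤ} [N.IsStrictlyLE 0] {E : A}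
    (e : DerivedCategory.Q.obj N ≅ (DerivedCategory.singleFunctor A 0).obj E) :
    ∃ ψ : N ⟶ (CochainComplex.singleFunctor A 0).obj E, QuasiIso ψ := by
  have hGE : N.IsGE 0 := by
    rw [CochainComplex.isGE_iff]
    exact fun n hn => exactAt_of_iso_Q e (exactAt_single E hn.ne)
  obtain ⟨M, ⟨f⟩⟩ := (N.truncGE 0).exists_iso_single 0
  have e' : (DerivedCategory.singleFunctor A 0).obj M ≅ (DerivedCategory.singleFunctor A 0).obj E :=
    DerivedCategory.Q.mapIso f.symm ≪≫ (asIso (DerivedCategory.Q.map (N.πTruncGE 0))).symm ≪≫ e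
  let e'' : M ≅ E := (DerivedCategory.singleFunctor A 0).preimageIso e'
  let g : N.truncGE 0 ⟶ (CochainComplex.singleFunctor A 0).obj E :=
    f.hom ≫ (CochainComplex.singleFunctor A 0).map e''.hom
  have hg : IsIso g := by
    have h1 : IsIso ((CochainComplex.singleFunctor A 0).map e''.hom) := inferInstance
    exact @IsIso.comp_isIso _ _ _ _ _ f.hom _ inferInstance h1
  exact ⟨N.πTruncGE 0 ≫ g, inferInstance⟩

end

section resolution

variable {X Y : Scheme.{u}} (i : X ⟶ Y)

/-- If `E` is the derived pullback of `F`, given by a universal arrow, then it is computed by a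
resolution `K` of `F`. -/
lemma exists_resolution_of_isUniversalArrow [IsTopIso i] {F : DerivedCategory Y.Modules}
    {E : DerivedCategory X.Modules} (b : ℤ) [F.IsLE b] (ρ : F ⟶ (derivedTheory.push i).obj E)
    (hρ : IsUniversalArrow (derivedTheory.push i) ρ) :
    ∃ (K : CochainComplex Y.Modules ℤ) (_ : K.IsStrictlyLE b),
      (∀ n, sectionProjective Y (K.X n)) ∧ Nonempty (F ≅ DerivedCategory.Q.obj K) ∧
      Nonempty (DerivedCategory.Q.obj ((onComplexes (Scheme.Modules.pullback i)).obj K) ≅ E) := by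
  have hG := isAdapted_sectionProjective i
  have := hG.isClosedUnderIsomorphisms
  have : (sectionProjective Y).ContainsZero :=
    ⟨⟨_, isZero_zero _, hG.prop_of_isZero _ (isZero_zero _)⟩⟩
  obtain ⟨K₀, hK₀, ⟨e₀⟩⟩ := F.exists_iso_Q_obj_of_isLE b
  obtain ⟨K, hK, f, hKG, hf⟩ := exists_resolution (sectionProjective Y) hG.exists_epi K₀ b
  have e : F ≅ DerivedCategory.Q.obj K := e₀ ≪≫ (asIso (DerivedCategory.Q.map f)).symm
  refine ⟨K, hK, hKG, ⟨e⟩, ?_⟩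
  let adj := Scheme.Modules.pullbackPushforwardAdjunction i
  let θ : K ⟶ (onComplexes (Scheme.Modules.pushforward i)).obj
    ((onComplexes (Scheme.Modules.pullback i)).obj K) := coadjunct adj (𝟙 _)
  have hθ : QuasiIso (adjunct adj θ) := by
    rw [adjunct_coadjunct]
    infer_instance
  have h1 := isUniversalArrow_mapDerivedCategory adj hG θ hθ b (fun P _ s hP _ =>
    quasiIso_pullback i s (isLocallySectionProjective_of_prop hP)
      (isLocallySectionProjective_of_prop hKG) b)
  have h2 := (isUniversalArrow_iso_iff (derivedTheory.push i) e.symm ρ (Iso.refl _)).mpr hρ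
  obtain ⟨e', -⟩ := IsUniversalArrow.exists_iso h1 h2
  exact ⟨e'⟩

/-- If the derived pullback along a thickening is concentrated in degree `0`, then the cohomology of
a bounded above object vanishes in positive degrees: the highest cohomology commutes with the
pullback, and Nakayama's lemma applies. -/
lemma isLE_of_isUniversalArrow [IsThickening i] {F : DerivedCategory Y.Modules}
    {E : X.Modules} (b : ℤ) [F.IsLE b] (ρ : F ⟶ (derivedTheory.push i).obj (inDegreeZero E))
    (hρ : IsUniversalArrow (derivedTheory.push i) ρ) : F.IsLE 0 := by
  obtain ⟨K, hK, hKG, ⟨e⟩, ⟨e'⟩⟩ := exists_resolution_of_isUniversalArrow i b ρ hρ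
  have h : K.IsLE 0 := by
    rw [CochainComplex.isLE_iff]
    exact (isAdapted_sectionProjective i).exactAt_of_exactAt_map (isZero_of_isZero_pullback i)
      K b 0 hKG (fun n hn => exactAt_of_iso_Q e' (exactAt_single E hn.ne'))
  have h' : (DerivedCategory.Q.obj K).IsLE 0 := (DerivedCategory.isLE_Q_obj_iff K 0).mpr h
  rw [DerivedCategory.isLE_iff] at h' ⊢
  exact fun n hn => (h' n hn).of_iso ((DerivedCategory.homologyFunctor _ n).mapIso e)

/-- Perfect complexes on quasi-compact schemes are bounded above. -/
lemma IsPerfect.exists_isLE [CompactSpace Y] {F : DerivedCategory Y.Modules}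
    (hF : IsPerfect Y F) : ∃ b : ℤ, F.IsLE b := by
  choose U hU P hP _ hFP using hF
  choose a b hab using hP
  obtain ⟨t, ht⟩ := CompactSpace.elim_nhds_subcover (fun y => (U y : Set Y))
    (fun y => (U y).2.mem_nhds (hU y))
  obtain ⟨c, hc⟩ := (t.image b).bddAbove
  refine ⟨c, ?_⟩
  let K := DerivedCategory.Q.objPreimage F
  let e : DerivedCategory.Q.obj K ≅ F := DerivedCategory.Q.objObjPreimageIso F
  have h : K.IsLE c := by
    rw [CochainComplex.isLE_iff]
    intro n hn
    refine exactAt_of_locally K n fun x => ?_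
    obtain ⟨y, hy, hxy⟩ : ∃ y ∈ t, x ∈ U y := by
      have : x ∈ ⋃ y ∈ t, (U y : Set Y) := ht ▸ trivial
      simpa using this
    refine ⟨U y, hxy, ?_⟩
    obtain ⟨e'⟩ := hFP y
    have e'' : DerivedCategory.Q.obj ((onComplexes (Scheme.Modules.restrictFunctor (U y).ι)).obj K) ≅
        DerivedCategory.Q.obj (P y) :=
      ((Scheme.Modules.restrictFunctor (U y).ι).mapDerivedCategoryFactors.app K).symm ≪≫
      (Scheme.Modules.restrictFunctor (U y).ι).mapDerivedCategory.mapIso e ≪≫ e'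
    refine exactAt_of_iso_Q e'' (HomologicalComplex.ExactAt.of_isZero (hab y n (Or.inr ?_)))
    exact (hc (Finset.mem_coe.mpr (Finset.mem_image_of_mem b hy))).trans_lt hn
  have h' : (DerivedCategory.Q.obj K).IsLE c := (DerivedCategory.isLE_Q_obj_iff K c).mpr h
  rw [DerivedCategory.isLE_iff] at h' ⊢
  exact fun n hn => (h' n hn).of_iso ((DerivedCategory.homologyFunctor _ n).mapIso e.symm)

end resolution

/-! ### Local lifts of bases -/

section local_lift

variable {Y : Scheme.{u}}

lemma exists_local_lift {M N : Y.Modules} (q : M ⟶ N) [hq : Epi q] (U : Y.Opens) (n : Γ(N, U))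
    (y : Y) (hy : y ∈ U) : ∃ (V : Y.Opens) (i : V ⟶ U) (m : Γ(M, V)), y ∈ V ∧
      q.app V m = N.presheaf.map i.op n := by
  have h1 : Epi ((toAbSheaf Y).map q) :=
    @Functor.PreservesEpimorphisms.preserves _ _ _ _ _ (toSheaf_preservesEpi Y.ringCatSheaf) M N q hq
  have h2 := (Sheaf.isLocallySurjective_iff_epi' Ab.{u} ((toAbSheaf Y).map q)).mpr h1
  obtain ⟨V, i, ⟨m, hm⟩, hV⟩ := Presheaf.imageSieve_mem (Opens.grothendieckTopology Y)
    ((toAbSheaf Y).map q).hom n y hy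
  exact ⟨V, i, m, hV, hm⟩

/-- Morphisms out of a free module of finite rank lift locally through epimorphisms. -/
lemma exists_local_lift_free {M N : Y.Modules} (q : M ⟶ N) [Epi q] (I : Type u) [Finite I]
    (g : freeModule Y I ⟶ N) (y : Y) : ∃ V : Y.Opens, y ∈ V ∧
      ∃ φ : (freeModule Y I).restrict V.ι ⟶ M.restrict V.ι,
        φ ≫ (Scheme.Modules.restrictFunctor V.ι).map q =
          (Scheme.Modules.restrictFunctor V.ι).map g := by
  choose V i m hy hm using fun k => exists_local_lift q ⊤ (freeEquiv N I g k) y trivial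
  let W : Y.Opens := ⟨⋂ k, (V k : Set Y), isOpen_iInter_of_finite fun k => (V k).2⟩
  have hW (k : I) : W.ι ''ᵁ (W.ι ⁻¹ᵁ ⊤) ≤ V k := by
    refine (W.ι_image_le _).trans ?_
    exact fun z hz => Set.mem_iInter.mp hz k
  refine ⟨W, Set.mem_iInter.mpr hy, ?_⟩
  let adj := Scheme.Modules.restrictAdjunction W.ι
  let φ : freeModule Y I ⟶ (Scheme.Modules.pushforward W.ι).obj (M.restrict W.ι) :=
    (freeEquiv _ I).symm fun k => M.presheaf.map (homOfLE (hW k)).op (m k)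
  refine ⟨(adj.homEquiv _ _).symm φ, (adj.homEquiv _ _).injective ?_⟩
  rw [adj.homEquiv_naturality_right, Equiv.apply_symm_apply, adj.homEquiv_unit]
  refine Eq.trans ?_ (adj.unit.naturality g)
  apply (freeEquiv _ I).injective
  funext k
  refine (freeEquiv_comp _ _ k).trans (Eq.trans ?_ (freeEquiv_comp _ _ k).symm)
  have h1 : freeEquiv _ I φ k = M.presheaf.map (homOfLE (hW k)).op (m k) :=
    congrFun ((freeEquiv _ I).apply_symm_apply _) k
  have h2 := congrArg (fun t => t.hom (freeEquiv N I g k))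
    (Scheme.Modules.restrictAdjunction_unit_app_app W.ι N ⊤)
  refine (congrArg (q.app (W.ι ''ᵁ (W.ι ⁻¹ᵁ ⊤))) h1).trans (Eq.trans ?_ h2.symm)
  rw [app_map, hm]
  exact (ConcreteCategory.congr_hom (N.presheaf.map_comp (i k).op (homOfLE (hW k)).op)
    (freeEquiv N I g k)).symm

end local_lift

section square

variable {X Y X' Y' : Scheme.{u}} (p : X ⟶ Y) (p' : X' ⟶ Y') (j' : X' ⟶ X) (j : Y' ⟶ Y)
  [IsOpenImmersion j] [IsOpenImmersion j'] (h : j' ≫ p = p' ≫ j)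

lemma homEquiv_restrictPullbackIso {M : Y.Modules} {E : X.Modules}
    (τ : (Scheme.Modules.pullback p).obj M ⟶ E) :
    (Scheme.Modules.pullbackPushforwardAdjunction p').homEquiv _ _
      ((restrictPullbackIso p p' j' j h).hom.app M ≫
        (Scheme.Modules.restrictFunctor j').map τ) =
    (Scheme.Modules.restrictFunctor j).map
      ((Scheme.Modules.pullbackPushforwardAdjunction p).homEquiv _ _ τ) ≫
      (pushforwardRestrict p p' j' j h).natTrans.app E := by
  have h1 := restrict_unit_comp p p' j' j h M
  have h2 := (pushforwardRestrict p p' j' j h).natTrans.naturality τ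
  rw [Adjunction.homEquiv_unit, Adjunction.homEquiv_unit, Functor.map_comp, Functor.map_comp,
    Category.assoc]
  refine Eq.trans ?_ (congrArg (fun t => (Scheme.Modules.restrictFunctor j).map
    ((Scheme.Modules.pullbackPushforwardAdjunction p).unit.app M) ≫ t) h2.symm)
  refine (Category.assoc _ _ _).symm.trans ?_
  refine (congrArg (fun t => t ≫ (Scheme.Modules.pushforward p').map
    ((Scheme.Modules.restrictFunctor j').map τ)) h1.symm).trans ?_
  exact Category.assoc _ _ _

/-- If `φ` lifts, on an open subset, the adjunct of `υ` through the adjunct of `τ`, then its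
pullback lifts `υ` through `τ`. -/
lemma pullback_map_comp_restrictPullbackIso {P M : Y.Modules} {E : X.Modules}
    (υ : (Scheme.Modules.pullback p).obj P ⟶ E) (τ : (Scheme.Modules.pullback p).obj M ⟶ E)
    (φ : P.restrict j ⟶ M.restrict j)
    (hφ : φ ≫ (Scheme.Modules.restrictFunctor j).map
      ((Scheme.Modules.pullbackPushforwardAdjunction p).homEquiv _ _ τ) =
      (Scheme.Modules.restrictFunctor j).map
      ((Scheme.Modules.pullbackPushforwardAdjunction p).homEquiv _ _ υ)) :
    (Scheme.Modules.pullback p').map φ ≫ (restrictPullbackIso p p' j' j h).hom.app M ≫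
      (Scheme.Modules.restrictFunctor j').map τ =
    (restrictPullbackIso p p' j' j h).hom.app P ≫ (Scheme.Modules.restrictFunctor j').map υ := by
  apply ((Scheme.Modules.pullbackPushforwardAdjunction p').homEquiv _ _).injective
  rw [homEquiv_restrictPullbackIso]
  refine (Adjunction.homEquiv_naturality_left _ _ _).trans ?_
  rw [homEquiv_restrictPullbackIso, ← hφ, Category.assoc]

end square

section lift

variable {A B : Type*} [Category* A] [Abelian A] [Category* B] [Abelian B] {L : A ⥤ B} [L.Additive]
  [PreservesFiniteColimits L] {G : ObjectProperty A} (hG : IsAdapted L G)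
  (hL : ∀ M : A, IsZero (L.obj M) → IsZero M)
include hG hL

/-- A morphism of bounded above complexes of objects adapted to `L` is a quasi-isomorphism if `L`
maps it to one, provided that `L` reflects zero objects. -/
lemma quasiIso_of_quasiIso_map {P K : CochainComplex A ℤ} (b : ℤ) [P.IsStrictlyLE b]
    [K.IsStrictlyLE b] (hP : ∀ n, G (P.X n)) (hK : ∀ n, G (K.X n)) (f : P ⟶ K)
    (hf : QuasiIso ((onComplexes L).map f)) : QuasiIso f := by
  rw [quasiIso_iff_acyclic_mappingCone]
  rw [quasiIso_map_iff_acyclic] at hf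
  have := isStrictlyLE_mappingCone f b
  exact fun n => hG.exactAt_of_exactAt_map hL _ b (n - 1) (prop_mappingCone hG f hP hK)
    (fun m _ => hf m) n (by omega)

/-- If `L K` is quasi-isomorphic to an object in degree `0`, and `φ : P ⟶ K⁰` induces an isomorphism
of `L P` with this object, then `φ` induces a quasi-isomorphism from `P` in degree `0` to `K`. -/
lemma exists_quasiIso_of_lift {P : A} (hP : G P) {K : CochainComplex A ℤ} [K.IsStrictlyLE 0]
    (hK : ∀ n, G (K.X n)) {E : B}
    (ψ : (onComplexes L).obj K ⟶ (CochainComplex.singleFunctor B 0).obj E) [QuasiIso ψ]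
    (φ : P ⟶ K.X 0) (hφ : IsIso (L.map φ ≫ ψ.f 0)) :
    ∃ f : (CochainComplex.singleFunctor A 0).obj P ⟶ K, QuasiIso f := by
  have := hG.isClosedUnderIsomorphisms
  let f : (CochainComplex.singleFunctor A 0).obj P ⟶ K :=
    HomologicalComplex.mkHomFromSingle φ (fun k hk =>
      (K.isZero_of_isStrictlyLE 0 k (by have : 0 + 1 = k := hk; omega)).eq_of_tgt _ _)
  have hf : f.f 0 = (singleZeroIso A P).hom ≫ φ := HomologicalComplex.mkHomFromSingle_f φ _
  refine ⟨f, quasiIso_of_quasiIso_map hG hL 0 (fun n => ?_) hK f ?_⟩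
  · by_cases h : n = 0
    · subst h
      exact G.prop_of_iso (singleZeroIso A P).symm hP
    · exact hG.prop_of_isZero _ (isZero_single_X P n h)
  · have (n : ℤ) : IsIso (((onComplexes L).map f ≫ ψ).f n) := by
      by_cases h : n = 0
      · subst h
        have e : ((onComplexes L).map f ≫ ψ).f 0 =
            L.map (singleZeroIso A P).hom ≫ L.map φ ≫ ψ.f 0 := by
          refine (congrArg (fun t => L.map t ≫ ψ.f 0) hf).trans ?_
          rw [L.map_comp]
          exact Category.assoc _ _ _
        have h1 {X Y Z : B} (x : X ≅ Y) (y : Y ⟶ Z) [IsIso y] : IsIso (x.hom ≫ y) := inferInstance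
        exact e.symm ▸ h1 (L.mapIso (singleZeroIso A P)) (L.map φ ≫ ψ.f 0)
      · exact ⟨0, (L.map_isZero (isZero_single_X P n h)).eq_of_src _ _,
          (isZero_single_X E n h).eq_of_src _ _⟩
    have : IsIso ((onComplexes L).map f ≫ ψ) := HomologicalComplex.Hom.isIso_of_components _
    exact quasiIso_of_comp_right ((onComplexes L).map f) ψ

end lift

section local_structure

variable {X Y : Scheme.{u}} (i : X ⟶ Y)

/-- The restriction to `i⁻¹ U` of a morphism of complexes `i^* K ⟶ E`. -/
noncomputable def restrictToSingle {K : CochainComplex Y.Modules ℤ} {E : X.Modules}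
    (ψ : (onComplexes (Scheme.Modules.pullback i)).obj K ⟶
      (CochainComplex.singleFunctor X.Modules 0).obj E) (U : Y.Opens) :
    (onComplexes (Scheme.Modules.pullback (i ∣_ U))).obj
      ((onComplexes (Scheme.Modules.restrictFunctor U.ι)).obj K) ⟶
      (CochainComplex.singleFunctor (i ⁻¹ᵁ U : X.Opens).toScheme.Modules 0).obj
        (E.restrict (i ⁻¹ᵁ U).ι) :=
  (restrictPullbackComplexIso i K U).hom ≫
    (onComplexes (Scheme.Modules.restrictFunctor (i ⁻¹ᵁ U).ι)).map ψ ≫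
    ((Scheme.Modules.restrictFunctor (i ⁻¹ᵁ U).ι).mapCochainComplexSingleFunctor 0).hom.app E

lemma quasiIso_map {A B : Type*} [Category* A] [Abelian A] [Category* B] [Abelian B] (F : A ⥤ B)
    [F.Additive] [PreservesFiniteLimits F] [PreservesFiniteColimits F] {K K' : CochainComplex A ℤ}
    (f : K ⟶ K') [QuasiIso f] : QuasiIso ((onComplexes F).map f) := by
  rw [quasiIso_map_iff_acyclic]
  exact fun n => exactAt_map F ((quasiIso_iff_acyclic_mappingCone f).mp inferInstance n)

instance quasiIso_restrictToSingle {K : CochainComplex Y.Modules ℤ} {E : X.Modules}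
    (ψ : (onComplexes (Scheme.Modules.pullback i)).obj K ⟶
      (CochainComplex.singleFunctor X.Modules 0).obj E) [QuasiIso ψ] (U : Y.Opens) :
    QuasiIso (restrictToSingle i ψ U) := by
  have h1 := quasiIso_map (Scheme.Modules.restrictFunctor (i ⁻¹ᵁ U).ι) ψ
  have h2 : QuasiIso
      (((Scheme.Modules.restrictFunctor (i ⁻¹ᵁ U).ι).mapCochainComplexSingleFunctor 0).hom.app E) :=
    inferInstance
  have h3 := quasiIso_comp ((onComplexes (Scheme.Modules.restrictFunctor (i ⁻¹ᵁ U).ι)).map ψ)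
    (((Scheme.Modules.restrictFunctor (i ⁻¹ᵁ U).ι).mapCochainComplexSingleFunctor 0).hom.app E)
  exact quasiIso_comp (restrictPullbackComplexIso i K U).hom _

lemma restrictToSingle_f_zero {K : CochainComplex Y.Modules ℤ} {E : X.Modules}
    (ψ : (onComplexes (Scheme.Modules.pullback i)).obj K ⟶
      (CochainComplex.singleFunctor X.Modules 0).obj E) (U : Y.Opens) :
    (restrictToSingle i ψ U).f 0 =
      (restrictPullbackIso i (i ∣_ U) (i ⁻¹ᵁ U).ι U.ι (morphismRestrict_ι i U).symm).hom.app (K.X 0) ≫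
        (Scheme.Modules.restrictFunctor (i ⁻¹ᵁ U).ι).map
          (show (Scheme.Modules.pullback i).obj (K.X 0) ⟶ E from
            ψ.f 0 ≫ (singleZeroIso X.Modules E).hom) ≫
        (singleZeroIso _ (E.restrict (i ⁻¹ᵁ U).ι)).inv := by
  have h : (((Scheme.Modules.restrictFunctor
      (i ⁻¹ᵁ U).ι).mapCochainComplexSingleFunctor 0).hom.app E).f 0 =
      (Scheme.Modules.restrictFunctor (i ⁻¹ᵁ U).ι).map (singleZeroIso X.Modules E).hom ≫
        (singleZeroIso _ (E.restrict (i ⁻¹ᵁ U).ι)).inv :=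
    HomologicalComplex.singleMapHomologicalComplex_hom_app_self _ _ _ _
  have h' := (Scheme.Modules.restrictFunctor (i ⁻¹ᵁ U).ι).map_comp (ψ.f 0)
    (singleZeroIso X.Modules E).hom
  refine congrArg (fun t => (restrictPullbackIso i (i ∣_ U) (i ⁻¹ᵁ U).ι U.ι
    (morphismRestrict_ι i U).symm).hom.app (K.X 0) ≫ t) ?_
  refine (congrArg (fun t => (Scheme.Modules.restrictFunctor (i ⁻¹ᵁ U).ι).map (ψ.f 0) ≫ t) h).trans ?_
  refine Eq.trans ?_ (congrArg (fun t => t ≫ (singleZeroIso _ (E.restrict (i ⁻¹ᵁ U).ι)).inv) h'.symm)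
  exact (Category.assoc _ _ _).symm

/-- The pullback of a free module is free. -/
noncomputable def pullbackFreeModule (I : Type u) :
    (Scheme.Modules.pullback i).obj (freeModule Y I) ≅ freeModule X I :=
  pullbackFree i I

/-- If the derived restriction of `K` is free of finite rank, then `K` is locally free. -/
lemma exists_local_iso_of_free [IsThickening i] {K : CochainComplex Y.Modules ℤ}
    [K.IsStrictlyLE 0] (hK : ∀ n, sectionProjective Y (K.X n)) {E : X.Modules}
    (ψ : (onComplexes (Scheme.Modules.pullback i)).obj K ⟶
      (CochainComplex.singleFunctor X.Modules 0).obj E) [QuasiIso ψ] (I : Type u) [Finite I]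
    (e : E ≅ freeModule X I) (y : Y) :
    ∃ V : Y.Opens, y ∈ V ∧
      Nonempty (DerivedCategory.Q.obj ((onComplexes (Scheme.Modules.restrictFunctor V.ι)).obj K) ≅
        inDegreeZero ((freeModule Y I).restrict V.ι)) := by
  let adj := Scheme.Modules.pullbackPushforwardAdjunction i
  let τ : (Scheme.Modules.pullback i).obj (K.X 0) ⟶ E := ψ.f 0 ≫ (singleZeroIso X.Modules E).hom
  have hτ : Epi τ := by
    have := epi_f_zero_of_quasiIso ψ
    exact epi_comp (ψ.f 0) _
  have hq : Epi (adj.homEquiv _ _ τ) := by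
    have h1 := epi_unit_app i (K.X 0)
    have h2 : Epi ((Scheme.Modules.pushforward i).map τ) := inferInstance
    rw [adj.homEquiv_unit]
    exact epi_comp _ _
  let υ : (Scheme.Modules.pullback i).obj (freeModule Y I) ⟶ E :=
    (pullbackFreeModule i I ≪≫ e.symm).hom
  have hυ : IsIso υ := Iso.isIso_hom _
  obtain ⟨V, hV, φ, hφ⟩ := exists_local_lift_free (adj.homEquiv _ _ τ) I (adj.homEquiv _ _ υ) y
  refine ⟨V, hV, ?_⟩
  have hc := pullback_map_comp_restrictPullbackIso i (i ∣_ V) (i ⁻¹ᵁ V).ι V.ι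
    (morphismRestrict_ι i V).symm υ τ φ hφ
  have hiso : IsIso ((Scheme.Modules.pullback (i ∣_ V)).map φ ≫ (restrictToSingle i ψ V).f 0) := by
    rw [restrictToSingle_f_zero]
    have h1 {C : Type _} [Category C] {A₀ A₁ A₂ A₃ A₄ : C} (a : A₀ ⟶ A₁) (b : A₁ ⟶ A₂) (c : A₂ ⟶ A₃)
      (d : A₃ ≅ A₄) (h : IsIso (a ≫ b ≫ c)) : IsIso (a ≫ b ≫ c ≫ d.hom) := by
      have : IsIso ((a ≫ b ≫ c) ≫ d.hom) := inferInstance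
      simpa using this
    refine h1 _ _ _ (singleZeroIso _ (E.restrict (i ⁻¹ᵁ V).ι)).symm ?_
    exact hc.symm ▸ inferInstance
  have := isStrictlyLE_map (Scheme.Modules.restrictFunctor V.ι) K 0
  obtain ⟨f, hf⟩ := exists_quasiIso_of_lift (isAdapted_sectionProjective (i ∣_ V))
    (isZero_of_isZero_pullback (i ∣_ V)) (sectionProjective_restrict V.ι (sectionProjective_free I))
    (K := (onComplexes (Scheme.Modules.restrictFunctor V.ι)).obj K)
    (fun n => sectionProjective_restrict V.ι (hK n)) (restrictToSingle i ψ V) φ hiso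
  exact ⟨(asIso (DerivedCategory.Q.map f)).symm⟩

end local_structure

/-! ### Perfect complexes which restrict to vector bundles -/

section

variable {A B : Type*} [Category* A] [Abelian A] [Category* B] [Abelian B] [HasDerivedCategory A]
  [HasDerivedCategory B]

/-- An exact functor maps a complex isomorphic to `M` in the derived category to a complex
isomorphic to the image of `M`. -/
lemma nonempty_iso_map_of_iso_single (F : A ⥤ B) [F.Additive] [PreservesFiniteLimits F]
    [PreservesFiniteColimits F] {K : CochainComplex A ℤ} {M : A}
    (e : DerivedCategory.Q.obj K ≅ (DerivedCategory.singleFunctor A 0).obj M) :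
    Nonempty (DerivedCategory.Q.obj ((onComplexes F).obj K) ≅
      (DerivedCategory.singleFunctor B 0).obj (F.obj M)) :=
  ⟨(F.mapDerivedCategoryFactors.app K).symm ≪≫ F.mapDerivedCategory.mapIso e ≪≫
    (F.mapDerivedCategorySingleFunctor 0).app M⟩

end

section

variable {X Y : Scheme.{u}}

/-- A sheaf of modules is a vector bundle if it is locally isomorphic to a free module on an open
subset of an open subset. -/
lemma isVectorBundle_of_locally {M : Y.Modules}
    (h : ∀ y : Y, ∃ (U : Y.Opens) (V : U.toScheme.Opens) (y' : V) (n : ℕ), U.ι (V.ι y') = y ∧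
      Nonempty ((M.restrict U.ι).restrict V.ι ≅
        (freeModule U.toScheme (ULift.{u} (Fin n))).restrict V.ι)) :
    IsVectorBundle Y M := by
  intro y
  obtain ⟨U, V, y', n, rfl, ⟨e⟩⟩ := h y
  let W := U.ι ''ᵁ V
  let a : W.toScheme ⟶ V := (U.ι.isoImage V).inv
  have ha : (a ≫ V.ι) ≫ U.ι = W.ι := by
    rw [Category.assoc]
    exact Scheme.Hom.isoImage_inv_ι _ _
  refine ⟨W, ⟨_, y'.2, rfl⟩, n, ⟨?_⟩⟩
  let e1 : M.restrict W.ι ≅ (M.restrict U.ι).restrict (a ≫ V.ι) :=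
    (Scheme.Modules.restrictFunctorCongr ha.symm).app M ≪≫
      (Scheme.Modules.restrictFunctorComp (a ≫ V.ι) U.ι).app M
  let e2 : (M.restrict U.ι).restrict (a ≫ V.ι) ≅
      (freeModule U.toScheme (ULift.{u} (Fin n))).restrict (a ≫ V.ι) :=
    (Scheme.Modules.restrictFunctorComp a V.ι).app _ ≪≫
      (Scheme.Modules.restrictFunctor a).mapIso e ≪≫
      ((Scheme.Modules.restrictFunctorComp a V.ι).app _).symm
  exact e1 ≪≫ e2 ≪≫ (Scheme.Modules.restrictFunctorIsoPullback (a ≫ V.ι)).app _ ≪≫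
    pullbackFreeModule (a ≫ V.ι) _

variable (i : X ⟶ Y) [IsThickening i]

/-- A perfect complex whose derived restriction along a thickening is a vector bundle in degree `0`
is itself a vector bundle in degree `0`. -/
theorem exists_isVectorBundle_of_isPerfect [CompactSpace Y] {F : DerivedCategory Y.Modules}
    (hF : IsPerfect Y F) {E : X.Modules} (hE : IsVectorBundle X E)
    (ρ : F ⟶ (derivedTheory.push i).obj (inDegreeZero E))
    (hρ : IsUniversalArrow (derivedTheory.push i) ρ) :
    ∃ M : Y.Modules, IsVectorBundle Y M ∧ Nonempty (F ≅ inDegreeZero M) := by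
  -- `F` is represented by a complex `K` in degrees `≤ 0` of modules adapted to the pullback, and
  -- the pullback of `K` maps quasi-isomorphically to `E`.
  obtain ⟨b, hb⟩ := hF.exists_isLE
  have h0 := isLE_of_isUniversalArrow i b ρ hρ
  obtain ⟨K, hK, hKG, ⟨e⟩, ⟨e'⟩⟩ := exists_resolution_of_isUniversalArrow i 0 ρ hρ
  have := isStrictlyLE_map (Scheme.Modules.pullback i) K 0
  obtain ⟨ψ, hψ⟩ := exists_quasiIso_single e'
  -- Where `E` is free, its basis lifts locally to `K` in degree `0`, and makes `K` free.
  have hloc : ∀ y : Y, ∃ U : Y.Opens, y ∈ U ∧ ∃ n : ℕ, ∀ z : U, ∃ V : U.toScheme.Opens, z ∈ V ∧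
      Nonempty (DerivedCategory.Q.obj ((onComplexes (Scheme.Modules.restrictFunctor V.ι)).obj
        ((onComplexes (Scheme.Modules.restrictFunctor U.ι)).obj K)) ≅
        inDegreeZero ((freeModule U.toScheme (ULift.{u} (Fin n))).restrict V.ι)) := by
    intro y
    obtain ⟨x, rfl⟩ := i.surjective y
    obtain ⟨U, hU, n, ⟨e⟩⟩ := hE x
    obtain ⟨U, rfl⟩ := exists_preimage_eq i U
    have := isStrictlyLE_map (Scheme.Modules.restrictFunctor U.ι) K 0
    exact ⟨U, hU, n, fun z => exists_local_iso_of_free (i ∣_ U)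
      (K := (onComplexes (Scheme.Modules.restrictFunctor U.ι)).obj K)
      (fun n => sectionProjective_restrict U.ι (hKG n)) (restrictToSingle i ψ U) _ e z⟩
  have hex : ∀ n, n ≠ 0 → K.ExactAt n := by
    intro n hn
    refine exactAt_of_locally K n fun y => ?_
    obtain ⟨U, hU, r, h⟩ := hloc y
    refine ⟨U, hU, exactAt_of_locally _ n fun z => ?_⟩
    obtain ⟨V, hV, ⟨e⟩⟩ := h z
    exact ⟨V, hV, exactAt_of_iso_Q e (exactAt_single _ hn)⟩
  have hGE : (DerivedCategory.Q.obj K).IsGE 0 := by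
    rw [DerivedCategory.isGE_Q_obj_iff, CochainComplex.isGE_iff]
    exact fun n hn => hex n hn.ne
  have hLE : (DerivedCategory.Q.obj K).IsLE 0 := inferInstance
  obtain ⟨M, ⟨f⟩⟩ := DerivedCategory.exists_iso_singleFunctor_obj_of_isGE_of_isLE
    (DerivedCategory.Q.obj K) 0
  refine ⟨M, isVectorBundle_of_locally fun y => ?_, ⟨e ≪≫ f⟩⟩
  obtain ⟨U, hU, n, h⟩ := hloc y
  obtain ⟨V, hV, ⟨g⟩⟩ := h ⟨y, hU⟩
  refine ⟨U, V, ⟨⟨y, hU⟩, hV⟩, n, rfl, ?_⟩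
  obtain ⟨f₁⟩ := nonempty_iso_map_of_iso_single (Scheme.Modules.restrictFunctor U.ι) f
  obtain ⟨f₂⟩ := nonempty_iso_map_of_iso_single (Scheme.Modules.restrictFunctor V.ι) f₁
  exact ⟨(DerivedCategory.singleFunctor V.toScheme.Modules 0).preimageIso (f₂.symm ≪≫ g)⟩

end

/-! ### Quasi-compactness, and arrows in degree zero -/

section compact

variable {k : Type u} [Field k] {X : Scheme.{u}}

lemma quasiCompact_projectiveSpaceStr (n : ℕ) : QuasiCompact (projectiveSpaceStr k n) := by
  let 𝒜 := MvPolynomial.homogeneousSubmodule (Fin (n + 1)) k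
  have : IsScalarTower k (𝒜 0) (MvPolynomial (Fin (n + 1)) k) :=
    ⟨fun a b c => smul_mul_assoc a (b : MvPolynomial (Fin (n + 1)) k) c⟩
  have : Algebra.FiniteType (𝒜 0) (MvPolynomial (Fin (n + 1)) k) :=
    Algebra.FiniteType.of_restrictScalars_finiteType k _ _
  have h1 : QuasiCompact (Proj.toSpecZero 𝒜) := inferInstance
  exact MorphismProperty.comp_mem _ _ _ h1 inferInstance

/-- Projective schemes over a field are quasi-compact. -/
lemma compactSpace_of_isProjective {s : X ⟶ Spec (.of k)} (hs : IsProjective s) :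
    CompactSpace X := by
  obtain ⟨n, j, hj, rfl⟩ := hs
  have := quasiCompact_projectiveSpaceStr (k := k) n
  have h : QuasiCompact (j ≫ projectiveSpaceStr k n) := inferInstance
  exact (quasiCompact_iff_compactSpace (f := j ≫ projectiveSpaceStr k n)).mp h

lemma compactSpace_of_isTopIso {Y : Scheme.{u}} (i : X ⟶ Y) [IsTopIso i] [CompactSpace X] :
    CompactSpace Y :=
  (IsTopIso.isHomeomorph (f := i)).homeomorph.compactSpace

end compact

section perfect

variable {Y : Scheme.{u}}

lemma IsVectorBundle.of_iso {M N : Y.Modules} (e : M ≅ N) (h : IsVectorBundle Y M) :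
    IsVectorBundle Y N := by
  intro y
  obtain ⟨U, hU, n, ⟨f⟩⟩ := h y
  exact ⟨U, hU, n, ⟨(Scheme.Modules.restrictFunctor U.ι).mapIso e.symm ≪≫ f⟩⟩

lemma isZero_freeModule (I : Type u) [IsEmpty I] : IsZero (freeModule Y I) := by
  rw [IsZero.iff_id_eq_zero]
  exact (freeEquiv _ I).injective (Subsingleton.elim _ _)

lemma isVectorBundle_of_isZero {M : Y.Modules} (h : IsZero M) : IsVectorBundle Y M :=
  fun _ => ⟨⊤, trivial, 0, ⟨((Scheme.Modules.restrictFunctor _).map_isZero h).iso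
    (isZero_freeModule _)⟩⟩

lemma IsVectorBundle.isPerfect {M : Y.Modules} (h : IsVectorBundle Y M) :
    IsPerfect Y (inDegreeZero M) := by
  intro y
  have h' : IsVectorBundle _ (M.restrict (⊤ : Y.Opens).ι) :=
    (h.pullback (⊤ : Y.Opens).ι).of_iso
      ((Scheme.Modules.restrictFunctorIsoPullback (⊤ : Y.Opens).ι).symm.app M)
  refine ⟨⊤, trivial, (CochainComplex.singleFunctor _ 0).obj (M.restrict (⊤ : Y.Opens).ι),
    ⟨0, 0, fun n hn => isZero_single_X _ n (by omega)⟩, fun n => ?_,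
    ⟨((Scheme.Modules.restrictFunctor (⊤ : Y.Opens).ι).mapDerivedCategorySingleFunctor 0).app M⟩⟩
  by_cases hn : n = 0
  · subst hn
    exact h'.of_iso (singleZeroIso _ _).symm
  · exact isVectorBundle_of_isZero (isZero_single_X _ n hn)

end perfect

section arrows

variable {X Y Z : Scheme.{u}}

lemma arrowInDegreeZero_comp (i : Y ⟶ Z) [IsTopIso i] {M : Z.Modules} {N N' : Y.Modules}
    (a : M ⟶ (Scheme.Modules.pushforward i).obj N) (g : N ⟶ N') :
    arrowInDegreeZero i (a ≫ (Scheme.Modules.pushforward i).map g) =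
      arrowInDegreeZero i a ≫ (derivedTheory.push i).map
        ((DerivedCategory.singleFunctor Y.Modules 0).map g) := by
  have h := ((Scheme.Modules.pushforward i).mapDerivedCategorySingleFunctor 0).inv.naturality g
  refine (congrArg (fun t => t ≫ ((Scheme.Modules.pushforward
    i).mapDerivedCategorySingleFunctor 0).inv.app N')
      ((DerivedCategory.singleFunctor Z.Modules 0).map_comp a _)).trans ?_
  refine (Category.assoc _ _ _).trans (Eq.trans ?_ (Category.assoc _ _ _).symm)
  exact congrArg (fun t => (DerivedCategory.singleFunctor Z.Modules 0).map a ≫ t) h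

/-- Placing modules in degree `0` is fully faithful. -/
lemma arrowInDegreeZero_bijective (i : Y ⟶ Z) [IsTopIso i] (M : Z.Modules) (N : Y.Modules) :
    Function.Bijective (fun a : M ⟶ (Scheme.Modules.pushforward i).obj N =>
      arrowInDegreeZero i a) := by
  let e := ((Scheme.Modules.pushforward i).mapDerivedCategorySingleFunctor 0).symm.app N
  have h1 : Function.Bijective fun t : inDegreeZero M ⟶ (DerivedCategory.singleFunctor
      Z.Modules 0).obj ((Scheme.Modules.pushforward i).obj N) => t ≫ e.hom :=
    (e.homToEquiv (Z := inDegreeZero M)).bijective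
  exact h1.comp ((Functor.FullyFaithful.ofFullyFaithful
    (DerivedCategory.singleFunctor Z.Modules 0)).homEquiv.bijective)

/-- An arrow of modules is universal if it is universal in the derived category: test on objects in
degree `0`. -/
lemma isUniversalArrow_of_arrowInDegreeZero (i : Y ⟶ Z) [IsTopIso i] {M : Z.Modules}
    {N : Y.Modules} (a : M ⟶ (Scheme.Modules.pushforward i).obj N)
    (h : IsUniversalArrow (derivedTheory.push i) (arrowInDegreeZero i a)) :
    IsUniversalArrow (Scheme.Modules.pushforward i) a := by
  intro T
  have h1 := (h (inDegreeZero T)).comp (Functor.FullyFaithful.ofFullyFaithful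
    (DerivedCategory.singleFunctor Y.Modules 0)).homEquiv.bijective
  rw [← (arrowInDegreeZero_bijective i M T).of_comp_iff']
  refine (iff_of_eq (congrArg _ (funext fun g => ?_))).mpr h1
  exact arrowInDegreeZero_comp i a g

lemma singleArrow_comp {C₁ C₂ C₃ : Type*} [Category* C₁] [Abelian C₁] [Category* C₂] [Abelian C₂]
    [Category* C₃] [Abelian C₃] {F : C₁ ⥤ C₂} {G : C₂ ⥤ C₃} {H : C₁ ⥤ C₃}
    [F.Additive] [G.Additive] [H.Additive] (κ : F ⋙ G ≅ H) {M : C₃} {N : C₂} {E : C₁}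
    (b : M ⟶ G.obj N) (c : N ⟶ F.obj E) :
    singleArrow G b ≫ (onComplexes G).map (singleArrow F c) ≫
      (complexComp κ).hom.app ((CochainComplex.singleFunctor C₁ 0).obj E) =
    singleArrow H (b ≫ G.map c ≫ κ.hom.app E) := by
  ext n
  by_cases h : n = 0
  · subst h
    have h1 := κ.hom.naturality (singleZeroIso C₁ E).inv
    refine (congrArg₂ (· ≫ ·) (singleArrow_f_zero b) (congrArg₂ (· ≫ ·)
      (congrArg (fun t => G.map t) (singleArrow_f_zero c)) rfl)).trans
        (Eq.trans ?_ (singleArrow_f_zero _).symm)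
    have h2 {W : C₃} (x : W ⟶ M) {N' : C₂} (e : N' ≅ N) {T : C₃} {E' : C₁} (y : E ⟶ E')
        (z : G.obj (F.obj E') ⟶ T) : (x ≫ b ≫ G.map e.inv) ≫ G.map (e.hom ≫ c ≫ F.map y) ≫ z =
        x ≫ (b ≫ G.map c) ≫ G.map (F.map y) ≫ z := by
      simp
    refine (h2 _ (singleZeroIso C₂ N) (singleZeroIso C₁ E).inv (κ.hom.app _)).trans ?_
    refine congrArg (fun t => (singleZeroIso C₃ M).hom ≫ t) ?_
    refine (congrArg (fun t => (b ≫ G.map c) ≫ t) h1).trans ?_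
    simp
  · exact (isZero_single_X M n h).eq_of_src _ _

/-- `arrowInDegreeZero` is compatible with compositions of pushforwards. -/
lemma arrowInDegreeZero_pushComp (f : X ⟶ Y) (g : Y ⟶ Z) (h : X ⟶ Z) [IsTopIso f] [IsTopIso g]
    [IsTopIso h] (w : f ≫ g = h) {M : Z.Modules} {N : Y.Modules} {E : X.Modules}
    (b : M ⟶ (Scheme.Modules.pushforward g).obj N) (c : N ⟶ (Scheme.Modules.pushforward f).obj E) :
    arrowInDegreeZero g b ≫ (derivedTheory.push g).map (arrowInDegreeZero f c) ≫
      (derivedTheory.pushComp f g h w).hom.app (inDegreeZero E) =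
    arrowInDegreeZero h (b ≫ (Scheme.Modules.pushforward g).map c ≫
      (modulesPushComp f g h w).hom.app E) := by
  let F := Scheme.Modules.pushforward f
  let G := Scheme.Modules.pushforward g
  let H := Scheme.Modules.pushforward h
  let K := (CochainComplex.singleFunctor X.Modules 0).obj E
  let S := (CochainComplex.singleFunctor Y.Modules 0).obj N
  have h1 : (derivedTheory.pushComp f g h w).hom.app (inDegreeZero E) = _ :=
    derivedComp_hom_app (modulesPushComp f g h w) K
  have h2 := G.mapDerivedCategoryFactors_hom_naturality (singleArrow F c)
  have h3 := congrArg DerivedCategory.Q.map (singleArrow_comp (modulesPushComp f g h w) b c)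
  rw [Functor.map_comp, Functor.map_comp] at h3
  rw [h1]
  rw [arrowInDegreeZero_eq g b, arrowInDegreeZero_eq f c, arrowInDegreeZero_eq h, ← h3]
  have h4 : (derivedTheory.push g).map (DerivedCategory.Q.map (singleArrow F c) ≫
      F.mapDerivedCategoryFactors.inv.app K) =
      G.mapDerivedCategory.map (DerivedCategory.Q.map (singleArrow F c)) ≫
        G.mapDerivedCategory.map (F.mapDerivedCategoryFactors.inv.app K) :=
    G.mapDerivedCategory.map_comp _ _
  have h5 : G.mapDerivedCategory.map (F.mapDerivedCategoryFactors.inv.app K) ≫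
      G.mapDerivedCategory.map (F.mapDerivedCategoryFactors.hom.app K) = 𝟙 _ := by
    rw [← Functor.map_comp, Iso.inv_hom_id_app]
    exact G.mapDerivedCategory.map_id _
  have h6 : G.mapDerivedCategoryFactors.inv.app S ≫ G.mapDerivedCategoryFactors.hom.app S = 𝟙 _ :=
    Iso.inv_hom_id_app _ _
  have key {D : Type _} [Category D] {a₀ a₁ a₂ a₃ a₄ a₅ a₆ a₇ : D} (x : a₀ ⟶ a₁) (ginv : a₁ ⟶ a₂)
      (gq : a₂ ⟶ a₃) (finv : a₃ ⟶ a₄) (fhom : a₄ ⟶ a₃) (gh : a₃ ⟶ a₅) (ghom : a₂ ⟶ a₁)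
      (q : a₁ ⟶ a₅) (y : a₅ ⟶ a₆) (z : a₆ ⟶ a₇) (v : a₂ ⟶ a₄) (e4 : v = gq ≫ finv)
      (e2 : gq ≫ gh = ghom ≫ q) (e5 : finv ≫ fhom = 𝟙 _) (e6 : ginv ≫ ghom = 𝟙 _) :
      (x ≫ ginv) ≫ v ≫ fhom ≫ gh ≫ y ≫ z = (x ≫ q ≫ y) ≫ z := by
    simp [e4, reassoc_of% e2, reassoc_of% e5, reassoc_of% e6]
  exact key _ _ _ _ _ _ (G.mapDerivedCategoryFactors.hom.app S) _ _ _ _ h4 h2 h5 h6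

end arrows

/-! ### Comparison of the deformation functors -/

namespace Deformation

variable {k : Type u} [Field k] {X : Scheme.{u}} {s : X ⟶ Spec (.of k)} {E : X.Modules}
  {A B : ArtAlg k}

/-- The deformation of `E` as an object of the derived category given by a deformation of `E` as a
vector bundle: the bundle is placed in degree `0`. -/
noncomputable def toDerived (x : Deformation modulesTheory.{u} IsVectorBundle s E A) :
    Deformation derivedTheory.{u} IsPerfect s (inDegreeZero E) A :=
  ⟨x.base, inDegreeZero (Y := x.base.total) x.F, IsVectorBundle.isPerfect x.prop,
    arrowInDegreeZero x.base.i x.ρ, isUniversalArrow_arrowInDegreeZero _ _ x.prop x.isUniversal⟩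

/-- Placing bundles in degree `0` preserves and reflects base change and isomorphism. -/
lemma arrow_toDerived_iff {f : A ⟶ B} (x : Deformation modulesTheory.{u} IsVectorBundle s E A)
    (y : Deformation modulesTheory.{u} IsVectorBundle s E B) :
    Arrow f x.toDerived y.toDerived ↔ Arrow f x y := by
  constructor
  · rintro ⟨(φ : SchemeDeformation.Hom f x.base y.base), a, ha, h⟩
    obtain ⟨b, rfl⟩ := (arrowInDegreeZero_bijective φ.p x.F y.F).2 a
    refine ⟨φ, b, isUniversalArrow_of_arrowInDegreeZero φ.p b ha, ?_⟩
    exact (arrowInDegreeZero_bijective x.base.i x.F E).1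
      ((arrowInDegreeZero_pushComp y.base.i φ.p x.base.i φ.comm b y.ρ).symm.trans h)
  · rintro ⟨φ, a, ha, h⟩
    exact ⟨φ, arrowInDegreeZero φ.p a, isUniversalArrow_arrowInDegreeZero φ.p a x.prop ha,
      (arrowInDegreeZero_pushComp y.base.i φ.p x.base.i φ.comm a y.ρ).trans
        (congrArg (fun t => arrowInDegreeZero x.base.i t) h)⟩

/-- An isomorphism of the object underlying a deformation with another object `G` turns the
deformation into an isomorphic one with underlying object `G`. -/
lemma arrow_of_iso {T : PushforwardTheory.{v, u}} {P : ∀ Y : Scheme.{u}, T.Cat Y → Prop}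
    {E : T.Cat X} (x : Deformation T P s E A) {G : T.Cat x.base.total} (hG : P _ G) (e : x.F ≅ G) :
    ∃ h, Arrow (𝟙 A) x ⟨x.base, G, hG, e.inv ≫ x.ρ, h⟩ := by
  have h : IsUniversalArrow (T.push x.base.i) (e.inv ≫ x.ρ) := by
    simpa using (isUniversalArrow_iso_iff (T.push x.base.i) e.symm x.ρ (Iso.refl _)).mpr
      x.isUniversal
  refine ⟨h, ?_⟩
  obtain ⟨φ, a, ha, hc⟩ := Arrow.refl (⟨x.base, G, hG, e.inv ≫ x.ρ, h⟩ : Deformation T P s E A)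
  refine ⟨φ, e.hom ≫ a, ?_, ?_⟩
  · simpa using (isUniversalArrow_iso_iff (T.push φ.p) e a (Iso.refl _)).mpr ha
  · refine (Category.assoc _ _ _).trans ((congrArg (fun t => e.hom ≫ t) hc).trans ?_)
    exact e.hom_inv_id_assoc _

/-- Every deformation of `E` as an object of the derived category is isomorphic to one which comes
from a deformation of `E` as a vector bundle. -/
lemma exists_arrow_toDerived [CompactSpace X] (hE : IsVectorBundle X E)
    (y : Deformation derivedTheory.{u} IsPerfect s (inDegreeZero E) A) :
    ∃ x : Deformation modulesTheory.{u} IsVectorBundle s E A, Arrow (𝟙 A) y x.toDerived := by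
  have : CompactSpace y.base.total := compactSpace_of_isTopIso y.base.i
  obtain ⟨M, hM, ⟨e⟩⟩ := exists_isVectorBundle_of_isPerfect y.base.i y.prop hE y.ρ y.isUniversal
  obtain ⟨h, ha⟩ := y.arrow_of_iso (IsVectorBundle.isPerfect hM) e
  obtain ⟨r, hr⟩ := (arrowInDegreeZero_bijective y.base.i M E).2 (e.inv ≫ y.ρ)
  have key : ∀ (q : inDegreeZero M ⟶ (derivedTheory.push y.base.i).obj (inDegreeZero E))
      (hq : IsUniversalArrow (derivedTheory.push y.base.i) q),
      Arrow (𝟙 A) y ⟨y.base, inDegreeZero M, IsVectorBundle.isPerfect hM, q, hq⟩ →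
      arrowInDegreeZero y.base.i r = q →
      ∃ x : Deformation modulesTheory.{u} IsVectorBundle s E A, Arrow (𝟙 A) y x.toDerived := by
    rintro q hq h rfl
    exact ⟨⟨y.base, M, hM, r, isUniversalArrow_of_arrowInDegreeZero _ _ hq⟩, h⟩
  exact key _ h ha hr

/-- The base change of a deformation of `E` as an object of the derived category is computed on
an isomorphic deformation of `E` as a vector bundle. -/
lemma hasBaseChange_derived [CompactSpace X] (hE : IsVectorBundle X E) :
    HasBaseChange derivedTheory.{u} IsPerfect s (inDegreeZero E) := by
  intro A B f y
  obtain ⟨x, hx⟩ := exists_arrow_toDerived hE y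
  obtain ⟨x', hx'⟩ := hasBaseChange_vectorBundle s E f x
  exact ⟨x'.toDerived, by simpa using hx.comp ((arrow_toDerived_iff x x').mpr hx')⟩

/-- Placing a vector bundle in degree `0`, on isomorphism classes of deformations. -/
noncomputable def quotientToDerived (s : X ⟶ Spec (.of k)) (E : X.Modules) (A : ArtAlg k) :
    Quotient (setoid modulesTheory.{u} IsVectorBundle s E A) →
      Quotient (setoid derivedTheory.{u} IsPerfect s (inDegreeZero E) A) :=
  Quotient.map toDerived fun x y h => (arrow_toDerived_iff x y).mpr h

lemma quotientToDerived_bijective [CompactSpace X] (hE : IsVectorBundle X E) (A : ArtAlg k) :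
    Function.Bijective (quotientToDerived s E A) := by
  constructor
  · intro p q
    refine Quotient.inductionOn₂ p q fun x y h => ?_
    exact Quotient.sound ((arrow_toDerived_iff x y).mp (Quotient.exact h))
  · intro q
    refine Quotient.inductionOn q fun y => ?_
    obtain ⟨x, hx⟩ := exists_arrow_toDerived hE y
    exact ⟨Quotient.mk _ x, (Quotient.sound
      (s := setoid derivedTheory.{u} IsPerfect s (inDegreeZero E) A) hx).symm⟩

/-- Placing a vector bundle in degree `0`, as an isomorphism of deformation functors. -/
noncomputable def isoDerived [CompactSpace X] (hE : IsVectorBundle X E) :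
    vectorBundleDeformationFunctor s E ≅
      derivedDeformationFunctor s E (hasBaseChange_derived hE) :=
  NatIso.ofComponents
    (fun A => (Equiv.ofBijective _ (quotientToDerived_bijective (s := s) hE A)).toIso) (by
      intro A B f
      ext p
      refine Quotient.inductionOn p fun x => ?_
      exact (Quotient.sound (s := setoid derivedTheory.{u} IsPerfect s (inDegreeZero E) B)
        ((hasBaseChange_derived hE f x.toDerived).choose_spec.unique ((arrow_toDerived_iff x _).mpr
          (hasBaseChange_vectorBundle s E f x).choose_spec))).symm)

end Deformation

end PairDeformation

theorem corollary4p3 {k : Type u} [Field k] [IsAlgClosed k] [CharZero k] {X : Scheme.{u}}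
    (s : X ⟶ Spec (.of k)) [IsIntegral X] [Smooth s] (hs : IsProjective s)
    (E : X.Modules) (hE : IsVectorBundle X E) :
    ∃ (h : Deformation.HasBaseChange derivedTheory.{u} IsPerfect s (inDegreeZero E))
      (η : vectorBundleDeformationFunctor s E ≅ derivedDeformationFunctor s E h),
      ∀ (A : ArtAlg k) (x : Deformation modulesTheory.{u} IsVectorBundle s E A),
        ∃ (hP : IsPerfect x.base.total (inDegreeZero (Y := x.base.total) x.F))
          (hρ : IsUniversalArrow (derivedTheory.push x.base.i) (arrowInDegreeZero x.base.i x.ρ)),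
          η.hom.app A (Quotient.mk _ x) =
            Quotient.mk (Deformation.setoid derivedTheory IsPerfect s (inDegreeZero E) A)
              ⟨x.base, inDegreeZero (Y := x.base.total) x.F, hP, arrowInDegreeZero x.base.i x.ρ, hρ⟩ := by
  have : CompactSpace X := compactSpace_of_isProjective hs
  exact ⟨Deformation.hasBaseChange_derived hE, Deformation.isoDerived hE, fun A x =>
    ⟨IsVectorBundle.isPerfect x.prop,
      isUniversalArrow_arrowInDegreeZero _ _ x.prop x.isUniversal, rfl⟩⟩
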